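/- Let $\alpha,\gamma,\vartheta>0$, $\rho\in(0,1)$, $\nu\in[0,1]$, $\lambda\in(0,2)$, $p\in\mathbb R$, $\omega\in\mathbb C$, and let $g:\mathbb R\to\mathbb C$ be continuous and integrable with integrable Fourier transform $g^*(k)=\int_{\mathbb R}g(x)e^{ikx}\,dx$. Let $$E^{c}_{a,b}(z)=\sum_{j\ge 0}\frac{(c)_j}{\Gamma(aj+b)}\frac{z^j}{j!},\qquad (I^{c}_{a,b,\omega,0^+}f)(t)=\int_0^t (t-\tau)^{b-1}E^{c}_{a,b}(\omega(t-\tau)^a)f(\tau)\,d\tau$$ be the three-parameter Mittag-Leffler function and the Prabhakar integral (with $I^{0}_{a,0,\omega,0^+}$ the identity), and let $${}^C D^{\gamma,\rho,\nu}_{\alpha,\omega,0^+}f=I^{-\gamma\nu}_{\alpha,\nu(1-\rho),\omega,0^+}\,I^{-\gamma(1-\nu)}_{\alpha,(1-\nu)(1-\rho),\omega,0^+}\,\frac{df}{dt}$$ be the regularized Hilfer–Prabhakar derivative, taken in the variable $t$. The fractional Laplacian $\Delta^{\lambda/2}$, in the variable $x$, is the Fourier multiplier with symbol $-|k|^\lambda$: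 if $f(x)=\frac1{2\pi}\int F(k)e^{-ikx}\,dk$ with $F$ and $|k|^\lambda F$ integrable, then $\Delta^{\lambda/2}f(x)=-\frac1{2\pi}\int|k|^\lambda F(k)e^{-ikx}\,dk$. Consider the problem $${}^C D^{\gamma,\rho,\nu}_{\alpha,\omega,0^+}\psi(x,t)=-p\,\partial_x\psi(x,t)+\vartheta\,\Delta^{\lambda/2}\psi(x,t)\quad(x\in\mathbb R,\ t>0),$$ $$\psi(x,0)=\psi(x,0^+)=g(x)\quad (x\in\mathbb R),\qquad \lim_{|x|\to\infty}\psi(x,t)=0\quad (t\ge0).$$ A solution is a function $\psi:\mathbb R\times[0,\infty)\to\mathbb C$ satisfying these conditions pointwise, such that for $t>0$ all terms of the equation exist (the integrals in the fractional time derivative converging absolutely, the inner one at every positive time; $\partial_x\psi$ is required to exist only if $p\neq0$), $\partial_t\psi$ exists for $t>0$, and $|\partial_t\psi(x,t)|\le m(t)$ for all $x\in\mathbb R$, $t>0$, with some $m$ (depending on $\psi$) that is integrable on $(0,b]$ for every $b>0$. Then, for all $k\in\mathbb R$ and $t\ge0$, the series $$u(k,t)=\sum_{n=0}^\infty t^{\rho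 n}\,(ipk-\vartheta|k|^\lambda)^n\,E^{\gamma n}_{\alpha,\rho n+1}(\omega t^\alpha)\qquad(0^0=1)$$ converges absolutely, $u(\cdot,t)\,g^*$ is integrable for every $t\ge0$, and $$\psi(x,t)=\frac1{2\pi}\int_{-\infty}^{\infty}e^{-ikx}\,u(k,t)\,g^*(k)\,dk$$ is a solution of the problem. It is the only solution. -/

import Mathlib

open Filter Topology MeasureTheory

/-- The three-parameter Mittag-Leffler (Prabhakar) function
`E^γ_{α,β}(z) = ∑_k (γ)_k z^k / (Γ(α k + β) k!)`, where `(γ)_k` is the rising factorial. -/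
noncomputable def mittagLeffler (α β γ : ℝ) (z : ℂ) : ℂ :=
  ∑' k : ℕ, (((ascPochhammer ℝ k).eval γ / (Real.Gamma (α * k + β) * (k.factorial : ℝ)) : ℝ) : ℂ)
    * z ^ k

/-- The Prabhakar kernel `e^γ_{α,β,ω}(t) = t^{β-1} E^γ_{α,β}(ω t^α)`, for `t > 0`. -/
noncomputable def prabhakarKernel (α β γ : ℝ) (ω : ℂ) (t : ℝ) : ℂ :=
  ((t ^ (β - 1) : ℝ) : ℂ) * mittagLeffler α β γ (ω * ((t ^ α : ℝ) : ℂ))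

open Classical in
/-- The Prabhakar fractional integral
`(I^γ_{α,β,ω,0+} f)(t) = ∫_0^t (t-τ)^{β-1} E^γ_{α,β}(ω (t-τ)^α) f(τ) dτ`;
for `β = γ = 0` it is the identity, by the usual convention. -/
noncomputable def prabhakarIntegral (α β γ : ℝ) (ω : ℂ) (f : ℝ → ℂ) (t : ℝ) : ℂ :=
  if β = 0 ∧ γ = 0 then f t
  else ∫ τ in (0 : ℝ)..t, prabhakarKernel α β γ ω (t - τ) * f τ

/-- The integral that defines `prabhakarIntegral α β γ ω f t` converges absolutely. -/
def PrabhakarIntegrable (α β γ : ℝ) (ω : ℂ) (f : ℝ → ℂ) (t : ℝ) : Prop :=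
  (β = 0 ∧ γ = 0) ∨
    IntervalIntegrable (fun τ => prabhakarKernel α β γ ω (t - τ) * f τ) volume 0 t

/-- The regularized Hilfer-Prabhakar derivative
`^C D^{γ,ρ,ν}_{α,ω,0+} f = I^{-γν}_{α,ν(1-ρ),ω,0+} I^{-γ(1-ν)}_{α,(1-ν)(1-ρ),ω,0+} (df/dt)`. -/
noncomputable def regHilferPrabhakar (γ ρ ν α : ℝ) (ω : ℂ) (f : ℝ → ℂ) (t : ℝ) : ℂ :=
  prabhakarIntegral α (ν * (1 - ρ)) (-(γ * ν)) ω
    (prabhakarIntegral α ((1 - ν) * (1 - ρ)) (-(γ * (1 - ν))) ω (deriv f)) t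

/-- Both integrals in `regHilferPrabhakar γ ρ ν α ω f t` converge absolutely
(the inner one at every positive time), so that its value is a genuine one. -/
def HasRegHilferPrabhakar (γ ρ ν α : ℝ) (ω : ℂ) (f : ℝ → ℂ) (t : ℝ) : Prop :=
  (∀ s : ℝ, 0 < s →
    PrabhakarIntegrable α ((1 - ν) * (1 - ρ)) (-(γ * (1 - ν))) ω (deriv f) s) ∧
  PrabhakarIntegrable α (ν * (1 - ρ)) (-(γ * ν)) ω
    (prabhakarIntegral α ((1 - ν) * (1 - ρ)) (-(γ * (1 - ν))) ω (deriv f)) t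

/-- The Fourier transform `f*(k) = ∫ f(x) e^{ikx} dx`. -/
noncomputable def fourierT (f : ℝ → ℂ) (k : ℝ) : ℂ :=
  ∫ x : ℝ, f x * Complex.exp (Complex.I * k * x)

/-- The inverse Fourier transform `(1/2π) ∫ F(k) e^{-ikx} dk`. -/
noncomputable def invFourierT (F : ℝ → ℂ) (x : ℝ) : ℂ :=
  (1 / (2 * (Real.pi : ℂ))) * ∫ k : ℝ, F k * Complex.exp (-(Complex.I * k * x))

/-- `h = Δ^{lam/2} f`, the fractional Laplacian of order `lam`, i.e. the Fourier multiplier with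
symbol `-|k|^lam`: `f` has an integrable Fourier transform `F` for which `|k|^lam F` is
integrable too, and the Fourier transform of `h` is `-|k|^lam F`. -/
def HasFracLaplacian (lam : ℝ) (f h : ℝ → ℂ) : Prop :=
  ∃ F : ℝ → ℂ, Integrable F ∧ Integrable (fun k : ℝ => ((|k| ^ lam : ℝ) : ℂ) * F k) ∧
    (∀ x, f x = invFourierT F x) ∧
    (∀ x, h x = invFourierT (fun k : ℝ => -((|k| ^ lam : ℝ) : ℂ) * F k) x)

/-- `ψ(x,t)`, `x ∈ ℝ`, `t ≥ 0`, solves the Cauchy problem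
`^C D^{γ,ρ,ν}_{α,ω,0+} ψ = -p ∂_x ψ + ϑ Δ^{lam/2} ψ` for `t > 0`, `ψ(x,0+) = g(x)`,
`ψ(x,t) → 0` as `|x| → ∞`. -/
structure IsCauchySolution (γ ρ ν α : ℝ) (ω : ℂ) (p ϑ lam : ℝ) (g : ℝ → ℂ)
    (ψ : ℝ → ℝ → ℂ) : Prop where
  /-- Time differentiability. -/
  diff_t : ∀ x t : ℝ, 0 < t → DifferentiableAt ℝ (ψ x) t
  /-- The time derivative is bounded, uniformly in `x`, by a function that is integrable on
  every `(0,b]`; together with the initial condition, every `ψ x` is then absolutely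
  continuous on every `[0,b]`. -/
  dom_t : ∃ m : ℝ → ℝ, (∀ b : ℝ, 0 < b → IntegrableOn m (Set.Ioc 0 b)) ∧
    ∀ x t : ℝ, 0 < t → ‖deriv (ψ x) t‖ ≤ m t
  /-- Existence of the fractional time derivative. -/
  frac_t : ∀ x t : ℝ, 0 < t → HasRegHilferPrabhakar γ ρ ν α ω (ψ x) t
  /-- Space differentiability (for `p = 0` there is no first order term). -/
  diff_x : p ≠ 0 → ∀ x t : ℝ, 0 < t → DifferentiableAt ℝ (fun y => ψ y t) x
  /-- The equation. -/
  equation : ∀ t : ℝ, 0 < t → ∃ h : ℝ → ℂ, HasFracLaplacian lam (fun y => ψ y t) h ∧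
    ∀ x : ℝ, regHilferPrabhakar γ ρ ν α ω (ψ x) t
      = -(p : ℂ) * deriv (fun y => ψ y t) x + (ϑ : ℂ) * h x
  /-- The initial condition. -/
  initial : ∀ x : ℝ, ψ x 0 = g x ∧ Tendsto (ψ x) (𝓝[>] 0) (𝓝 (g x))
  /-- The condition at infinity. -/
  decay : ∀ t : ℝ, 0 ≤ t → Tendsto (fun x => ψ x t) (cocompact ℝ) (𝓝 0)

/-- The `n`-th term `t^{ρn} (ipk - ϑ|k|^lam)^n E^{γn}_{α,ρn+1}(ω t^α)`. -/
noncomputable def symbolTerm (γ ρ α : ℝ) (ω : ℂ) (p ϑ lam : ℝ) (k t : ℝ) (n : ℕ) : ℂ :=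
  ((t ^ (ρ * n) : ℝ) : ℂ) * (Complex.I * p * k - ϑ * ((|k| ^ lam : ℝ) : ℂ)) ^ n
    * mittagLeffler α (ρ * n + 1) (γ * n) (ω * ((t ^ α : ℝ) : ℂ))

/-! Reduction. In the Fourier variable the problem becomes one scalar Volterra problem per
frequency, with the number a = `spaceSymbol`, Re a ≤ 0, in place of the spatial operator. The two
Prabhakar integrals merge into one convolution with the kernel e^{-γ}_{α,1-ρ,ω}
(`halfConv_prabhakarKernel`, `regHilferPrabhakar_eq`), whose Laplace transform is φ(s)/s with φ(s) =
s^ρ (1 - ω s^{-α})^γ. Hence u = 1 + ∫ r, where r has Laplace transform a/(φ - a); the geometric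
series in a/φ is the Mittag-Leffler series of the theorem (`laplaceT_resKernel`). Identities between
such series are verified on the Laplace side and pulled back by uniqueness of the transform.

Existence needs bounds of r that are uniform in a, and these the series does not give. Far to the
right, φ stays in a sector strictly inside the right half-plane, so |φ - a| is at least a constant
times |s|^ρ + |a|. Inverting the second derivative of a/(φ - a), the transform of t² r, along Re s =
R + 1/t yields `exists_resKernel_bound`. The majorant `resBound` is at most 1/t and has time
integral at most 1/ρ, whatever a is (`integral_resBound_le`): this dominates the time derivative of
ψ. The resolvent equation `halfConv_resKernel` then bounds a·u uniformly in a for each t > 0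
(`ResBounds.exists_mul_le`), so u absorbs the spatial operator and g needs no smoothness.

Uniqueness. The difference of two solutions is averaged in x against a kernel whose Fourier
transform is a smooth cutoff vanishing near 0 and near infinity. On such averages the spatial
operator is convolution with an L¹ function, hence bounded (`IsNullSolution.halfConv_average`). They
therefore satisfy a Volterra equation with a weakly singular kernel and vanish, by contraction in an
exponentially weighted norm (`IsNullSolution.average_eq_zero`). Letting the cutoff tend to 1 gives
the claim. -/

/-! ### Laplace transforms: absolute convergence and differentiation. -/

/-- The Laplace transform `∫_0^∞ e^{-st} f(t) dt`. -/
noncomputable def laplaceT (f : ℝ → ℂ) (s : ℂ) : ℂ :=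
  ∫ t in Set.Ioi (0 : ℝ), Complex.exp (-s * t) * f t

/-- The Laplace transform of `f` converges absolutely for `re s > x₀`. -/
def LaplaceAdm (f : ℝ → ℂ) (x₀ : ℝ) : Prop :=
  ∀ s : ℂ, x₀ < s.re → IntegrableOn (fun t : ℝ => Complex.exp (-s * t) * f t) (Set.Ioi 0)

namespace LaplaceAdm

variable {f : ℝ → ℂ} {x₀ : ℝ}

lemma aestronglyMeasurable (h : LaplaceAdm f x₀) :
    AEStronglyMeasurable f (volume.restrict (Set.Ioi 0)) := by
  have h1 := (h ((x₀ + 1 : ℝ) : ℂ) (by simp)).aestronglyMeasurable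
  have h2 : AEStronglyMeasurable (fun t : ℝ => Complex.exp (((x₀ + 1 : ℝ) : ℂ) * t))
    (volume.restrict (Set.Ioi 0)) := by
    refine Continuous.aestronglyMeasurable ?_
    fun_prop
  refine (h2.mul h1).congr (ae_of_all _ fun t => ?_)
  simp only [Pi.mul_apply]
  rw [← mul_assoc, ← Complex.exp_add, neg_mul, add_neg_cancel, Complex.exp_zero, one_mul]

lemma of_norm (hm : AEStronglyMeasurable f (volume.restrict (Set.Ioi 0)))
    (h : ∀ x : ℝ, x₀ < x → IntegrableOn (fun t : ℝ => Real.exp (-x * t) * ‖f t‖) (Set.Ioi 0)) :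
    LaplaceAdm f x₀ := fun s hs => by
  refine Integrable.mono' (h s.re hs) ?_ (ae_of_all _ fun t => ?_)
  · exact AEStronglyMeasurable.mul (Continuous.aestronglyMeasurable (by fun_prop)) hm
  · rw [norm_mul, Complex.norm_exp]; simp

lemma norm_integrable (h : LaplaceAdm f x₀) {x : ℝ} (hx : x₀ < x) :
    IntegrableOn (fun t : ℝ => Real.exp (-x * t) * ‖f t‖) (Set.Ioi 0) := by
  refine (h (x : ℂ) (by simpa using hx)).norm.congr (ae_of_all _ fun t => ?_)
  simp only [norm_mul, Complex.norm_exp]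
  simp

/-- The factor t costs an arbitrarily small exponential, δ t ≤ e^{δt}, and half of the distance from
x to x₀ is available for it. -/
lemma mul_id (h : LaplaceAdm f x₀) : LaplaceAdm (fun t => (t : ℂ) * f t) x₀ := by
  refine of_norm ?_ fun x hx => ?_
  · exact AEStronglyMeasurable.mul (Continuous.aestronglyMeasurable (by fun_prop))
      h.aestronglyMeasurable
  · set δ := (x - x₀) / 2 with hδ
    have hδ0 : 0 < δ := by rw [hδ]; linarith
    refine Integrable.mono' ((h.norm_integrable (x := x - δ) (by rw [hδ]; linarith)).const_mul δ⁻¹)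
      ?_ ?_
    · exact AEStronglyMeasurable.mul (Continuous.aestronglyMeasurable (by fun_prop))
        (AEStronglyMeasurable.mul (Continuous.aestronglyMeasurable (by fun_prop))
          h.aestronglyMeasurable).norm
    · filter_upwards [ae_restrict_mem measurableSet_Ioi] with t ht
      have ht0 : (0 : ℝ) < t := ht
      rw [Real.norm_of_nonneg (by positivity), norm_mul, Complex.norm_real,
        Real.norm_of_nonneg ht0.le]
      have h1 : δ * t ≤ Real.exp (δ * t) := by linarith [Real.add_one_le_exp (δ * t)]
      have h2 : Real.exp (-(x - δ) * t) = Real.exp (-x * t) * Real.exp (δ * t) := by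
        rw [← Real.exp_add]; ring_nf
      rw [h2]
      have h3 : t ≤ δ⁻¹ * Real.exp (δ * t) := by
        rw [← div_eq_inv_mul, le_div_iff₀ hδ0]; linarith
      calc Real.exp (-x * t) * (t * ‖f t‖)
          ≤ Real.exp (-x * t) * (δ⁻¹ * Real.exp (δ * t) * ‖f t‖) := by gcongr
        _ = _ := by ring

lemma hasDerivAt (h : LaplaceAdm f x₀) {s : ℂ} (hs : x₀ < s.re) :
    HasDerivAt (laplaceT f) (-laplaceT (fun t => (t : ℂ) * f t) s) s := by
  set δ := (s.re - x₀) / 2 with hδ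
  have hδ0 : 0 < δ := by rw [hδ]; linarith
  have key := hasDerivAt_integral_of_dominated_loc_of_deriv_le
    (μ := volume.restrict (Set.Ioi (0 : ℝ))) (F := fun (s : ℂ) (t : ℝ) => Complex.exp (-s * t) * f t)
    (F' := fun (s : ℂ) (t : ℝ) => -(Complex.exp (-s * t) * ((t : ℂ) * f t))) (x₀ := s)
    (s := Metric.ball s δ) (bound := fun t => Real.exp (-(s.re - δ) * t) * ‖(t : ℂ) * f t‖)
    (Metric.ball_mem_nhds s hδ0)
    (Eventually.of_forall fun s => AEStronglyMeasurable.mul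
      (Continuous.aestronglyMeasurable (by fun_prop)) h.aestronglyMeasurable)
    (h s hs) (h.mul_id s hs).aestronglyMeasurable.neg ?_
    (h.mul_id.norm_integrable (by rw [hδ]; linarith)) ?_
  · have := key.2
    rwa [integral_neg] at this
  · filter_upwards [ae_restrict_mem measurableSet_Ioi] with t ht w hw
    have ht0 : (0 : ℝ) < t := ht
    rw [norm_neg, norm_mul, Complex.norm_exp]
    have h1 : s.re - δ ≤ w.re := by
      have := (Complex.abs_re_le_norm (w - s)).trans_lt (mem_ball_iff_norm.mp hw)
      rw [Complex.sub_re] at this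
      linarith [(abs_lt.mp this).1]
    have h2 : (-w * t).re = -w.re * t := by simp
    rw [h2]
    gcongr
  · refine ae_of_all _ fun t w _ => ?_
    have h1 : HasDerivAt (fun w : ℂ => Complex.exp (-w * t)) (Complex.exp (-w * t) * (-1 * t)) w :=
      ((hasDerivAt_id w).neg.mul_const (t : ℂ)).cexp
    convert! h1.mul_const (f t) using 1
    ring

end LaplaceAdm

/-! ### Riemann-Liouville kernels: bounds uniform in the exponent, Laplace transforms. -/

/-- The Riemann-Liouville kernel `t^{b-1} / Γ(b)`. -/
noncomputable def rlKernel (b t : ℝ) : ℝ := t ^ (b - 1) / Real.Gamma b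

lemma rlKernel_nonneg {b t : ℝ} (hb : 0 < b) (ht : 0 ≤ t) : 0 ≤ rlKernel b t :=
  div_nonneg (Real.rpow_nonneg ht _) (Real.Gamma_pos_of_pos hb).le

lemma measurable_rlKernel (b : ℝ) : Measurable (rlKernel b) := by
  unfold rlKernel; fun_prop

lemma continuousOn_rlKernel (b : ℝ) : ContinuousOn (rlKernel b) (Set.Ioi 0) := by
  unfold rlKernel
  exact (continuousOn_id.rpow_const fun x hx => Or.inl (ne_of_gt hx)).div_const _

lemma rlKernel_succ {b t : ℝ} (hb : 0 < b) (ht : 0 < t) :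
    rlKernel b t = b / t * rlKernel (b + 1) t := by
  have h1 := (Real.Gamma_pos_of_pos hb).ne'
  rw [rlKernel, rlKernel, Real.Gamma_add_one hb.ne', show b + 1 - 1 = (b - 1) + 1 by ring,
    Real.rpow_add_one ht.ne']
  field_simp

/-- A lower bound for Γ(b) without Stirling's formula: in ∫ τ^{b-1} e^{-yτ} dτ = y^{-b} Γ(b) only
the interval (t, t+1] is kept, where the integrand is at least t^{b-1} e^{-y(t+1)} since b ≥ 1. -/
lemma rlKernel_le_of_one_le {b y t : ℝ} (hb : 1 ≤ b) (hy : 0 < y) (ht : 0 < t) :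
    rlKernel b t ≤ Real.exp (y * (t + 1)) * y ^ (-b) := by
  have hb0 : 0 < b := by linarith
  have hG := Real.Gamma_pos_of_pos hb0
  have hI := Real.integral_rpow_mul_exp_neg_mul_Ioi hb0 hy
  -- The integral of a non-integrable function is 0 by convention, so a positive value proves
  -- integrability.
  have hint : IntegrableOn (fun τ : ℝ => τ ^ (b - 1) * Real.exp (-(y * τ))) (Set.Ioi 0) := by
    by_contra h
    rw [integral_undef h] at hI
    have : 0 < (1 / y) ^ b * Real.Gamma b := by positivity
    linarith
  have h1 : t ^ (b - 1) * Real.exp (-(y * (t + 1))) ≤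
      ∫ τ in Set.Ioc t (t + 1), τ ^ (b - 1) * Real.exp (-(y * τ)) := by
    have h := setIntegral_ge_of_const_le_real (μ := volume) (s := Set.Ioc t (t + 1))
      (f := fun τ : ℝ => τ ^ (b - 1) * Real.exp (-(y * τ)))
      (c := t ^ (b - 1) * Real.exp (-(y * (t + 1)))) measurableSet_Ioc (by simp)
      (fun x hx => by
        have hx1 := hx.1
        have hx2 := hx.2
        have : t ^ (b - 1) ≤ x ^ (b - 1) := Real.rpow_le_rpow ht.le hx1.le (by linarith)
        have h2 : Real.exp (-(y * (t + 1))) ≤ Real.exp (-(y * x)) := by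
          apply Real.exp_le_exp.mpr; nlinarith
        have : 0 ≤ x ^ (b - 1) := Real.rpow_nonneg (by linarith) _
        gcongr)
      (hint.mono_set fun x hx => lt_trans ht hx.1)
    simpa using h
  have h2 : ∫ τ in Set.Ioc t (t + 1), τ ^ (b - 1) * Real.exp (-(y * τ)) ≤
      (1 / y) ^ b * Real.Gamma b := by
    rw [← hI]
    refine setIntegral_mono_set hint ?_ (ae_of_all _ fun x hx => lt_trans ht hx.1)
    filter_upwards [ae_restrict_mem measurableSet_Ioi] with x hx
    exact mul_nonneg (Real.rpow_nonneg (le_of_lt hx) _) (Real.exp_pos _).le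
  have h3 := h1.trans h2
  rw [rlKernel, div_le_iff₀ hG]
  rw [Real.exp_neg, one_div, Real.inv_rpow hy.le, ← Real.rpow_neg hy.le,
    mul_inv_le_iff₀ (Real.exp_pos _)] at h3
  linarith

/-- The constant in the bound of the Riemann-Liouville kernels by exponentials. -/
noncomputable def rlConst (y : ℝ) : ℝ := (1 + 1 / y) * Real.exp (2 * y)

lemma rlConst_pos {y : ℝ} (hy : 0 < y) : 0 < rlConst y := by unfold rlConst; positivity

/-- For b < 1 the previous bound is applied to b + 1; the factor b/t is at most 1 and the shift of
the exponent costs 1/y. -/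
lemma rlKernel_le_of_one_le_right {b y t : ℝ} (hb : 0 < b) (hy : 0 < y) (ht : 1 ≤ t) :
    rlKernel b t ≤ (1 + 1 / y) * (Real.exp (y * (t + 1)) * y ^ (-b)) := by
  have ht0 : 0 < t := by linarith
  have hyb := Real.rpow_pos_of_pos hy (-b)
  have hpos : 0 < Real.exp (y * (t + 1)) * y ^ (-b) := by positivity
  have h1y : 0 < 1 / y := by positivity
  rcases le_or_gt 1 b with h | h
  · have := rlKernel_le_of_one_le h hy ht0
    nlinarith
  · rw [rlKernel_succ hb ht0]
    have h2 := rlKernel_le_of_one_le (b := b + 1) (by linarith) hy ht0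
    rw [neg_add, Real.rpow_add hy, Real.rpow_neg_one, ← mul_assoc] at h2
    have h3 : b / t ≤ 1 := by rw [div_le_one ht0]; linarith
    have h4 := rlKernel_nonneg (b := b + 1) (by linarith) ht0.le
    rw [one_div]
    rw [one_div] at h1y
    nlinarith

/-- The dependence on b sits in y^{-b} alone. A series of such kernels is therefore controlled by
the same sum ∑ |C_i| y^{-b_i} that controls its Laplace transform. For t < 1 the power is compared
with t^{β-1}, and 1/Γ(b) is the kernel at t = 1. -/
lemma rlKernel_le {β b y t : ℝ} (hβ : 0 < β) (hb : β ≤ b) (hy : 0 < y) (ht : 0 < t) :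
    rlKernel b t ≤ rlConst y * (t ^ (β - 1) + 1) * Real.exp (y * t) * y ^ (-b) := by
  have hb0 : 0 < b := by linarith
  have hyb := Real.rpow_pos_of_pos hy (-b)
  have htb := Real.rpow_pos_of_pos ht (β - 1)
  have hc := rlConst_pos hy
  rcases le_or_gt 1 t with h | h
  · refine (rlKernel_le_of_one_le_right hb0 hy h).trans ?_
    have h1 : (1 + 1 / y) * (Real.exp (y * (t + 1)) * y ^ (-b)) ≤
        rlConst y * 1 * Real.exp (y * t) * y ^ (-b) := by
      have : Real.exp (y * (t + 1)) ≤ Real.exp (2 * y) * Real.exp (y * t) := by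
        rw [← Real.exp_add]; apply Real.exp_le_exp.mpr; nlinarith
      rw [rlConst]
      calc _ ≤ (1 + 1 / y) * ((Real.exp (2 * y) * Real.exp (y * t)) * y ^ (-b)) := by gcongr
        _ = _ := by ring
    refine h1.trans ?_
    gcongr
    linarith
  · have h1 := rlKernel_le_of_one_le_right hb0 hy le_rfl
    rw [rlKernel, Real.one_rpow] at h1
    have h2 : t ^ (b - 1) ≤ t ^ (β - 1) :=
      Real.rpow_le_rpow_of_exponent_ge ht h.le (by linarith)
    have h3 : 1 ≤ Real.exp (y * t) := Real.one_le_exp (by positivity)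
    calc rlKernel b t = t ^ (b - 1) * (1 / Real.Gamma b) := by rw [rlKernel]; ring
      _ ≤ t ^ (β - 1) * ((1 + 1 / y) * (Real.exp (y * (1 + 1)) * y ^ (-b))) := by
        have := Real.Gamma_pos_of_pos hb0
        gcongr
      _ = rlConst y * t ^ (β - 1) * 1 * y ^ (-b) := by
        rw [rlConst, show y * (1 + 1) = 2 * y by ring]; ring
      _ ≤ _ := by gcongr; linarith

lemma integral_rexp_mul_rlKernel {b x : ℝ} (hb : 0 < b) (hx : 0 < x) :
    IntegrableOn (fun t => Real.exp (-x * t) * rlKernel b t) (Set.Ioi 0) ∧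
    ∫ t in Set.Ioi (0 : ℝ), Real.exp (-x * t) * rlKernel b t = x ^ (-b) := by
  have hI := Real.integral_rpow_mul_exp_neg_mul_Ioi hb hx
  have hG := Real.Gamma_pos_of_pos hb
  have h2 : ∫ t in Set.Ioi (0 : ℝ), Real.exp (-x * t) * rlKernel b t = x ^ (-b) := by
    have : ∀ t : ℝ, Real.exp (-x * t) * rlKernel b t =
        (Real.Gamma b)⁻¹ * (t ^ (b - 1) * Real.exp (-(x * t))) := fun t => by
      rw [rlKernel, neg_mul]; ring
    simp only [this]
    rw [integral_const_mul, hI, one_div, Real.inv_rpow hx.le, ← Real.rpow_neg hx.le]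
    field_simp
  refine ⟨?_, h2⟩
  by_contra h
  rw [integral_undef h] at h2
  have := Real.rpow_pos_of_pos hx (-b)
  linarith

lemma laplaceAdm_rlKernel {b : ℝ} (hb : 0 < b) : LaplaceAdm (fun t => (rlKernel b t : ℂ)) 0 := by
  refine LaplaceAdm.of_norm ?_ fun x hx => ?_
  · exact (Complex.measurable_ofReal.comp (measurable_rlKernel _)).aestronglyMeasurable
  · refine (integral_rexp_mul_rlKernel hb hx).1.congr ?_
    filter_upwards [ae_restrict_mem measurableSet_Ioi] with t ht
    rw [Complex.norm_real, Real.norm_of_nonneg (rlKernel_nonneg hb (le_of_lt ht))]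

/-- Both sides are holomorphic in the right half-plane and agree on the positive axis by Euler's
integral, so the identity theorem applies. -/
lemma laplaceT_rlKernel {b : ℝ} (hb : 0 < b) {s : ℂ} (hs : 0 < s.re) :
    laplaceT (fun t => (rlKernel b t : ℂ)) s = s ^ (-b : ℂ) := by
  have hopen : IsOpen {s : ℂ | 0 < s.re} := isOpen_lt continuous_const Complex.continuous_re
  have hf : AnalyticOnNhd ℂ (laplaceT fun t => (rlKernel b t : ℂ)) {s : ℂ | 0 < s.re} :=
    DifferentiableOn.analyticOnNhd
      (fun s hs => ((laplaceAdm_rlKernel hb).hasDerivAt hs).differentiableAt.differentiableWithinAt)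
      hopen
  have hg : AnalyticOnNhd ℂ (fun s : ℂ => s ^ (-b : ℂ)) {s : ℂ | 0 < s.re} :=
    DifferentiableOn.analyticOnNhd
      (fun s hs => (differentiableAt_id.cpow_const (Or.inl hs)).differentiableWithinAt) hopen
  have hc : IsPreconnected {s : ℂ | 0 < s.re} := (convex_halfSpace_re_gt 0).isPreconnected
  have hreal : ∀ x : ℝ, 0 < x → laplaceT (fun t => (rlKernel b t : ℂ)) x = (x : ℂ) ^ (-b : ℂ) := by
    intro x hx
    rw [← Complex.ofReal_neg, ← Complex.ofReal_cpow hx.le, ← (integral_rexp_mul_rlKernel hb hx).2,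
      laplaceT, ← integral_complex_ofReal]
    push_cast
    rfl
  refine hf.eqOn_of_preconnected_of_frequently_eq hg hc (z₀ := 1) (by simp) ?_ hs
  -- Positive reals that accumulate at 1 without reaching it.
  have ht : Tendsto (fun n : ℕ => ((1 + 1 / ((n : ℝ) + 1) : ℝ) : ℂ)) atTop (𝓝[≠] 1) := by
    refine tendsto_nhdsWithin_iff.mpr ⟨?_, Eventually.of_forall fun n => ?_⟩
    · have : Tendsto (fun n : ℕ => 1 + 1 / ((n : ℝ) + 1)) atTop (𝓝 (1 + 0)) :=
        tendsto_const_nhds.add tendsto_one_div_add_atTop_nhds_zero_nat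
      simpa [Function.comp_def] using (Complex.continuous_ofReal.tendsto _).comp this
    · have : (0 : ℝ) < 1 / ((n : ℝ) + 1) := by positivity
      simp only [Set.mem_compl_iff, Set.mem_singleton_iff]
      rw [← Complex.ofReal_one, Complex.ofReal_inj]
      linarith
  exact ht.frequently (Frequently.of_forall fun n => hreal _ (by positivity))

/-! ### Generalized power series and their termwise Laplace transforms. -/

/-- The generalized power series `∑ C_i t^{b_i - 1} / Γ(b_i)`. -/
noncomputable def gseries {ι : Type*} (C : ι → ℂ) (b : ι → ℝ) (t : ℝ) : ℂ :=
  ∑' i, C i * (rlKernel (b i) t : ℂ)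

/-- The series `∑ C_i s^{-b_i}` converges absolutely at `s = y`, and the exponents are at least
`β > 0`. -/
structure GAdm {ι : Type*} (C : ι → ℂ) (b : ι → ℝ) (β y : ℝ) : Prop where
  pos : 0 < β
  le : ∀ i, β ≤ b i
  ypos : 0 < y
  summable : Summable fun i => ‖C i‖ * y ^ (-b i)

namespace GAdm

variable {ι κ : Type*} {C : ι → ℂ} {b : ι → ℝ} {β y : ℝ}

lemma bpos (h : GAdm C b β y) (i : ι) : 0 < b i := h.pos.trans_le (h.le i)

lemma mono (h : GAdm C b β y) {x : ℝ} (hx : y ≤ x) : GAdm C b β x := by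
  refine ⟨h.pos, h.le, h.ypos.trans_le hx, ?_⟩
  refine Summable.of_nonneg_of_le (fun i => ?_) (fun i => ?_) h.summable
  · exact mul_nonneg (norm_nonneg _) (Real.rpow_nonneg (h.ypos.le.trans hx) _)
  · exact mul_le_mul_of_nonneg_left
      (Real.rpow_le_rpow_of_nonpos h.ypos hx (by linarith [h.bpos i])) (norm_nonneg _)

/-- The value at `y` of the series of absolute values. -/
noncomputable def total (C : ι → ℂ) (b : ι → ℝ) (y : ℝ) : ℝ := ∑' i, ‖C i‖ * y ^ (-b i)

lemma norm_term_le (h : GAdm C b β y) {t : ℝ} (ht : 0 < t) (i : ι) :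
    ‖C i * (rlKernel (b i) t : ℂ)‖ ≤
      rlConst y * (t ^ (β - 1) + 1) * Real.exp (y * t) * (‖C i‖ * y ^ (-b i)) := by
  rw [norm_mul, Complex.norm_real, Real.norm_of_nonneg (rlKernel_nonneg (h.bpos i) ht.le)]
  calc _ ≤ ‖C i‖ * (rlConst y * (t ^ (β - 1) + 1) * Real.exp (y * t) * y ^ (-b i)) :=
        mul_le_mul_of_nonneg_left (rlKernel_le h.pos (h.le i) h.ypos ht) (norm_nonneg _)
    _ = _ := by ring

lemma summable_norm (h : GAdm C b β y) {t : ℝ} (ht : 0 < t) :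
    Summable fun i => ‖C i * (rlKernel (b i) t : ℂ)‖ :=
  Summable.of_nonneg_of_le (fun _ => norm_nonneg _) (h.norm_term_le ht) (h.summable.mul_left _)

lemma summable_term (h : GAdm C b β y) {t : ℝ} (ht : 0 < t) :
    Summable fun i => C i * (rlKernel (b i) t : ℂ) := (h.summable_norm ht).of_norm

lemma total_nonneg (h : GAdm C b β y) : 0 ≤ total C b y :=
  tsum_nonneg fun _ => mul_nonneg (norm_nonneg _) (Real.rpow_nonneg h.ypos.le _)

lemma norm_le (h : GAdm C b β y) {t : ℝ} (ht : 0 < t) :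
    ‖gseries C b t‖ ≤ total C b y * rlConst y * (t ^ (β - 1) + 1) * Real.exp (y * t) := by
  refine (norm_tsum_le_tsum_norm (h.summable_norm ht)).trans ?_
  refine ((h.summable_norm ht).tsum_le_tsum (h.norm_term_le ht) (h.summable.mul_left _)).trans ?_
  rw [tsum_mul_left, total]
  apply le_of_eq; ring

lemma continuousOn (h : GAdm C b β y) : ContinuousOn (gseries C b) (Set.Ioi 0) := by
  intro t ht
  have ht0 : (0 : ℝ) < t := ht
  apply ContinuousAt.continuousWithinAt
  have hs : Set.Ioo (t / 2) (2 * t) ∈ 𝓝 t := Ioo_mem_nhds (by linarith) (by linarith)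
  refine ContinuousOn.continuousAt ?_ hs
  refine continuousOn_tsum (u := fun i => rlConst y * (((t / 2) ^ (β - 1) + (2 * t) ^ (β - 1)) + 1) *
    Real.exp (y * (2 * t)) * (‖C i‖ * y ^ (-b i))) (fun i => ?_) (h.summable.mul_left _) ?_
  · refine continuousOn_const.mul (Complex.continuous_ofReal.comp_continuousOn
      ((continuousOn_rlKernel (b i)).mono fun x hx => ?_))
    exact lt_trans (by linarith) hx.1
  · intro i x hx
    have hx0 : 0 < x := lt_trans (by linarith) hx.1
    refine (h.norm_term_le hx0 i).trans ?_
    have hy := h.ypos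
    have hc := rlConst_pos hy
    -- The power is monotone, increasing or decreasing according to β, so on the interval it lies
    -- below the sum of its two endpoint values.
    have h1 : x ^ (β - 1) ≤ (t / 2) ^ (β - 1) + (2 * t) ^ (β - 1) := by
      have e1 := Real.rpow_pos_of_pos (show 0 < t / 2 by linarith) (β - 1)
      have e2 := Real.rpow_pos_of_pos (show 0 < 2 * t by linarith) (β - 1)
      rcases le_or_gt 1 β with hb | hb
      · have := Real.rpow_le_rpow hx0.le hx.2.le (show 0 ≤ β - 1 by linarith)
        linarith
      · have := Real.rpow_le_rpow_of_nonpos (show 0 < t / 2 by linarith) hx.1.le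
          (show β - 1 ≤ 0 by linarith)
        linarith
    have h2 : Real.exp (y * x) ≤ Real.exp (y * (2 * t)) := by
      apply Real.exp_le_exp.mpr; exact mul_le_mul_of_nonneg_left hx.2.le hy.le
    have h3 : 0 ≤ ‖C i‖ * y ^ (-b i) := mul_nonneg (norm_nonneg _) (Real.rpow_nonneg hy.le _)
    have h4 := Real.rpow_nonneg hx0.le (β - 1)
    gcongr

variable [Countable ι] [Countable κ]

omit [Countable ι] [Countable κ] in
lemma integral_norm_term (h : GAdm C b β y) {s : ℂ} (hs : y ≤ s.re) (i : ι) :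
    IntegrableOn (fun t : ℝ => Complex.exp (-s * t) * (C i * (rlKernel (b i) t : ℂ))) (Set.Ioi 0) ∧
    ∫ t in Set.Ioi (0 : ℝ), ‖Complex.exp (-s * t) * (C i * (rlKernel (b i) t : ℂ))‖ =
      ‖C i‖ * s.re ^ (-b i) := by
  have hs0 := h.ypos.trans_le hs
  obtain ⟨h1, h2⟩ := integral_rexp_mul_rlKernel (h.bpos i) hs0
  have e : Set.EqOn (fun t : ℝ => ‖Complex.exp (-s * t) * (C i * (rlKernel (b i) t : ℂ))‖)
      (fun t => ‖C i‖ * (Real.exp (-s.re * t) * rlKernel (b i) t)) (Set.Ioi 0) := fun t ht => by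
    have : (-s * t).re = -s.re * t := by simp
    simp only [norm_mul, Complex.norm_exp, this, Complex.norm_real,
      Real.norm_of_nonneg (rlKernel_nonneg (h.bpos i) (le_of_lt ht))]
    ring
  constructor
  · refine Integrable.mono' (h1.const_mul ‖C i‖) ?_ ?_
    · refine (Measurable.mul (by fun_prop) (measurable_const.mul ?_)).aestronglyMeasurable
      exact Complex.measurable_ofReal.comp (measurable_rlKernel _)
    · filter_upwards [ae_restrict_mem measurableSet_Ioi] with t ht
      exact (e ht).le
  · rw [setIntegral_congr_fun measurableSet_Ioi e, integral_const_mul, h2]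

omit [Countable ι] [Countable κ] in
lemma laplaceT_term (h : GAdm C b β y) {s : ℂ} (hs : y ≤ s.re) (i : ι) :
    ∫ t in Set.Ioi (0 : ℝ), Complex.exp (-s * t) * (C i * (rlKernel (b i) t : ℂ)) =
      C i * s ^ (-b i : ℂ) := by
  rw [← laplaceT_rlKernel (h.bpos i) (h.ypos.trans_le hs), laplaceT, ← integral_const_mul]
  congr 1; ext t; ring

/-- The kernels are nonnegative, so the integral of the norm of the i-th term is exactly |C_i| (Re
s)^{-b_i}; these numbers are summable and the sum may be integrated termwise. -/
lemma hasSum_laplace (h : GAdm C b β y) {s : ℂ} (hs : y ≤ s.re) :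
    HasSum (fun i => C i * s ^ (-b i : ℂ)) (laplaceT (gseries C b) s) := by
  have hS : Summable fun i => ∫ t in Set.Ioi (0 : ℝ),
      ‖Complex.exp (-s * t) * (C i * (rlKernel (b i) t : ℂ))‖ := by
    simp only [(h.integral_norm_term hs _).2]
    exact (h.mono hs).summable
  have := hasSum_integral_of_summable_integral_norm (fun i => (h.integral_norm_term hs i).1) hS
  simp only [h.laplaceT_term hs] at this
  simpa only [laplaceT, gseries, ← tsum_mul_left] using this

omit [Countable ι] in
lemma laplaceAdm (h : GAdm C b β y) : LaplaceAdm (gseries C b) y := by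
  have hy := h.ypos
  refine LaplaceAdm.of_norm (h.continuousOn.aestronglyMeasurable measurableSet_Ioi) fun x hx => ?_
  have hint : IntegrableOn (fun t : ℝ => (total C b y * rlConst y) *
      (t ^ (β - 1) * Real.exp (-(x - y) * t) + Real.exp (-(x - y) * t))) (Set.Ioi 0) := by
    refine Integrable.const_mul (Integrable.add ?_ ?_) _
    · have := (integral_rexp_mul_rlKernel h.pos (show 0 < x - y by linarith)).1.const_mul
        (Real.Gamma β)
      refine this.congr (ae_of_all _ fun t => ?_)
      have := (Real.Gamma_pos_of_pos h.pos).ne'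
      simp only [rlKernel]; field_simp
    · exact integrableOn_exp_mul_Ioi (by linarith) 0
  refine Integrable.mono' hint ?_ ?_
  · exact AEStronglyMeasurable.mul (Continuous.aestronglyMeasurable (by fun_prop))
      (h.continuousOn.aestronglyMeasurable measurableSet_Ioi).norm
  · filter_upwards [ae_restrict_mem measurableSet_Ioi] with t ht
    have ht0 : (0 : ℝ) < t := ht
    rw [Real.norm_of_nonneg (by positivity)]
    have h1 := h.norm_le ht0
    have h2 : Real.exp (-(x - y) * t) = Real.exp (-x * t) * Real.exp (y * t) := by
      rw [← Real.exp_add]; ring_nf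
    rw [h2]
    calc _ ≤ Real.exp (-x * t) * _ := mul_le_mul_of_nonneg_left h1 (Real.exp_pos _).le
      _ = _ := by ring

end GAdm

/-! ### Convolution of generalized power series. -/

/-- Convolution on the half line. -/
noncomputable def halfConv (f g : ℝ → ℂ) (t : ℝ) : ℂ := ∫ τ in (0 : ℝ)..t, f (t - τ) * g τ

lemma integral_rpow_mul_rpow {b c t : ℝ} (hb : 0 < b) (hc : 0 < c) (ht : 0 < t) :
    ∫ τ in (0 : ℝ)..t, (t - τ) ^ (b - 1) * τ ^ (c - 1) =
      t ^ (b + c - 1) * (Real.Gamma b * Real.Gamma c / Real.Gamma (b + c)) := by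
  have h1 := Complex.betaIntegral_scaled (c : ℂ) (b : ℂ) ht
  have h2 := Complex.Gamma_mul_Gamma_eq_betaIntegral (s := (c : ℂ)) (t := (b : ℂ))
    (by simpa using hc) (by simpa using hb)
  have hG : Complex.Gamma (c + b) ≠ 0 := by
    rw [← Complex.ofReal_add, Complex.Gamma_ofReal]
    exact_mod_cast (Real.Gamma_pos_of_pos (add_pos hc hb)).ne'
  have h3 : Complex.betaIntegral c b = ((Real.Gamma b * Real.Gamma c / Real.Gamma (b + c) : ℝ) : ℂ) := by
    rw [eq_comm]
    push_cast [← Complex.Gamma_ofReal]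
    rw [add_comm, div_eq_iff hG, mul_comm (Complex.Gamma b), h2, mul_comm]
  rw [h3] at h1
  have h4 : ∫ τ in (0 : ℝ)..t, (τ : ℂ) ^ ((c : ℂ) - 1) * ((t : ℂ) - τ) ^ ((b : ℂ) - 1) =
      ((∫ τ in (0 : ℝ)..t, (t - τ) ^ (b - 1) * τ ^ (c - 1) : ℝ) : ℂ) := by
    rw [← intervalIntegral.integral_ofReal]
    refine intervalIntegral.integral_congr fun τ hτ => ?_
    rw [Set.uIcc_of_le ht.le] at hτ
    push_cast [Complex.ofReal_cpow hτ.1, Complex.ofReal_cpow (sub_nonneg.mpr hτ.2)]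
    ring
  rw [h4] at h1
  have h5 : (t : ℂ) ^ ((c : ℂ) + b - 1) = ((t ^ (b + c - 1) : ℝ) : ℂ) := by
    push_cast [Complex.ofReal_cpow ht.le]
    rw [add_comm]
  rw [h5] at h1
  exact_mod_cast h1

lemma intervalIntegrable_rpow_mul_rpow {b c t : ℝ} (hb : 0 < b) (hc : 0 < c) (ht : 0 < t) :
    IntervalIntegrable (fun τ => (t - τ) ^ (b - 1) * τ ^ (c - 1)) volume 0 t := by
  by_contra h
  have h1 := integral_rpow_mul_rpow hb hc ht
  rw [intervalIntegral.integral_undef h] at h1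
  have := Real.Gamma_pos_of_pos hb
  have := Real.Gamma_pos_of_pos hc
  have := Real.Gamma_pos_of_pos (add_pos hb hc)
  have : 0 < t ^ (b + c - 1) * (Real.Gamma b * Real.Gamma c / Real.Gamma (b + c)) := by positivity
  linarith

lemma rlKernel_mul {b c t τ : ℝ} : rlKernel b (t - τ) * rlKernel c τ =
    (Real.Gamma b * Real.Gamma c)⁻¹ * ((t - τ) ^ (b - 1) * τ ^ (c - 1)) := by
  simp only [rlKernel, mul_inv]; ring

lemma integral_rlKernel_mul {b c t : ℝ} (hb : 0 < b) (hc : 0 < c) (ht : 0 < t) :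
    ∫ τ in (0 : ℝ)..t, rlKernel b (t - τ) * rlKernel c τ = rlKernel (b + c) t := by
  have h1 := (Real.Gamma_pos_of_pos hb).ne'
  have h2 := (Real.Gamma_pos_of_pos hc).ne'
  simp only [rlKernel_mul]
  rw [intervalIntegral.integral_const_mul, integral_rpow_mul_rpow hb hc ht, rlKernel]
  field_simp

lemma intervalIntegrable_rlKernel_mul {b c t : ℝ} (hb : 0 < b) (hc : 0 < c) (ht : 0 < t) :
    IntervalIntegrable (fun τ => rlKernel b (t - τ) * rlKernel c τ) volume 0 t := by
  simp only [rlKernel_mul]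
  exact (intervalIntegrable_rpow_mul_rpow hb hc ht).const_mul _

namespace GAdm

variable {ι κ : Type*} {C : ι → ℂ} {b : ι → ℝ} {β y : ℝ} {C' : κ → ℂ} {b' : κ → ℝ} {β' : ℝ}

lemma prod (h : GAdm C b β y) (h' : GAdm C' b' β' y) :
    GAdm (fun p : ι × κ => C p.1 * C' p.2) (fun p => b p.1 + b' p.2) (β + β') y := by
  refine ⟨add_pos h.pos h'.pos, fun p => add_le_add (h.le _) (h'.le _), h.ypos, ?_⟩
  have := h.summable.mul_of_nonneg h'.summable
    (fun i => mul_nonneg (norm_nonneg _) (Real.rpow_nonneg h.ypos.le _))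
    (fun i => mul_nonneg (norm_nonneg _) (Real.rpow_nonneg h.ypos.le _))
  refine this.congr fun p => ?_
  rw [norm_mul, neg_add, Real.rpow_add h.ypos]
  ring

/-- By the Beta integral, convolution of two kernels adds their exponents. The kernels are
nonnegative, so the integrals of the norms obey the same formula, and the product series may be
integrated termwise. -/
lemma halfConv_gseries [Countable ι] [Countable κ] (h : GAdm C b β y) (h' : GAdm C' b' β' y)
    {t : ℝ} (ht : 0 < t) :
    halfConv (gseries C b) (gseries C' b') t =
      gseries (fun p : ι × κ => C p.1 * C' p.2) (fun p => b p.1 + b' p.2) t := by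
  set F : ι × κ → ℝ → ℂ := fun p τ =>
    (C p.1 * C' p.2) * ((rlKernel (b p.1) (t - τ) * rlKernel (b' p.2) τ : ℝ) : ℂ) with hF
  have hi : ∀ p, Integrable (F p) (volume.restrict (Set.Ioo 0 t)) := fun p => by
    have := intervalIntegrable_rlKernel_mul (h.bpos p.1) (h'.bpos p.2) ht
    rw [intervalIntegrable_iff_integrableOn_Ioo_of_le ht.le] at this
    exact (Integrable.ofReal this).const_mul _
  have hn : ∀ p, ∫ τ in Set.Ioo 0 t, ‖F p τ‖ =
      ‖(C p.1 * C' p.2) * (rlKernel (b p.1 + b' p.2) t : ℂ)‖ := fun p => by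
    rw [norm_mul, Complex.norm_real, Real.norm_of_nonneg (rlKernel_nonneg
      (add_pos (h.bpos p.1) (h'.bpos p.2)) ht.le), ← integral_rlKernel_mul (h.bpos p.1)
      (h'.bpos p.2) ht, intervalIntegral.integral_of_le ht.le, integral_Ioc_eq_integral_Ioo,
      ← integral_const_mul]
    refine setIntegral_congr_fun measurableSet_Ioo fun τ hτ => ?_
    simp only [hF]
    rw [norm_mul, Complex.norm_real, Real.norm_of_nonneg]
    exact mul_nonneg (rlKernel_nonneg (h.bpos _) (sub_nonneg.mpr hτ.2.le))
      (rlKernel_nonneg (h'.bpos _) hτ.1.le)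
  have hs : Summable fun p => ∫ τ in Set.Ioo 0 t, ‖F p τ‖ := by
    simp only [hn]
    exact (h.prod h').summable_norm ht
  have key := hasSum_integral_of_summable_integral_norm hi hs
  have h1 : ∀ p, ∫ τ in Set.Ioo 0 t, F p τ =
      (C p.1 * C' p.2) * (rlKernel (b p.1 + b' p.2) t : ℂ) := fun p => by
    simp only [hF]
    rw [integral_const_mul, ← integral_rlKernel_mul (h.bpos p.1)
      (h'.bpos p.2) ht, intervalIntegral.integral_of_le ht.le, integral_Ioc_eq_integral_Ioo,
      integral_complex_ofReal]
  simp only [h1] at key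
  rw [gseries, key.tsum_eq, halfConv, intervalIntegral.integral_of_le ht.le,
    integral_Ioc_eq_integral_Ioo]
  refine setIntegral_congr_fun measurableSet_Ioo fun τ hτ => ?_
  simp only [gseries, hF]
  rw [tsum_mul_tsum_of_summable_norm (h.summable_norm (sub_pos.mpr hτ.2)) (h'.summable_norm hτ.1)]
  congr 1; ext p
  push_cast
  ring

lemma laplaceT_prod [Countable ι] [Countable κ] (h : GAdm C b β y) (h' : GAdm C' b' β' y)
    {s : ℂ} (hs : y ≤ s.re) :
    laplaceT (gseries (fun p : ι × κ => C p.1 * C' p.2) (fun p => b p.1 + b' p.2)) s =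
      laplaceT (gseries C b) s * laplaceT (gseries C' b') s := by
  have hs0 : s ≠ 0 := fun h0 => by
    have := h.ypos.trans_le hs
    rw [h0] at this; simp at this
  have h1 := (h.prod h').hasSum_laplace hs
  have h2 := (h.hasSum_laplace hs).mul (h'.hasSum_laplace hs) (by
    refine h1.summable.congr fun p => ?_
    push_cast
    rw [neg_add, Complex.cpow_add _ _ hs0]
    ring)
  refine h1.unique (h2.congr_fun fun p => ?_)
  push_cast
  rw [neg_add, Complex.cpow_add _ _ hs0]
  ring

end GAdm

/-! ### Inversion and uniqueness of the Laplace transform, shift of the contour. -/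

section inversion

open Real in
/-- **Inversion of the Laplace transform** along a vertical line. -/
lemma laplaceT_inversion {f : ℝ → ℂ} {x₀ σ t : ℝ} (hf : LaplaceAdm f x₀) (hσ : x₀ < σ)
    (hF : Integrable fun ξ : ℝ => laplaceT f (σ + Complex.I * ξ)) (ht : 0 < t)
    (hc : ContinuousAt f t) :
    f t = (1 / (2 * (π : ℂ))) *
      ∫ ξ : ℝ, Complex.exp ((σ + Complex.I * ξ) * t) * laplaceT f (σ + Complex.I * ξ) := by
  -- Damped by e^{-σt} and extended by 0, f has as Fourier transform its Laplace transform on the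
  -- line Re s = σ, up to the factor 2π in the frequency.
  set F : ℝ → ℂ := Set.indicator (Set.Ioi 0) fun t => Complex.exp (-(σ : ℂ) * t) * f t with hFdef
  have hint : Integrable F := (hf σ (by simpa using hσ)).integrable_indicator measurableSet_Ioi
  have hcont : ContinuousAt F t := by
    have : ContinuousAt (fun t : ℝ => Complex.exp (-(σ : ℂ) * t) * f t) t :=
      ContinuousAt.mul (by fun_prop) hc
    refine this.congr ?_
    filter_upwards [Ioi_mem_nhds ht] with x hx
    rw [hFdef, Set.indicator_of_mem hx]
  have hFour : ∀ ξ : ℝ, FourierTransform.fourier F ξ = laplaceT f (σ + Complex.I * ((2 * π) * ξ : ℝ)) := by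
    intro ξ
    rw [Real.fourier_real_eq_integral_exp_smul, laplaceT, ← integral_indicator measurableSet_Ioi]
    congr 1; ext v
    by_cases hv : v ∈ Set.Ioi (0 : ℝ)
    · rw [hFdef, Set.indicator_of_mem hv, Set.indicator_of_mem hv, smul_eq_mul, ← mul_assoc,
        ← Complex.exp_add]
      congr 2; push_cast; ring
    · rw [hFdef, Set.indicator_of_notMem hv, Set.indicator_of_notMem hv, smul_zero]
  have hFint : Integrable (FourierTransform.fourier F) := by
    have : FourierTransform.fourier F = fun ξ : ℝ => (fun ξ : ℝ => laplaceT f (σ + Complex.I * ξ)) ((2 * π) * ξ) := by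
      ext ξ; rw [hFour]
    rw [this]
    exact hF.comp_mul_left' (by positivity)
  have key := hint.fourierInv_fourier_eq hFint hcont
  rw [Real.fourierInv_eq'] at key
  have hFt : F t = Complex.exp (-(σ : ℂ) * t) * f t := by
    rw [hFdef, Set.indicator_of_mem (show t ∈ Set.Ioi (0 : ℝ) from ht)]
  have h2 : f t = Complex.exp ((σ : ℂ) * t) * F t := by
    rw [hFt, ← mul_assoc, ← Complex.exp_add]; simp
  rw [h2, ← key, ← integral_const_mul]
  have h3 := Measure.integral_comp_mul_left (fun ξ : ℝ => Complex.exp ((σ + Complex.I * ξ) * t) * laplaceT f (σ + Complex.I * ξ))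
    (2 * π)
  have h4 : ((1 / (2 * (π : ℂ)))) = ((|(2 * π)⁻¹| : ℝ) : ℂ) := by
    rw [abs_of_pos (by positivity)]; push_cast; rw [one_div]
  rw [Complex.real_smul] at h3
  rw [h4, ← h3]
  congr 1; ext ξ
  rw [hFour, smul_eq_mul, ← mul_assoc, ← Complex.exp_add]
  congr 2
  simp
  ring

lemma laplaceT_congr_Ioi {f g : ℝ → ℂ} (h : ∀ t, 0 < t → f t = g t) : laplaceT f = laplaceT g := by
  ext s
  exact setIntegral_congr_fun measurableSet_Ioi fun t ht => by simp only [h t ht]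

/-- **Uniqueness theorem** for the Laplace transform. -/
lemma eq_of_laplaceT_eq {f g : ℝ → ℂ} {x₀ : ℝ} (hf : LaplaceAdm f x₀) (hg : LaplaceAdm g x₀)
    (hfc : ContinuousOn f (Set.Ioi 0)) (hgc : ContinuousOn g (Set.Ioi 0))
    (h : ∀ s : ℂ, x₀ < s.re → laplaceT f s = laplaceT g s) {t : ℝ} (ht : 0 < t) : f t = g t := by
  have hsub : LaplaceAdm (fun t => f t - g t) x₀ := fun s hs => by
    refine ((hf s hs).sub (hg s hs)).congr (ae_of_all _ fun t => ?_)
    simp only [Pi.sub_apply]; ring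
  have h0 : ∀ s : ℂ, x₀ < s.re → laplaceT (fun t => f t - g t) s = 0 := fun s hs => by
    have := integral_sub (hf s hs) (hg s hs)
    rw [laplaceT]
    simp only [mul_sub]
    rw [this, sub_eq_zero]
    exact h s hs
  have h1 : ∀ ξ : ℝ, laplaceT (fun t => f t - g t) ((x₀ + 1 : ℝ) + Complex.I * ξ) = 0 := fun ξ =>
    h0 _ (by simp)
  -- The difference has zero transform on a vertical line, so the integrability needed for inversion
  -- is trivial.
  have key := laplaceT_inversion hsub (σ := x₀ + 1) (by linarith) (by simp only [h1]; simp) ht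
    ((hfc.sub hgc).continuousAt (Ioi_mem_nhds ht))
  simp only [h1] at key
  simpa [sub_eq_zero] using key

/-- Integrals along vertical lines do not depend on the abscissa. -/
lemma integral_vertical_eq {G : ℂ → ℂ} {x₀ σ₁ σ₂ M q : ℝ} (hG : DifferentiableOn ℂ G {s | x₀ < s.re})
    (h₁ : x₀ < σ₁) (h₂ : σ₁ ≤ σ₂) (hq : 1 < q)
    (hM : ∀ s : ℂ, σ₁ ≤ s.re → s.re ≤ σ₂ → 1 ≤ |s.im| → ‖G s‖ ≤ M * |s.im| ^ (-q)) :
    ∫ ξ : ℝ, G (σ₁ + Complex.I * ξ) = ∫ ξ : ℝ, G (σ₂ + Complex.I * ξ) := by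
  have hcont : ∀ σ, x₀ < σ → Continuous fun ξ : ℝ => G (σ + Complex.I * ξ) := fun σ hσ =>
    hG.continuousOn.comp_continuous (by fun_prop) (fun ξ => by simpa using hσ)
  have hint : ∀ σ, σ₁ ≤ σ → σ ≤ σ₂ → Integrable fun ξ : ℝ => G (σ + Complex.I * ξ) := by
    intro σ hσ hσ'
    have hM0 : ∀ x : ℝ, 1 ≤ |x| → ‖G (σ + Complex.I * x)‖ ≤ M * |x| ^ (-q) := fun x hx => by
      simpa using hM (σ + Complex.I * x) (by simpa using hσ) (by simpa using hσ') (by simpa using hx)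
    have hO : ∀ l : Filter ℝ, (∀ᶠ x in l, 1 ≤ |x|) →
        (fun ξ : ℝ => G (σ + Complex.I * ξ)) =O[l] fun x => |x| ^ (-q) := fun l hl => by
      refine Asymptotics.IsBigO.of_bound M ?_
      filter_upwards [hl] with x hx
      rw [Real.norm_of_nonneg (Real.rpow_nonneg (abs_nonneg _) _)]
      exact hM0 x hx
    refine (hcont σ (h₁.trans_le hσ)).locallyIntegrable.integrable_of_isBigO_atBot_atTop
      (hO atBot ?_) ?_ (hO atTop ?_) ?_
    · filter_upwards [eventually_le_atBot (-1 : ℝ)] with x hx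
      rw [abs_of_nonpos (by linarith)]; linarith
    · refine ⟨Set.Iio (-1), Iio_mem_atBot _, ?_⟩
      have := (integrableOn_Ioi_rpow_of_lt (a := -q) (by linarith) zero_lt_one).comp_neg
      simp only [Set.neg_Ioi] at this
      refine this.congr_fun (fun x hx => ?_) measurableSet_Iio
      have : x < -1 := hx
      simp only [abs_of_neg (show x < 0 by linarith)]
    · filter_upwards [eventually_ge_atTop (1 : ℝ)] with x hx
      rwa [abs_of_nonneg (by linarith)]
    · refine ⟨Set.Ioi 1, Ioi_mem_atTop _, ?_⟩
      refine (integrableOn_Ioi_rpow_of_lt (a := -q) (by linarith) zero_lt_one).congr_fun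
        (fun x hx => ?_) measurableSet_Ioi
      have : 1 < x := hx
      simp only [abs_of_pos (show 0 < x by linarith)]
  have hT : ∀ σ, σ₁ ≤ σ → σ ≤ σ₂ → Tendsto (fun T : ℝ => ∫ ξ in (-T)..T, G (σ + Complex.I * ξ)) atTop
      (𝓝 (∫ ξ : ℝ, G (σ + Complex.I * ξ))) := fun σ hσ hσ' =>
    intervalIntegral_tendsto_integral (hint σ hσ hσ') tendsto_neg_atTop_atBot tendsto_id
  have hrect : ∀ T : ℝ, 0 < T → Complex.I * (∫ ξ in (-T)..T, G (σ₂ + Complex.I * ξ)) -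
      Complex.I * (∫ ξ in (-T)..T, G (σ₁ + Complex.I * ξ)) =
      (∫ x in σ₁..σ₂, G (x + Complex.I * T)) - ∫ x in σ₁..σ₂, G (x + Complex.I * (-T)) := by
    intro T hT0
    have := Complex.integral_boundary_rect_eq_zero_of_differentiableOn G (σ₁ + Complex.I * ((-T : ℝ) : ℂ))
      (σ₂ + Complex.I * (T : ℂ)) (hG.mono ?_)
    · simp only [Complex.add_re, Complex.ofReal_re, Complex.mul_re, Complex.I_re, Complex.I_im,
        Complex.add_im, Complex.ofReal_im, Complex.mul_im, zero_mul, one_mul, zero_add, add_zero,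
        sub_zero, smul_eq_mul, mul_zero, mul_comm _ Complex.I] at this
      push_cast at this
      linear_combination this
    · intro z hz
      have := (Complex.mem_reProdIm.mp hz).1
      simp [Set.uIcc_of_le h₂] at this
      exact h₁.trans_le this.1
  -- The horizontal sides of the rectangle, the upper one for ε = 1 and the lower one for ε = -1,
  -- vanish in the limit by the decay of G.
  have hM' : ∀ ε : ℝ, |ε| = 1 → Tendsto (fun T : ℝ => ∫ x in σ₁..σ₂, G (x + Complex.I * ((ε * T : ℝ) : ℂ))) atTop (𝓝 0) := by
    intro ε hε
    have hz : Tendsto (fun T : ℝ => M * T ^ (-q) * |σ₂ - σ₁|) atTop (𝓝 0) := by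
      have := ((tendsto_rpow_neg_atTop (y := q) (by linarith)).const_mul M).mul_const |σ₂ - σ₁|
      simpa using this
    refine squeeze_zero_norm' ?_ hz
    filter_upwards [eventually_ge_atTop (1 : ℝ)] with T hT
    refine intervalIntegral.norm_integral_le_of_norm_le_const fun x hx => ?_
    rw [Set.uIoc_of_le h₂] at hx
    have habs : |ε * T| = T := by rw [abs_mul, hε, one_mul, abs_of_pos (by linarith)]
    have := hM (x + Complex.I * ((ε * T : ℝ) : ℂ))
    simp only [Complex.add_re, Complex.ofReal_re, Complex.mul_re, Complex.I_re, Complex.I_im,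
        Complex.add_im, Complex.ofReal_im, Complex.mul_im, zero_mul, one_mul, zero_add, add_zero,
        sub_zero, mul_zero, habs] at this
    exact this hx.1.le hx.2 hT
  have h1 := (hM' 1 (by simp)).sub (hM' (-1) (by simp))
  have h2 := ((hT σ₂ h₂ le_rfl).const_mul Complex.I).sub ((hT σ₁ le_rfl h₂).const_mul Complex.I)
  have h3 := tendsto_nhds_unique_of_eventuallyEq h2 h1 (by
    filter_upwards [eventually_gt_atTop 0] with T hT
    rw [hrect T hT]
    simp)
  rw [sub_zero, sub_eq_zero] at h3
  exact (mul_left_cancel₀ Complex.I_ne_zero h3).symm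

end inversion

/-! ### Binomial series, Laplace transforms and semigroup property of the Prabhakar kernels. -/

lemma ascPochhammer_div_factorial (c : ℝ) (j : ℕ) :
    (ascPochhammer ℝ j).eval c / (j.factorial : ℝ) = Ring.choose (c + j - 1) j := by
  rw [← Ring.multichoose_eq, div_eq_iff (by exact_mod_cast j.factorial_ne_zero),
    ← Polynomial.ascPochhammer_smeval_eq_eval, ← Ring.factorial_nsmul_multichoose_eq_ascPochhammer,
    nsmul_eq_mul, mul_comm]

lemma hasSum_binomial (c : ℝ) {z : ℂ} (hz : ‖z‖ < 1) :
    HasSum (fun j : ℕ => (((ascPochhammer ℝ j).eval c / (j.factorial : ℝ) : ℝ) : ℂ) * z ^ j)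
      ((1 - z) ^ (-c : ℂ)) := by
  have h := (Complex.one_div_one_sub_cpow_hasFPowerSeriesOnBall_zero (c : ℂ)).hasSum (y := z)
    (by rw [← ENNReal.ofReal_one, Metric.eball_ofReal]; simpa using hz)
  simp only [zero_add, FormalMultilinearSeries.ofScalars_apply_eq, smul_eq_mul, one_div,
    ← Complex.cpow_neg] at h
  refine h.congr_fun fun j => ?_
  rw [ascPochhammer_div_factorial, Complex.ofReal_choose]
  push_cast
  rfl

lemma hasSum_binomial_real (c : ℝ) {x : ℝ} (hx0 : 0 ≤ x) (hx : x < 1) :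
    HasSum (fun j : ℕ => (ascPochhammer ℝ j).eval c / (j.factorial : ℝ) * x ^ j)
      ((1 - x) ^ (-c)) := by
  have h := hasSum_binomial c (z := x) (by simpa [abs_of_nonneg hx0] using hx)
  have h1 : ((1 : ℂ) - x) ^ (-c : ℂ) = (((1 - x) ^ (-c) : ℝ) : ℂ) := by
    push_cast [Complex.ofReal_cpow (sub_nonneg.mpr hx.le)]; rfl
  rw [h1] at h
  exact_mod_cast h

/-- The coefficients of the three-parameter Mittag-Leffler function. -/
noncomputable def mlCoeff (c : ℝ) (ω : ℂ) (j : ℕ) : ℂ :=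
  (((ascPochhammer ℝ j).eval c / (j.factorial : ℝ) : ℝ) : ℂ) * ω ^ j

/-- The exponents of the Prabhakar kernel. -/
noncomputable def mlExp (α β : ℝ) (j : ℕ) : ℝ := α * j + β

lemma mlCoeff_zero (ω : ℂ) (j : ℕ) : mlCoeff 0 ω j = if j = 0 then 1 else 0 := by
  rcases j with _ | j
  · simp [mlCoeff]
  · simp [mlCoeff, ascPochhammer_succ_left]

lemma prabhakarKernel_eq_gseries {α β c : ℝ} {ω : ℂ} {t : ℝ} (ht : 0 < t) :
    prabhakarKernel α β c ω t = gseries (mlCoeff c ω) (mlExp α β) t := by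
  rw [prabhakarKernel, mittagLeffler, gseries, ← tsum_mul_left]
  congr 1; ext j
  have h : t ^ (α * j + β - 1) = t ^ (β - 1) * (t ^ α) ^ j := by
    rw [← Real.rpow_natCast, ← Real.rpow_mul ht.le, ← Real.rpow_add ht]; ring_nf
  rw [mlCoeff, mlExp, rlKernel, h, mul_pow]
  push_cast
  by_cases hG : (Real.Gamma (α * j + β) : ℂ) = 0
  · simp [hG]
  · have := Nat.cast_ne_zero (R := ℂ).mpr j.factorial_ne_zero
    field_simp

/-- `|ω s^{-α}| < 1` for `re s ≥ y`. -/
def MLLarge (α : ℝ) (ω : ℂ) (y : ℝ) : Prop := 0 < y ∧ ‖ω‖ * y ^ (-α) < 1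

lemma MLLarge.norm_lt {α : ℝ} {ω : ℂ} {y : ℝ} (h : MLLarge α ω y) (hα : 0 < α) {s : ℂ}
    (hs : y ≤ s.re) : ‖ω * s ^ (-α : ℂ)‖ < 1 := by
  have h1 : y ≤ ‖s‖ := hs.trans ((le_abs_self _).trans (Complex.abs_re_le_norm s))
  rw [norm_mul, ← Complex.ofReal_neg, Complex.norm_cpow_real]
  refine lt_of_le_of_lt (mul_le_mul_of_nonneg_left ?_ (norm_nonneg _)) h.2
  exact Real.rpow_le_rpow_of_nonpos h.1 h1 (by linarith)

lemma MLLarge.one_sub_ne {α : ℝ} {ω : ℂ} {y : ℝ} (h : MLLarge α ω y) (hα : 0 < α) {s : ℂ}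
    (hs : y ≤ s.re) : 1 - ω * s ^ (-α : ℂ) ≠ 0 := by
  intro h0
  have := h.norm_lt hα hs
  rw [← sub_eq_zero.mp h0] at this
  simp at this

lemma eventually_MLLarge {α : ℝ} (hα : 0 < α) (ω : ℂ) : ∀ᶠ y in atTop, MLLarge α ω y := by
  have h := (tendsto_rpow_neg_atTop hα).const_mul ‖ω‖
  rw [mul_zero] at h
  exact (eventually_gt_atTop 0).and (h.eventually_lt_const one_pos)

lemma ne_zero_of_le_re {y : ℝ} (hy : 0 < y) {s : ℂ} (hs : y ≤ s.re) : s ≠ 0 := fun h => by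
  rw [h] at hs; simp at hs; linarith

lemma rpow_neg_mlExp {α β y : ℝ} (hy : 0 < y) (j : ℕ) :
    y ^ (-mlExp α β j) = y ^ (-β) * (y ^ (-α)) ^ j := by
  rw [mlExp, ← Real.rpow_natCast, ← Real.rpow_mul hy.le, ← Real.rpow_add hy]; ring_nf

lemma cpow_neg_mlExp {α β : ℝ} {s : ℂ} (hs : s ≠ 0) (j : ℕ) :
    s ^ (-mlExp α β j : ℂ) = s ^ (-β : ℂ) * (s ^ (-α : ℂ)) ^ j := by
  rw [mlExp, ← Complex.cpow_nat_mul, ← Complex.cpow_add _ _ hs]; push_cast; ring_nf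

lemma gadm_ml {α β y : ℝ} {ω : ℂ} (hα : 0 < α) (hβ : 0 < β) (hy : MLLarge α ω y) (c : ℝ) :
    GAdm (mlCoeff c ω) (mlExp α β) β y := by
  refine ⟨hβ, fun j => by rw [mlExp]; linarith [mul_nonneg hα.le (Nat.cast_nonneg (α := ℝ) j)], hy.1, ?_⟩
  -- Absolute convergence comes from the binomial series at the real point |ω| y^{-α} < 1, whose
  -- terms have the required norms up to the factor y^{-β}.
  have h := (hasSum_binomial c (z := ‖ω‖ * (y ^ (-α) : ℝ)) (by
    rw [norm_mul, Complex.norm_real, Complex.norm_real, norm_norm,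
      Real.norm_of_nonneg (Real.rpow_nonneg hy.1.le _)]
    exact hy.2)).summable.norm
  refine (h.mul_left (y ^ (-β))).congr fun j => ?_
  rw [rpow_neg_mlExp hy.1, mlCoeff]
  simp only [norm_mul, norm_pow, Complex.norm_real, norm_norm,
    Real.norm_of_nonneg (Real.rpow_nonneg hy.1.le _)]
  ring

lemma hasSum_ml_laplace {α β y : ℝ} {ω : ℂ} (hα : 0 < α) (hy : MLLarge α ω y) (c : ℝ)
    {s : ℂ} (hs : y ≤ s.re) : HasSum (fun j => mlCoeff c ω j * s ^ (-mlExp α β j : ℂ))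
      (s ^ (-β : ℂ) * (1 - ω * s ^ (-α : ℂ)) ^ (-c : ℂ)) := by
  have hs0 := ne_zero_of_le_re hy.1 hs
  refine ((hasSum_binomial c (hy.norm_lt hα hs)).mul_left (s ^ (-β : ℂ))).congr_fun fun j => ?_
  rw [cpow_neg_mlExp hs0, mlCoeff]
  ring

lemma laplaceT_ml {α β y : ℝ} {ω : ℂ} (hα : 0 < α) (hβ : 0 < β) (hy : MLLarge α ω y) (c : ℝ)
    {s : ℂ} (hs : y ≤ s.re) : laplaceT (gseries (mlCoeff c ω) (mlExp α β)) s =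
      s ^ (-β : ℂ) * (1 - ω * s ^ (-α : ℂ)) ^ (-c : ℂ) :=
  ((gadm_ml hα hβ hy c).hasSum_laplace hs).unique (hasSum_ml_laplace hα hy c hs)

lemma halfConv_congr {f f' g g' : ℝ → ℂ} {t : ℝ} (hf : ∀ τ, 0 < τ → f τ = f' τ)
    (hg : ∀ τ, 0 < τ → g τ = g' τ) (ht : 0 < t) : halfConv f g t = halfConv f' g' t := by
  rw [halfConv, halfConv, intervalIntegral.integral_of_le ht.le,
    intervalIntegral.integral_of_le ht.le, integral_Ioc_eq_integral_Ioo,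
    integral_Ioc_eq_integral_Ioo]
  refine setIntegral_congr_fun measurableSet_Ioo fun τ hτ => ?_
  simp only [hf _ (sub_pos.mpr hτ.2), hg _ hτ.1]

/-- **Semigroup property** of the Prabhakar kernels. -/
lemma halfConv_prabhakarKernel {α β₁ β₂ c₁ c₂ : ℝ} {ω : ℂ} (hα : 0 < α) (h₁ : 0 < β₁)
    (h₂ : 0 < β₂) {t : ℝ} (ht : 0 < t) :
    halfConv (prabhakarKernel α β₁ c₁ ω) (prabhakarKernel α β₂ c₂ ω) t =
      prabhakarKernel α (β₁ + β₂) (c₁ + c₂) ω t := by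
  obtain ⟨y, hy⟩ := (eventually_MLLarge hα ω).exists
  have H1 := gadm_ml hα h₁ hy c₁
  have H2 := gadm_ml hα h₂ hy c₂
  have H3 := gadm_ml hα (add_pos h₁ h₂) hy (c₁ + c₂)
  rw [halfConv_congr (fun τ hτ => prabhakarKernel_eq_gseries hτ)
    (fun τ hτ => prabhakarKernel_eq_gseries hτ) ht, prabhakarKernel_eq_gseries ht,
    H1.halfConv_gseries H2 ht]
  -- On the Laplace side the claim is the addition of the exponents of s and of 1 - ω s^{-α}.
  refine eq_of_laplaceT_eq (H1.prod H2).laplaceAdm H3.laplaceAdm (H1.prod H2).continuousOn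
    H3.continuousOn (fun s hs => ?_) ht
  have hs0 := ne_zero_of_le_re hy.1 hs.le
  rw [H1.laplaceT_prod H2 hs.le, laplaceT_ml hα h₁ hy _ hs.le, laplaceT_ml hα h₂ hy _ hs.le,
    laplaceT_ml hα (add_pos h₁ h₂) hy _ hs.le]
  push_cast
  rw [neg_add, neg_add, Complex.cpow_add _ _ hs0, Complex.cpow_add _ _ (hy.one_sub_ne hα hs.le)]
  ring

lemma prabhakarKernel_one_zero {α : ℝ} {ω : ℂ} {t : ℝ} (ht : 0 < t) :
    prabhakarKernel α 1 0 ω t = 1 := by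
  rw [prabhakarKernel_eq_gseries ht, gseries, tsum_eq_single 0]
  · simp [mlCoeff_zero, mlExp, rlKernel]
  · intro j hj; simp [mlCoeff_zero, hj]

/-- A Prabhakar kernel is bounded by a multiple of `t^{β-1} + 1` on bounded intervals. -/
lemma exists_prabhakarKernel_bound {α β : ℝ} (hα : 0 < α) (hβ : 0 < β) (c : ℝ) (ω : ℂ) :
    ∃ A y : ℝ, 0 ≤ A ∧ 0 < y ∧ ∀ t, 0 < t →
      ‖prabhakarKernel α β c ω t‖ ≤ A * (t ^ (β - 1) + 1) * Real.exp (y * t) := by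
  obtain ⟨y, hy⟩ := (eventually_MLLarge hα ω).exists
  have H := gadm_ml hα hβ hy c
  refine ⟨_, y, mul_nonneg H.total_nonneg (rlConst_pos hy.1).le, hy.1, fun t ht => ?_⟩
  rw [prabhakarKernel_eq_gseries ht]
  exact H.norm_le ht

lemma continuousOn_prabhakarKernel {α β : ℝ} (hα : 0 < α) (hβ : 0 < β) (c : ℝ) (ω : ℂ) :
    ContinuousOn (prabhakarKernel α β c ω) (Set.Ioi 0) := by
  obtain ⟨y, hy⟩ := (eventually_MLLarge hα ω).exists
  exact (gadm_ml hα hβ hy c).continuousOn.congr fun t ht => prabhakarKernel_eq_gseries ht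

/-! ### The resolvent kernel and its equation. -/

section resolvent

variable (γ ρ α : ℝ) (ω a : ℂ)

/-- The symbol `s^ρ (1 - ω s^{-α})^γ` of the time derivative. -/
noncomputable def timeSymbol (s : ℂ) : ℂ := s ^ (ρ : ℂ) * (1 - ω * s ^ (-α : ℂ)) ^ (γ : ℂ)

/-- Coefficients of the resolvent kernel. -/
noncomputable def resCoeff (p : ℕ × ℕ) : ℂ := a ^ (p.1 + 1) * mlCoeff (γ * (p.1 + 1 : ℕ)) ω p.2

/-- Exponents of the resolvent kernel. -/
noncomputable def resExp (p : ℕ × ℕ) : ℝ := mlExp α (ρ * (p.1 + 1 : ℕ)) p.2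

/-- The resolvent kernel `∑_{n ≥ 1} a^n e^{γn}_{α,ρn,ω}(t)`. -/
noncomputable def resKernel (t : ℝ) : ℂ := gseries (resCoeff γ ω a) (resExp ρ α) t

/-- The primitive `∑_{n ≥ 1} a^n e^{γn}_{α,ρn+1,ω}(t)` of the resolvent kernel. -/
noncomputable def resPrim (t : ℝ) : ℂ :=
  gseries (resCoeff γ ω a) (fun p => resExp ρ α p + 1) t

variable {γ ρ α ω}

/-- In absolute values the inner sum is again a binomial series, now in |ω| y^{-α}. What remains is
a geometric series with ratio |a| y^{-ρ} (1 - |ω| y^{-α})^{-γ}, which tends to 0 as y grows. The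
admissible y depend on a, which is why uniform bounds need another argument. -/
lemma eventually_gadm_res (hγ : 0 < γ) (hρ : 0 < ρ) (hα : 0 < α) :
    ∀ᶠ y in atTop, MLLarge α ω y ∧ GAdm (resCoeff γ ω a) (resExp ρ α) ρ y := by
  have h0 := (tendsto_rpow_neg_atTop hα).const_mul ‖ω‖
  rw [mul_zero] at h0
  have h1 := ((tendsto_const_nhds (x := (1 : ℝ))).sub h0).rpow_const (p := -γ) (Or.inl (by simp))
  have h2 := ((tendsto_rpow_neg_atTop hρ).const_mul ‖a‖).mul h1
  simp only [mul_zero, zero_mul] at h2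
  filter_upwards [eventually_MLLarge hα ω, h2.eventually_lt_const one_pos] with y hy hq
  refine ⟨hy, hρ, fun p => ?_, hy.1, ?_⟩
  · rw [resExp, mlExp]
    have h1 := mul_nonneg hα.le (Nat.cast_nonneg (α := ℝ) p.2)
    have h2 := mul_nonneg hρ.le (Nat.cast_nonneg (α := ℝ) p.1)
    push_cast
    linarith
  have hq0 : 0 ≤ ‖ω‖ * y ^ (-α) := mul_nonneg (norm_nonneg _) (Real.rpow_nonneg hy.1.le _)
  have hterm : ∀ n : ℕ, HasSum (fun j : ℕ => ‖resCoeff γ ω a (n, j)‖ * y ^ (-resExp ρ α (n, j)))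
      ((‖a‖ * y ^ (-ρ) * (1 - ‖ω‖ * y ^ (-α)) ^ (-γ)) ^ (n + 1)) := by
    intro n
    have h := (hasSum_binomial_real (γ * (n + 1 : ℕ)) hq0 hy.2).mul_left (‖a‖ ^ (n + 1) * y ^ (-(ρ * (n + 1 : ℕ))))
    have hv : (‖a‖ * y ^ (-ρ) * (1 - ‖ω‖ * y ^ (-α)) ^ (-γ)) ^ (n + 1) =
        ‖a‖ ^ (n + 1) * y ^ (-(ρ * (n + 1 : ℕ))) * (1 - ‖ω‖ * y ^ (-α)) ^ (-(γ * (n + 1 : ℕ))) := by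
      rw [mul_pow, mul_pow, ← Real.rpow_natCast (y ^ (-ρ)), ← Real.rpow_natCast (_ ^ (-γ)),
        ← Real.rpow_mul hy.1.le, ← Real.rpow_mul (by linarith [hy.2]), neg_mul, neg_mul]
    rw [hv]
    refine h.congr_fun fun j => ?_
    -- Here γ > 0 enters: the rising factorials are positive, so taking norms does not destroy the
    -- binomial series.
    have hc : 0 ≤ (ascPochhammer ℝ j).eval (γ * (n + 1 : ℕ)) / (j.factorial : ℝ) :=
      div_nonneg (ascPochhammer_pos j _ (by positivity)).le (by positivity)
    simp only [resCoeff, resExp]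
    rw [rpow_neg_mlExp hy.1, mlCoeff]
    simp only [norm_mul, norm_pow, Complex.norm_real, Real.norm_of_nonneg hc, mul_pow]
    ring
  rw [summable_prod_of_nonneg fun p => mul_nonneg (norm_nonneg _) (Real.rpow_nonneg hy.1.le _)]
  refine ⟨fun n => (hterm n).summable, ?_⟩
  simp only [(hterm _).tsum_eq]
  rw [summable_nat_add_iff 1]
  refine summable_geometric_of_lt_one ?_ hq
  exact mul_nonneg (mul_nonneg (norm_nonneg _) (Real.rpow_nonneg hy.1.le _))
    (Real.rpow_nonneg (by linarith [hy.2]) _)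

variable {a}

lemma timeSymbol_ne_zero (hα : 0 < α) {y : ℝ} (hy : MLLarge α ω y) {s : ℂ} (hs : y ≤ s.re) :
    timeSymbol γ ρ α ω s ≠ 0 := by
  refine mul_ne_zero ?_ ?_
  · rw [Complex.cpow_ne_zero_iff]; exact Or.inl (ne_zero_of_le_re hy.1 hs)
  · rw [Complex.cpow_ne_zero_iff]; exact Or.inl (hy.one_sub_ne hα hs)

lemma laplaceT_resKernel (hα : 0 < α) {y : ℝ} (hy : MLLarge α ω y)
    (h : GAdm (resCoeff γ ω a) (resExp ρ α) ρ y) {s : ℂ} (hs : y ≤ s.re) :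
    timeSymbol γ ρ α ω s - a ≠ 0 ∧
    laplaceT (resKernel γ ρ α ω a) s = a / (timeSymbol γ ρ α ω s - a) := by
  have hs0 := ne_zero_of_le_re hy.1 hs
  have hφ := timeSymbol_ne_zero (γ := γ) (ρ := ρ) hα hy hs
  have h1 : ∀ n : ℕ, HasSum (fun j : ℕ => resCoeff γ ω a (n, j) * s ^ (-resExp ρ α (n, j) : ℂ))
      ((a / timeSymbol γ ρ α ω s) ^ (n + 1)) := fun n => by
    have := (hasSum_ml_laplace (β := ρ * (n + 1 : ℕ)) hα hy (γ * (n + 1 : ℕ)) hs).mul_left (a ^ (n + 1))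
    have hv : (a / timeSymbol γ ρ α ω s) ^ (n + 1) = a ^ (n + 1) *
        (s ^ (-(ρ * (n + 1 : ℕ) : ℝ) : ℂ) * (1 - ω * s ^ (-α : ℂ)) ^ (-(γ * (n + 1 : ℕ) : ℝ) : ℂ)) := by
      rw [Complex.cpow_neg, Complex.cpow_neg, div_pow, timeSymbol, mul_pow,
        show ((ρ * (n + 1 : ℕ) : ℝ) : ℂ) = (n + 1 : ℕ) * (ρ : ℂ) by push_cast; ring,
        show ((γ * (n + 1 : ℕ) : ℝ) : ℂ) = (n + 1 : ℕ) * (γ : ℂ) by push_cast; ring,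
        Complex.cpow_nat_mul, Complex.cpow_nat_mul, div_eq_mul_inv, mul_inv]
    rw [hv]
    refine this.congr_fun fun j => ?_
    simp only [resCoeff, resExp]
    ring
  have h2 := (h.hasSum_laplace hs).prod_fiberwise h1
  -- No estimate of φ is needed: the double series converges, hence so does the series of its row
  -- sums, which is geometric.
  have h3 : ‖a / timeSymbol γ ρ α ω s‖ < 1 := by
    have := (summable_nat_add_iff 1).mp h2.summable
    exact summable_geometric_iff_norm_lt_one.mp this
  have h4 : timeSymbol γ ρ α ω s - a ≠ 0 := fun h0 => by
    rw [sub_eq_zero.mp h0, div_self (by rwa [← sub_eq_zero.mp h0])] at h3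
    simp at h3
  refine ⟨h4, ?_⟩
  have h5 := ((hasSum_geometric_of_norm_lt_one h3).mul_left (a / timeSymbol γ ρ α ω s))
  simp only [← pow_succ'] at h5
  have h6 := h2.unique h5
  change laplaceT (gseries (resCoeff γ ω a) (resExp ρ α)) s = _
  rw [h6]
  field_simp

end resolvent

section resolvent

variable {γ ρ α : ℝ} {ω a : ℂ}

lemma gadm_unit {y : ℝ} (hy : 0 < y) : GAdm (fun _ : Unit => (1 : ℂ)) (fun _ => (1 : ℝ)) 1 y :=
  ⟨one_pos, fun _ => le_rfl, hy, (hasSum_fintype _).summable⟩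

lemma gseries_unit {t : ℝ} : gseries (fun _ : Unit => (1 : ℂ)) (fun _ => (1 : ℝ)) t = 1 := by
  simp [gseries, rlKernel]

lemma GAdm.succ {ι : Type*} {C : ι → ℂ} {b : ι → ℝ} {β y : ℝ} (h : GAdm C b β y) :
    GAdm C (fun i => b i + 1) (β + 1) y := by
  refine ⟨by linarith [h.pos], fun i => by linarith [h.le i], h.ypos, ?_⟩
  refine (h.summable.mul_right (y ^ (-1 : ℝ))).congr fun i => ?_
  rw [neg_add, Real.rpow_add h.ypos, mul_assoc]

/-- Integration is convolution with the constant 1, the one-term series with exponent 1. -/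
lemma GAdm.integral_gseries {ι : Type*} [Countable ι] {C : ι → ℂ} {b : ι → ℝ} {β y : ℝ}
    (h : GAdm C b β y) {t : ℝ} (ht : 0 < t) :
    ∫ τ in (0 : ℝ)..t, gseries C b τ = gseries C (fun i => b i + 1) t := by
  have := (gadm_unit h.ypos).halfConv_gseries h ht
  simp only [halfConv, gseries_unit, one_mul] at this
  rw [this, gseries, gseries, ← (Equiv.punitProd ι).symm.tsum_eq]
  congr 1; ext i
  simp [add_comm]

lemma GAdm.intervalIntegrable {ι : Type*} {C : ι → ℂ} {b : ι → ℝ} {β y : ℝ}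
    (h : GAdm C b β y) {t : ℝ} (ht : 0 < t) : IntervalIntegrable (gseries C b) volume 0 t := by
  rw [intervalIntegrable_iff_integrableOn_Ioc_of_le ht.le]
  have h1 : AEStronglyMeasurable (gseries C b) (volume.restrict (Set.Ioc 0 t)) :=
    (h.continuousOn.mono fun x hx => hx.1).aestronglyMeasurable measurableSet_Ioc
  have hy := h.ypos
  have hc := rlConst_pos hy
  have h2 : IntegrableOn (fun x : ℝ => (GAdm.total C b y * rlConst y * Real.exp (y * t)) *
      (x ^ (β - 1) + 1)) (Set.Ioc 0 t) := by
    refine Integrable.const_mul (Integrable.add ?_ (by simp)) _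
    have := intervalIntegral.intervalIntegrable_rpow' (a := 0) (b := t) (r := β - 1)
      (by linarith [h.pos])
    rwa [intervalIntegrable_iff_integrableOn_Ioc_of_le ht.le] at this
  refine Integrable.mono' h2 h1 ?_
  filter_upwards [ae_restrict_mem measurableSet_Ioc] with x hx
  refine (h.norm_le hx.1).trans ?_
  have := h.total_nonneg
  have h3 : Real.exp (y * x) ≤ Real.exp (y * t) := by
    apply Real.exp_le_exp.mpr; exact mul_le_mul_of_nonneg_left hx.2 hy.le
  have h4 := Real.rpow_nonneg hx.1.le (β - 1)
  calc _ ≤ GAdm.total C b y * rlConst y * (x ^ (β - 1) + 1) * Real.exp (y * t) := by gcongr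
    _ = _ := by ring

lemma GAdm.hasDerivAt {ι : Type*} [Countable ι] {C : ι → ℂ} {b : ι → ℝ} {β y : ℝ}
    (h : GAdm C b β y) {t : ℝ} (ht : 0 < t) :
    HasDerivAt (gseries C (fun i => b i + 1)) (gseries C b t) t := by
  have hc : ContinuousAt (gseries C b) t := h.continuousOn.continuousAt (Ioi_mem_nhds ht)
  have hm : StronglyMeasurableAtFilter (gseries C b) (𝓝 t) :=
    h.continuousOn.stronglyMeasurableAtFilter isOpen_Ioi t ht
  have := intervalIntegral.integral_hasDerivAt_right (h.intervalIntegrable ht) hm hc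
  refine this.congr_of_eventuallyEq ?_
  filter_upwards [Ioi_mem_nhds ht] with x hx
  exact (h.integral_gseries hx).symm

lemma exists_gadm_res (hγ : 0 < γ) (hρ : 0 < ρ) (hα : 0 < α) (a ω : ℂ) :
    ∃ y, MLLarge α ω y ∧ GAdm (resCoeff γ ω a) (resExp ρ α) ρ y :=
  (eventually_gadm_res a hγ hρ hα).exists

lemma continuousOn_resKernel (hγ : 0 < γ) (hρ : 0 < ρ) (hα : 0 < α) :
    ContinuousOn (resKernel γ ρ α ω a) (Set.Ioi 0) := by
  obtain ⟨y, -, h⟩ := exists_gadm_res hγ hρ hα a ω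
  exact h.continuousOn

lemma hasDerivAt_resPrim (hγ : 0 < γ) (hρ : 0 < ρ) (hα : 0 < α) {t : ℝ} (ht : 0 < t) :
    HasDerivAt (resPrim γ ρ α ω a) (resKernel γ ρ α ω a t) t := by
  obtain ⟨y, -, h⟩ := exists_gadm_res hγ hρ hα a ω
  exact h.hasDerivAt ht

lemma integral_resKernel (hγ : 0 < γ) (hρ : 0 < ρ) (hα : 0 < α) {t : ℝ} (ht : 0 < t) :
    ∫ τ in (0 : ℝ)..t, resKernel γ ρ α ω a τ = resPrim γ ρ α ω a t := by
  obtain ⟨y, -, h⟩ := exists_gadm_res hγ hρ hα a ω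
  exact h.integral_gseries ht

lemma intervalIntegrable_resKernel (hγ : 0 < γ) (hρ : 0 < ρ) (hα : 0 < α) {t : ℝ} (ht : 0 < t) :
    IntervalIntegrable (resKernel γ ρ α ω a) volume 0 t := by
  obtain ⟨y, -, h⟩ := exists_gadm_res hγ hρ hα a ω
  exact h.intervalIntegrable ht

/-- The resolvent equation `e^{-γ}_{α,1-ρ,ω} * r = a (1 + ∫ r)`. -/
lemma halfConv_resKernel (hγ : 0 < γ) (hρ : 0 < ρ) (hρ1 : ρ < 1) (hα : 0 < α) {t : ℝ}
    (ht : 0 < t) :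
    halfConv (prabhakarKernel α (1 - ρ) (-γ) ω) (resKernel γ ρ α ω a) t =
      a * (1 + resPrim γ ρ α ω a t) := by
  obtain ⟨y, hy, h⟩ := exists_gadm_res hγ hρ hα a ω
  have hK := gadm_ml hα (show 0 < 1 - ρ by linarith) hy (-γ)
  have hv := h.succ
  have hu := gadm_unit hy.1
  rw [halfConv_congr (fun τ hτ => prabhakarKernel_eq_gseries hτ) (fun τ _ => rfl) ht]
  have e1 : halfConv (gseries (mlCoeff (-γ) ω) (mlExp α (1 - ρ))) (resKernel γ ρ α ω a) t = _ :=
    hK.halfConv_gseries h ht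
  rw [e1]
  have hA : LaplaceAdm (fun t => a * (1 + resPrim γ ρ α ω a t)) y := fun s hs => by
    have h1 := (hu.laplaceAdm s hs).add (hv.laplaceAdm s hs)
    refine (h1.const_mul a).congr (ae_of_all _ fun t => ?_)
    simp only [Pi.add_apply, gseries_unit, resPrim]
    ring
  -- With φ the time symbol, the transforms to be compared are (φ/s) · a/(φ - a) and a (1/s + (1/s)
  -- · a/(φ - a)); they agree because 1 + a/(φ - a) = φ/(φ - a).
  refine eq_of_laplaceT_eq (hK.prod h).laplaceAdm hA (hK.prod h).continuousOn
    (continuousOn_const.mul (continuousOn_const.add hv.continuousOn)) (fun s hs => ?_) ht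
  have hs0 := ne_zero_of_le_re hy.1 hs.le
  obtain ⟨hne, hL⟩ := laplaceT_resKernel hα hy h hs.le
  have hL1 : laplaceT (gseries (fun _ : Unit => (1 : ℂ)) (fun _ => (1 : ℝ))) s = s⁻¹ := by
    have := (hu.hasSum_laplace hs.le).unique (hasSum_fintype _)
    rw [this]
    simp [Complex.cpow_neg_one]
  have hLv : laplaceT (resPrim γ ρ α ω a) s = s⁻¹ * (a / (timeSymbol γ ρ α ω s - a)) := by
    rw [← hL, ← hL1]
    change _ = _ * laplaceT (gseries _ _) s
    rw [← hu.laplaceT_prod h hs.le]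
    refine congrFun (laplaceT_congr_Ioi fun τ hτ => ?_) s
    rw [← hu.halfConv_gseries h hτ, resPrim, ← h.integral_gseries hτ]
    simp only [halfConv, gseries_unit, one_mul]
  have hR : laplaceT (fun t => a * (1 + resPrim γ ρ α ω a t)) s =
      a * (s⁻¹ + s⁻¹ * (a / (timeSymbol γ ρ α ω s - a))) := by
    have hadd := integral_add (hu.laplaceAdm s hs) (hv.laplaceAdm s hs)
    rw [← hLv, ← hL1]
    simp only [laplaceT, resPrim]
    rw [← hadd, ← integral_const_mul]
    congr 1; ext τ
    simp only [gseries_unit]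
    ring
  have hL' : laplaceT (gseries (resCoeff γ ω a) (resExp ρ α)) s = a / (timeSymbol γ ρ α ω s - a) := hL
  rw [hR, hK.laplaceT_prod h hs.le, hL', laplaceT_ml hα (by linarith) hy _ hs.le]
  have e2 : s ^ (-(1 - ρ : ℝ) : ℂ) * (1 - ω * s ^ (-α : ℂ)) ^ (-(-γ : ℝ) : ℂ) =
      s⁻¹ * timeSymbol γ ρ α ω s := by
    rw [timeSymbol, show (-(1 - ρ : ℝ) : ℂ) = -1 + (ρ : ℂ) by push_cast; ring,
      Complex.cpow_add _ _ hs0, Complex.cpow_neg_one]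
    push_cast; rw [neg_neg]; ring
  rw [e2]
  field_simp
  ring

end resolvent

/-! ### The series of the theorem in terms of the resolvent kernel. -/

section symbol

variable {γ ρ α : ℝ} {ω : ℂ} {p ϑ lam k t : ℝ}

/-- The spatial symbol `ipk - ϑ|k|^lam`. -/
noncomputable def spaceSymbol (p ϑ lam k : ℝ) : ℂ :=
  Complex.I * p * k - ϑ * ((|k| ^ lam : ℝ) : ℂ)

lemma symbolTerm_eq (ht : 0 < t) (n : ℕ) :
    symbolTerm γ ρ α ω p ϑ lam k t n =
      spaceSymbol p ϑ lam k ^ n * gseries (mlCoeff (γ * n) ω) (mlExp α (ρ * n + 1)) t := by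
  rw [← prabhakarKernel_eq_gseries ht, symbolTerm, prabhakarKernel, spaceSymbol, add_sub_cancel_right]
  ring

lemma symbolTerm_zero : symbolTerm γ ρ α ω p ϑ lam k t 0 = 1 := by
  have h : mittagLeffler α 1 0 (ω * ((t ^ α : ℝ) : ℂ)) = 1 := by
    rw [mittagLeffler, tsum_eq_single 0]
    · simp
    · rintro (_ | j) hj
      · simp at hj
      · simp [ascPochhammer_succ_left]
  simp [symbolTerm, h]

lemma hasSum_symbolTerm (hγ : 0 < γ) (hρ : 0 < ρ) (hα : 0 < α) (ht : 0 < t) :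
    HasSum (symbolTerm γ ρ α ω p ϑ lam k t)
      (1 + resPrim γ ρ α ω (spaceSymbol p ϑ lam k) t) := by
  obtain ⟨y, hy, h⟩ := exists_gadm_res hγ hρ hα (spaceSymbol p ϑ lam k) ω
  have h1 := (h.succ.summable_term ht).hasSum
  have h2 : ∀ n : ℕ, HasSum (fun j : ℕ => resCoeff γ ω (spaceSymbol p ϑ lam k) (n, j) *
      (rlKernel (resExp ρ α (n, j) + 1) t : ℂ)) (symbolTerm γ ρ α ω p ϑ lam k t (n + 1)) := by
    intro n
    rw [symbolTerm_eq ht]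
    have h3 := gadm_ml hα (show 0 < ρ * (n + 1 : ℕ) + 1 by positivity) hy (γ * (n + 1 : ℕ))
    refine ((h3.summable_term ht).hasSum.mul_left _).congr_fun fun j => ?_
    simp only [resCoeff, resExp, mlExp, add_assoc, mul_assoc]
  have h4 := h1.prod_fiberwise h2
  -- Row n of the double series is the term of index n + 1; the missing term of index 0 is the
  -- summand 1.
  have h5 := (hasSum_nat_add_iff 1).mp h4
  rw [Finset.sum_range_one, symbolTerm_zero, add_comm] at h5
  exact h5

lemma hasSum_symbolTerm_zero (hρ : 0 < ρ) : HasSum (symbolTerm γ ρ α ω p ϑ lam k 0) 1 := by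
  have := hasSum_single (f := symbolTerm γ ρ α ω p ϑ lam k 0) 0 (fun n hn => by
    have : ρ * (n : ℝ) ≠ 0 := mul_ne_zero hρ.ne' (Nat.cast_ne_zero.mpr hn)
    simp [symbolTerm, Real.zero_rpow this])
  rwa [symbolTerm_zero] at this

end symbol

/-! ### Bounds of the resolvent kernel, uniform in the spatial symbol. -/

section estimates

variable {γ ρ α : ℝ} {ω : ℂ}

/-- The bound `A t^{-1-ρ} / (t^{-ρ} + A)²` of the resolvent kernel, `A` the modulus of the
spatial symbol. -/
noncomputable def resBound (ρ A t : ℝ) : ℝ := A * t ^ (-1 - ρ) / (t ^ (-ρ) + A) ^ 2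

/-- Behaviour of the time symbol in a right half-plane. -/
structure SymbolRegion (γ ρ α : ℝ) (ω : ℂ) (ε R : ℝ) : Prop where
  εpos : 0 < ε
  large : MLLarge α ω R
  half : ∀ s : ℂ, R ≤ s.re → ‖ω * s ^ (-α : ℂ)‖ ≤ 1 / 2
  re_ge : ∀ s : ℂ, R ≤ s.re → ε * ‖s‖ ^ ρ ≤ (timeSymbol γ ρ α ω s).re
  norm_le : ∀ s : ℂ, R ≤ s.re → ‖timeSymbol γ ρ α ω s‖ ≤ 2 * ‖s‖ ^ ρ

/-- As |arg s| < π/2, the power s^ρ has argument at most ρπ/2 in modulus. Since ρ < 1, this is a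
sector strictly inside the right half-plane. -/
lemma cos_mul_norm_rpow_le (hρ : 0 < ρ) (hρ1 : ρ < 1) {s : ℂ} (hs : 0 < s.re) :
    Real.cos (Real.pi / 2 * ρ) * ‖s‖ ^ ρ ≤ (s ^ (ρ : ℂ)).re := by
  rw [Complex.cpow_ofReal_re, mul_comm]
  refine mul_le_mul_of_nonneg_left ?_ (Real.rpow_nonneg (norm_nonneg _) _)
  rw [← Real.cos_abs (s.arg * ρ), abs_mul, abs_of_pos hρ]
  have h := (Complex.abs_arg_lt_pi_div_two_iff).mpr (Or.inl hs)
  refine Real.cos_le_cos_of_nonneg_of_le_pi (by positivity) ?_ ?_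
  · nlinarith [Real.pi_pos]
  · exact mul_le_mul_of_nonneg_right h.le hρ.le

/-- Far to the right ω s^{-α} is small, so φ is s^ρ up to a small relative error. -/
lemma exists_symbolRegion (hρ : 0 < ρ) (hρ1 : ρ < 1) (hα : 0 < α) (γ : ℝ) (ω : ℂ) :
    ∃ ε R, SymbolRegion γ ρ α ω ε R := by
  have hcos : 0 < Real.cos (Real.pi / 2 * ρ) :=
    Real.cos_pos_of_mem_Ioo ⟨by nlinarith [Real.pi_pos], by nlinarith [Real.pi_pos]⟩
  have hcos1 := Real.cos_le_one (Real.pi / 2 * ρ)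
  -- Half of the cosine serves as the lower bound; the other half absorbs the relative error. As ε ≤
  -- 1/2, the upper constant 2 has room as well.
  set ε := Real.cos (Real.pi / 2 * ρ) / 2 with hε
  have hε0 : 0 < ε := by rw [hε]; linarith
  have hc : ContinuousAt (fun z : ℂ => (1 - z) ^ (γ : ℂ)) 0 :=
    ContinuousAt.cpow (by fun_prop) continuousAt_const (by simp)
  obtain ⟨δ, hδ, hδε⟩ := Metric.continuousAt_iff.mp hc ε hε0
  have h0 := (tendsto_rpow_neg_atTop hα).const_mul ‖ω‖
  rw [mul_zero] at h0
  obtain ⟨R, ⟨hR, hRδ⟩, hR2⟩ := ((eventually_MLLarge hα ω).and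
    (h0.eventually_lt_const hδ) |>.and (h0.eventually_lt_const (show (0 : ℝ) < 1 / 2 by norm_num))).exists
  have hw : ∀ s : ℂ, R ≤ s.re → ‖ω * s ^ (-α : ℂ)‖ ≤ ‖ω‖ * R ^ (-α) := fun s hs => by
    have h1 : R ≤ ‖s‖ := hs.trans ((le_abs_self _).trans (Complex.abs_re_le_norm s))
    rw [norm_mul, ← Complex.ofReal_neg, Complex.norm_cpow_real]
    exact mul_le_mul_of_nonneg_left (Real.rpow_le_rpow_of_nonpos hR.1 h1 (by linarith)) (norm_nonneg _)
  have hη : ∀ s : ℂ, R ≤ s.re → ‖(1 - ω * s ^ (-α : ℂ)) ^ (γ : ℂ) - 1‖ < ε := fun s hs => by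
    have := hδε (x := ω * s ^ (-α : ℂ)) (by rw [dist_zero_right]; exact (hw s hs).trans_lt hRδ)
    simpa [dist_eq_norm] using this
  have hsplit : ∀ s : ℂ, timeSymbol γ ρ α ω s =
      s ^ (ρ : ℂ) + s ^ (ρ : ℂ) * ((1 - ω * s ^ (-α : ℂ)) ^ (γ : ℂ) - 1) := fun s => by
    rw [timeSymbol]; ring
  have hsmall : ∀ s : ℂ, R ≤ s.re →
      ‖s ^ (ρ : ℂ) * ((1 - ω * s ^ (-α : ℂ)) ^ (γ : ℂ) - 1)‖ ≤ ‖s‖ ^ ρ * ε := fun s hs => by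
    rw [norm_mul, Complex.norm_cpow_real]
    exact mul_le_mul_of_nonneg_left (hη s hs).le (Real.rpow_nonneg (norm_nonneg _) _)
  refine ⟨ε, R, hε0, hR, fun s hs => (hw s hs).trans hR2.le, fun s hs => ?_, fun s hs => ?_⟩
  · have h1 := cos_mul_norm_rpow_le hρ hρ1 (hR.1.trans_le hs)
    have h2 := (Complex.abs_re_le_norm _).trans (hsmall s hs)
    rw [hsplit, Complex.add_re]
    have := (abs_le.mp h2).1
    have h3 : Real.cos (Real.pi / 2 * ρ) = 2 * ε := by rw [hε]; ring
    rw [h3] at h1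
    linarith
  · rw [hsplit]
    refine (norm_add_le _ _).trans ?_
    have h1 := hsmall s hs
    have h2 : ‖s ^ (ρ : ℂ)‖ = ‖s‖ ^ ρ := Complex.norm_cpow_real _ _
    have h3 := Real.rpow_nonneg (norm_nonneg s) ρ
    rw [h2]
    nlinarith

namespace SymbolRegion

variable {ε R : ℝ}

lemma norm_pos (h : SymbolRegion γ ρ α ω ε R) {s : ℂ} (hs : R ≤ s.re) : 0 < ‖s‖ :=
  norm_pos_iff.mpr (ne_zero_of_le_re h.large.1 hs)

/-- Because Re a ≤ 0, the real part of φ - a is at least Re φ ≥ ε |s|^ρ. Moreover |a| ≤ |φ| + |φ -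
a| with |φ| ≤ 2 |s|^ρ. With |s|^ρ counted 1 + 2 times, the constant is 1 + 3/ε. -/
lemma le_norm_sub (h : SymbolRegion γ ρ α ω ε R) {s a : ℂ} (hs : R ≤ s.re) (ha : a.re ≤ 0) :
    ‖s‖ ^ ρ + ‖a‖ ≤ (1 + 3 / ε) * ‖timeSymbol γ ρ α ω s - a‖ := by
  have hε := h.εpos
  have h1 := h.re_ge s hs
  have h2 := h.norm_le s hs
  have h3 := (le_abs_self _).trans (Complex.abs_re_le_norm (timeSymbol γ ρ α ω s - a))
  rw [Complex.sub_re] at h3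
  have h4 : ‖a‖ ≤ ‖timeSymbol γ ρ α ω s‖ + ‖timeSymbol γ ρ α ω s - a‖ := by
    have := norm_sub_le (timeSymbol γ ρ α ω s) (timeSymbol γ ρ α ω s - a)
    simpa using this
  have h5 : ‖s‖ ^ ρ ≤ ‖timeSymbol γ ρ α ω s - a‖ / ε := by
    rw [le_div_iff₀ hε]; linarith
  have h6 : (1 + 3 / ε) * ‖timeSymbol γ ρ α ω s - a‖ =
    ‖timeSymbol γ ρ α ω s - a‖ + 3 * (‖timeSymbol γ ρ α ω s - a‖ / ε) := by ring
  linarith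

lemma sub_ne_zero (h : SymbolRegion γ ρ α ω ε R) {s a : ℂ} (hs : R ≤ s.re) (ha : a.re ≤ 0) :
    timeSymbol γ ρ α ω s - a ≠ 0 := fun h0 => by
  have h1 := h.le_norm_sub hs ha
  have := Real.rpow_pos_of_pos (h.norm_pos hs) ρ
  rw [h0, norm_zero, mul_zero] at h1
  linarith [norm_nonneg a]

end SymbolRegion

/-- The logarithmic derivative of the time symbol, times `s`. -/
noncomputable def timeSymbolLog (γ ρ α : ℝ) (ω s : ℂ) : ℂ :=
  ρ + γ * α * (ω * s ^ (-α : ℂ) / (1 - ω * s ^ (-α : ℂ)))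

lemma hasDerivAt_pow_neg {s : ℂ} (hs : 0 < s.re) :
    HasDerivAt (fun s : ℂ => ω * s ^ (-α : ℂ)) (-α * (ω * s ^ (-α : ℂ)) / s) s := by
  have hs0 : s ≠ 0 := ne_zero_of_le_re hs le_rfl
  have := ((hasDerivAt_id s).cpow_const (c := (-α : ℂ)) (Or.inl hs)).const_mul ω
  refine this.congr_deriv ?_
  simp only [id]
  rw [Complex.cpow_sub _ _ hs0, Complex.cpow_one]
  ring

lemma hasDerivAt_timeSymbol {s : ℂ} (hs : 0 < s.re) (hw : ‖ω * s ^ (-α : ℂ)‖ < 1) :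
    HasDerivAt (timeSymbol γ ρ α ω) (timeSymbol γ ρ α ω s * timeSymbolLog γ ρ α ω s / s) s := by
  have hs0 : s ≠ 0 := ne_zero_of_le_re hs le_rfl
  have hslit : 1 - ω * s ^ (-α : ℂ) ∈ Complex.slitPlane := by
    rw [sub_eq_add_neg]
    exact Complex.mem_slitPlane_of_norm_lt_one (by rwa [norm_neg])
  have hne := Complex.slitPlane_ne_zero hslit
  have h1 := (hasDerivAt_id s).cpow_const (c := (ρ : ℂ)) (Or.inl hs)
  have h2 := ((hasDerivAt_pow_neg (ω := ω) (α := α) hs).const_sub 1).cpow_const (c := (γ : ℂ)) hslit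
  refine (h1.mul h2).congr_deriv ?_
  simp only [id, timeSymbol, timeSymbolLog]
  rw [Complex.cpow_sub _ _ hs0, Complex.cpow_one, Complex.cpow_sub _ _ hne, Complex.cpow_one]
  field_simp

lemma hasDerivAt_timeSymbolLog {s : ℂ} (hs : 0 < s.re) (hw : ‖ω * s ^ (-α : ℂ)‖ < 1) :
    HasDerivAt (timeSymbolLog γ ρ α ω)
      (-(γ * α ^ 2 * (ω * s ^ (-α : ℂ)) / (1 - ω * s ^ (-α : ℂ)) ^ 2) / s) s := by
  have hs0 : s ≠ 0 := ne_zero_of_le_re hs le_rfl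
  have hne : 1 - ω * s ^ (-α : ℂ) ≠ 0 := fun h0 => by
    rw [← _root_.sub_eq_zero.mp h0] at hw
    simp at hw
  have h1 := hasDerivAt_pow_neg (ω := ω) (α := α) hs
  have h2 := ((h1.div (h1.const_sub 1) hne).const_mul (γ * α : ℂ)).const_add (ρ : ℂ)
  refine h2.congr_deriv ?_
  field_simp
  ring

/-- The second derivative of `a / (φ - a)`, `φ` the time symbol. -/
noncomputable def resolventDeriv2 (γ ρ α : ℝ) (ω a s : ℂ) : ℂ :=
  -a * (timeSymbol γ ρ α ω s / s ^ 2 * (timeSymbolLog γ ρ α ω s ^ 2 - timeSymbolLog γ ρ α ω s -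
    γ * α ^ 2 * (ω * s ^ (-α : ℂ)) / (1 - ω * s ^ (-α : ℂ)) ^ 2)) /
      (timeSymbol γ ρ α ω s - a) ^ 2 +
  2 * a * (timeSymbol γ ρ α ω s * timeSymbolLog γ ρ α ω s / s) ^ 2 /
    (timeSymbol γ ρ α ω s - a) ^ 3

variable {ε R : ℝ}

lemma SymbolRegion.hasDerivAt_resolvent (h : SymbolRegion γ ρ α ω ε R) {s a : ℂ} (hs : R ≤ s.re)
    (ha : a.re ≤ 0) :
    HasDerivAt (fun s => a / (timeSymbol γ ρ α ω s - a))
      (-a * (timeSymbol γ ρ α ω s * timeSymbolLog γ ρ α ω s / s) /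
        (timeSymbol γ ρ α ω s - a) ^ 2) s := by
  have hw : ‖ω * s ^ (-α : ℂ)‖ < 1 := (h.half s hs).trans_lt (by norm_num)
  have h1 := hasDerivAt_timeSymbol (γ := γ) (ρ := ρ) (h.large.1.trans_le hs) hw
  refine ((hasDerivAt_const s a).div (h1.sub_const a) (h.sub_ne_zero hs ha)).congr_deriv ?_
  ring

lemma SymbolRegion.hasDerivAt_resolvent' (h : SymbolRegion γ ρ α ω ε R) {s a : ℂ} (hs : R ≤ s.re)
    (ha : a.re ≤ 0) :
    HasDerivAt (fun s => -a * (timeSymbol γ ρ α ω s * timeSymbolLog γ ρ α ω s / s) /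
        (timeSymbol γ ρ α ω s - a) ^ 2) (resolventDeriv2 γ ρ α ω a s) s := by
  have hw : ‖ω * s ^ (-α : ℂ)‖ < 1 := (h.half s hs).trans_lt (by norm_num)
  have hs1 := h.large.1.trans_le hs
  have hs0 : s ≠ 0 := ne_zero_of_le_re h.large.1 hs
  have hne := h.sub_ne_zero hs ha
  have h1 := hasDerivAt_timeSymbol (γ := γ) (ρ := ρ) hs1 hw
  have h2 := hasDerivAt_timeSymbolLog (γ := γ) (ρ := ρ) hs1 hw
  have h3 := (((h1.mul h2).div (hasDerivAt_id s) hs0).const_mul (-a)).div ((h1.sub_const a).pow 2)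
    (pow_ne_zero 2 hne)
  refine h3.congr_deriv ?_
  simp only [resolventDeriv2, id, Pi.mul_apply, Pi.div_apply, Pi.pow_apply]
  -- With the transcendental quantities made opaque, only an identity of rational functions is left.
  generalize timeSymbol γ ρ α ω s = φ at *
  generalize timeSymbolLog γ ρ α ω s = q at *
  generalize hW : (γ * α ^ 2 * (ω * s ^ (-α : ℂ)) / (1 - ω * s ^ (-α : ℂ)) ^ 2) = W at *
  push_cast
  field_simp
  ring

/-- The logarithmic derivative of φ, times s, is bounded, so each differentiation gains a factor
1/|s|. Two are taken because, once the denominator is bounded below independently of Im s, the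
remaining |s|^{ρ-2} is integrable along vertical lines, while |s|^{ρ-1} would not be. -/
lemma SymbolRegion.norm_resolventDeriv2_le (h : SymbolRegion γ ρ α ω ε R) (hγ : 0 < γ)
    (hρ : 0 < ρ) (hα : 0 < α) : ∃ M : ℝ, 0 < M ∧ ∀ s a : ℂ, R ≤ s.re → a.re ≤ 0 →
      ‖resolventDeriv2 γ ρ α ω a s‖ ≤ M * (‖a‖ * ‖s‖ ^ (ρ - 2) / (‖s‖ ^ ρ + ‖a‖) ^ 2) := by
  set Q := ρ + γ * α with hQ
  set D := 1 + 3 / ε with hD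
  have hε := h.εpos
  have hQ0 : 0 < Q := by positivity
  have hD0 : 0 < D := by positivity
  refine ⟨2 * (Q ^ 2 + Q + 2 * (γ * α ^ 2)) * D ^ 2 + 8 * Q ^ 2 * D ^ 3, by positivity,
    fun s a hs ha => ?_⟩
  have hsp := h.norm_pos hs
  have hw := h.half s hs
  have h1w : 1 / 2 ≤ ‖1 - ω * s ^ (-α : ℂ)‖ := by
    have := norm_sub_norm_le 1 (ω * s ^ (-α : ℂ))
    rw [norm_one] at this
    linarith
  have hφ := h.norm_le s hs
  have hsub := h.le_norm_sub hs ha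
  have hsρ := Real.rpow_pos_of_pos hsp ρ
  set N := ‖s‖ ^ ρ + ‖a‖ with hN
  have hN0 : 0 < N := by positivity
  set P := ‖timeSymbol γ ρ α ω s - a‖ with hP
  have hP0 : 0 < P := norm_pos_iff.mpr (h.sub_ne_zero hs ha)
  have hPinv : 1 / P ≤ D / N := by rw [div_le_div_iff₀ hP0 hN0]; linarith
  -- In the term with the cube of φ - a below, one of the two factors φ is estimated by 2N; this
  -- cancels one denominator and leaves the shape of the other term.
  have hφN : ‖timeSymbol γ ρ α ω s‖ ≤ 2 * N := hφ.trans (by rw [hN]; linarith [norm_nonneg a])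
  have hq : ‖timeSymbolLog γ ρ α ω s‖ ≤ Q := by
    rw [timeSymbolLog, hQ]
    refine (norm_add_le _ _).trans ?_
    simp only [norm_mul, norm_div, Complex.norm_real, Real.norm_of_nonneg hρ.le,
      Real.norm_of_nonneg hγ.le, Real.norm_of_nonneg hα.le]
    rw [← norm_mul]
    have : ‖ω * s ^ (-α : ℂ)‖ / ‖1 - ω * s ^ (-α : ℂ)‖ ≤ 1 := by
      rw [div_le_one (by linarith)]; linarith
    nlinarith [mul_pos hγ hα]
  have hW : ‖(γ * α ^ 2 * (ω * s ^ (-α : ℂ)) / (1 - ω * s ^ (-α : ℂ)) ^ 2 : ℂ)‖ ≤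
      2 * (γ * α ^ 2) := by
    rw [norm_div, norm_mul, norm_pow, div_le_iff₀ (by positivity)]
    have e : ‖(γ * α ^ 2 : ℂ)‖ = γ * α ^ 2 := by
      rw [← Complex.ofReal_pow, ← Complex.ofReal_mul, Complex.norm_real,
        Real.norm_of_nonneg (by positivity)]
    rw [e]
    have hc : 0 < γ * α ^ 2 := by positivity
    have h4 : 1 / 4 ≤ ‖1 - ω * s ^ (-α : ℂ)‖ ^ 2 := by nlinarith
    nlinarith
  have hbr : ‖timeSymbolLog γ ρ α ω s ^ 2 - timeSymbolLog γ ρ α ω s -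
      γ * α ^ 2 * (ω * s ^ (-α : ℂ)) / (1 - ω * s ^ (-α : ℂ)) ^ 2‖ ≤
      Q ^ 2 + Q + 2 * (γ * α ^ 2) := by
    refine (norm_sub_le _ _).trans (add_le_add ((norm_sub_le _ _).trans ?_) hW)
    rw [norm_pow]
    exact add_le_add (pow_le_pow_left₀ (norm_nonneg _) hq 2) hq
  have hs2 : ‖s‖ ^ (ρ - 2) = ‖s‖ ^ ρ / ‖s‖ ^ 2 := by
    rw [Real.rpow_sub hsp, Real.rpow_two]
  rw [hs2, resolventDeriv2]
  refine (norm_add_le _ _).trans ?_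
  simp only [norm_mul, norm_div, norm_pow, norm_neg, Complex.norm_ofNat]
  have t1 : ‖a‖ * (‖timeSymbol γ ρ α ω s‖ / ‖s‖ ^ 2 * ‖timeSymbolLog γ ρ α ω s ^ 2 -
      timeSymbolLog γ ρ α ω s - γ * α ^ 2 * (ω * s ^ (-α : ℂ)) /
      (1 - ω * s ^ (-α : ℂ)) ^ 2‖) / P ^ 2 ≤
      ‖a‖ * (2 * ‖s‖ ^ ρ / ‖s‖ ^ 2 * (Q ^ 2 + Q + 2 * (γ * α ^ 2))) * (D / N) ^ 2 := by
    rw [div_eq_mul_one_div _ (P ^ 2), ← one_div_pow]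
    gcongr
  have t2 : 2 * ‖a‖ * (‖timeSymbol γ ρ α ω s‖ * ‖timeSymbolLog γ ρ α ω s‖ / ‖s‖) ^ 2 / P ^ 3 ≤
      2 * ‖a‖ * ((2 * N) * (2 * ‖s‖ ^ ρ) * Q ^ 2 / ‖s‖ ^ 2) * (D / N) ^ 3 := by
    rw [div_eq_mul_one_div _ (P ^ 3), ← one_div_pow, div_pow, mul_pow, pow_two ‖timeSymbol γ ρ α ω s‖]
    gcongr
  refine (add_le_add t1 t2).trans (le_of_eq ?_)
  field_simp
  ring

lemma integrable_add_abs_rpow (hρ1 : ρ < 1) : Integrable fun ξ : ℝ => (1 + |ξ|) ^ (ρ - 2) := by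
  have := integrable_one_add_norm (E := ℝ) (μ := volume) (r := 2 - ρ) (by simp; linarith)
  simpa [Real.norm_eq_abs] using this

/-- Scaling ξ by σ; the factor σ^{ρ-1} later becomes t^{1-ρ}. -/
lemma integral_add_abs_rpow (hρ1 : ρ < 1) {σ : ℝ} (hσ : 0 < σ) :
    Integrable (fun ξ : ℝ => (σ + |ξ|) ^ (ρ - 2)) ∧
    ∫ ξ : ℝ, (σ + |ξ|) ^ (ρ - 2) = σ ^ (ρ - 1) * ∫ ξ : ℝ, (1 + |ξ|) ^ (ρ - 2) := by
  have e : (fun ξ : ℝ => (σ + |ξ|) ^ (ρ - 2)) =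
      fun ξ => σ ^ (ρ - 2) * (fun ξ : ℝ => (1 + |ξ|) ^ (ρ - 2)) (ξ / σ) := by
    ext ξ
    rw [← Real.mul_rpow hσ.le (by positivity), abs_div, abs_of_pos hσ]
    congr 1; field_simp
  rw [e]
  refine ⟨((integrable_add_abs_rpow hρ1).comp_div hσ.ne').const_mul _, ?_⟩
  rw [integral_const_mul, Measure.integral_comp_div (fun ξ : ℝ => (1 + |ξ|) ^ (ρ - 2)) σ, abs_of_pos hσ, smul_eq_mul, ← mul_assoc,
    ← Real.rpow_add_one hσ.ne']
  ring_nf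

/-- The function is the derivative of a holomorphic one, so its long formula is not differentiated
again. -/
lemma SymbolRegion.differentiableOn_resolventDeriv2 (h : SymbolRegion γ ρ α ω ε R) {a : ℂ}
    (ha : a.re ≤ 0) : DifferentiableOn ℂ (resolventDeriv2 γ ρ α ω a) {s | R < s.re} := by
  have hopen : IsOpen {s : ℂ | R < s.re} := isOpen_lt continuous_const Complex.continuous_re
  have h1 : DifferentiableOn ℂ (fun s => -a * (timeSymbol γ ρ α ω s * timeSymbolLog γ ρ α ω s / s) /
        (timeSymbol γ ρ α ω s - a) ^ 2) {s | R < s.re} := fun s hs =>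
    (h.hasDerivAt_resolvent' (le_of_lt hs) ha).differentiableAt.differentiableWithinAt
  refine (h1.deriv hopen).congr fun s hs => ?_
  exact (h.hasDerivAt_resolvent' (le_of_lt hs) ha).deriv.symm

/-- The resolvent kernel is dominated by `resBound`, uniformly in the symbol. -/
theorem exists_resKernel_bound (hγ : 0 < γ) (hρ : 0 < ρ) (hρ1 : ρ < 1) (hα : 0 < α) (ω : ℂ) :
    ∃ A R : ℝ, 0 < A ∧ 0 < R ∧ ∀ a : ℂ, a.re ≤ 0 → ∀ t, 0 < t →
      ‖resKernel γ ρ α ω a t‖ ≤ A * Real.exp (R * t) * resBound ρ ‖a‖ t := by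
  obtain ⟨ε, R, h⟩ := exists_symbolRegion hρ hρ1 hα γ ω
  obtain ⟨M, hM, hbd⟩ := h.norm_resolventDeriv2_le hγ hρ hα
  have hR := h.large.1
  set J := ∫ ξ : ℝ, (1 + |ξ|) ^ (ρ - 2) with hJ
  have hJ0 : 0 ≤ J := integral_nonneg fun ξ => Real.rpow_nonneg (by positivity) _
  -- The factor 2^{2-ρ} comes from |s| ≥ (σ + |ξ|)/2 and e from the choice of σ below; the summand 1
  -- only makes A positive.
  set A := M * (2 : ℝ) ^ (2 - ρ) * J * Real.exp 1 + 1 with hA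
  refine ⟨A, R, by positivity, hR, fun a ha t ht => ?_⟩
  -- bound on vertical lines
  have hvert : ∀ σ : ℝ, R ≤ σ → ∀ ξ : ℝ, ‖resolventDeriv2 γ ρ α ω a (σ + Complex.I * ξ)‖ ≤
      M * (‖a‖ * (2 : ℝ) ^ (2 - ρ) / (σ ^ ρ + ‖a‖) ^ 2) * (σ + |ξ|) ^ (ρ - 2) := by
    intro σ hσ ξ
    have hσ0 : 0 < σ := hR.trans_le hσ
    set s : ℂ := σ + Complex.I * ξ with hs
    have hre : s.re = σ := by simp [hs]
    have him : s.im = ξ := by simp [hs]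
    have h1 : σ ≤ ‖s‖ := by
      have := (le_abs_self _).trans (Complex.abs_re_le_norm s); rwa [hre] at this
    have h2 : |ξ| ≤ ‖s‖ := by have := Complex.abs_im_le_norm s; rwa [him] at this
    refine (hbd s a (by rw [hre]; exact hσ) ha).trans ?_
    have h3 : ‖s‖ ^ (ρ - 2) ≤ (2 : ℝ) ^ (2 - ρ) * (σ + |ξ|) ^ (ρ - 2) := by
      have e : (2 : ℝ) ^ (2 - ρ) * (σ + |ξ|) ^ (ρ - 2) = ((σ + |ξ|) / 2) ^ (ρ - 2) := by
        rw [Real.div_rpow (by positivity) (by norm_num), show (2 - ρ) = -(ρ - 2) by ring,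
          Real.rpow_neg (by norm_num)]
        ring
      rw [e]
      exact Real.rpow_le_rpow_of_nonpos (by positivity) (by linarith) (by linarith)
    have h4 : σ ^ ρ ≤ ‖s‖ ^ ρ := Real.rpow_le_rpow hσ0.le h1 hρ.le
    have h5 := Real.rpow_pos_of_pos hσ0 ρ
    calc M * (‖a‖ * ‖s‖ ^ (ρ - 2) / (‖s‖ ^ ρ + ‖a‖) ^ 2)
        ≤ M * (‖a‖ * ((2 : ℝ) ^ (2 - ρ) * (σ + |ξ|) ^ (ρ - 2)) / (σ ^ ρ + ‖a‖) ^ 2) := by gcongr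
      _ = _ := by ring
  -- Laplace transform of `t² r`
  obtain ⟨y, ⟨hy, hg⟩, hyR⟩ := ((eventually_gadm_res a hγ hρ hα).and
    (eventually_ge_atTop (R + 1 / t))).exists
  have hadm : LaplaceAdm (resKernel γ ρ α ω a) y := hg.laplaceAdm
  have hRy : R ≤ y := le_trans (by have : 0 < 1 / t := by positivity
                                   linarith) hyR
  have hopen : IsOpen {s : ℂ | y < s.re} := isOpen_lt continuous_const Complex.continuous_re
  have hL1 : ∀ s : ℂ, y < s.re → laplaceT (fun t => (t : ℂ) * resKernel γ ρ α ω a t) s =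
      -(-a * (timeSymbol γ ρ α ω s * timeSymbolLog γ ρ α ω s / s) /
        (timeSymbol γ ρ α ω s - a) ^ 2) := fun s hs => by
    have h1 := hadm.hasDerivAt hs
    have h2 := (h.hasDerivAt_resolvent (hRy.trans hs.le) ha).congr_of_eventuallyEq
      (f₁ := laplaceT (resKernel γ ρ α ω a)) (by
        filter_upwards [hopen.mem_nhds hs] with w hw
        exact (laplaceT_resKernel hα hy hg (le_of_lt hw)).2)
    rw [← h1.unique h2, neg_neg]
  have hL2 : ∀ s : ℂ, y < s.re → laplaceT (fun t => (t : ℂ) * ((t : ℂ) * resKernel γ ρ α ω a t)) s =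
      resolventDeriv2 γ ρ α ω a s := fun s hs => by
    have h1 := hadm.mul_id.hasDerivAt hs
    have h2 := (h.hasDerivAt_resolvent' (hRy.trans hs.le) ha).neg.congr_of_eventuallyEq
      (f₁ := laplaceT fun t => (t : ℂ) * resKernel γ ρ α ω a t) (by
        filter_upwards [hopen.mem_nhds hs] with w hw
        exact hL1 w hw)
    have := h1.unique h2
    exact neg_injective this
  have hint : ∀ σ : ℝ, R < σ → Integrable fun ξ : ℝ => resolventDeriv2 γ ρ α ω a (σ + Complex.I * ξ) := by
    intro σ hσ
    refine Integrable.mono' ((integral_add_abs_rpow hρ1 (hR.trans hσ)).1.const_mul _) ?_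
      (ae_of_all _ (hvert σ hσ.le))
    exact ((h.differentiableOn_resolventDeriv2 ha).continuousOn.comp_continuous (by fun_prop)
      (fun ξ => by simpa using hσ)).aestronglyMeasurable
  have hre : ∀ ξ : ℝ, y < (((y + 1 : ℝ) : ℂ) + Complex.I * ξ).re := fun ξ => by simp
  have hinv := laplaceT_inversion (hadm.mul_id.mul_id) (σ := y + 1) (by linarith) (by
      simp only [hL2 _ (hre _)]
      exact hint _ (by linarith)) ht (by
      refine ContinuousAt.mul (by fun_prop) (ContinuousAt.mul (by fun_prop) ?_)
      exact (continuousOn_resKernel hγ hρ hα).continuousAt (Ioi_mem_nhds ht))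
  simp only [hL2 _ (hre _)] at hinv
  -- This abscissa keeps e^{σt} = e · e^{Rt} under control, while σ ≥ 1/t turns powers of σ into
  -- powers of 1/t.
  set σ := R + 1 / t with hσ
  have hσR : R < σ := by rw [hσ]; have : 0 < 1 / t := by positivity
                         linarith
  have hσ0 := hR.trans hσR
  -- The crucial point for uniformity: inversion is available at y + 1, where y depends on a, but
  -- the integrand is holomorphic for Re s > R whenever Re a ≤ 0. The contour can thus be moved to
  -- σ, which does not depend on a.
  have hshift := integral_vertical_eq (G := fun s => Complex.exp (s * t) * resolventDeriv2 γ ρ α ω a s)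
    (x₀ := R) (σ₁ := σ) (σ₂ := y + 1) (q := 2 - ρ)
    (M := Real.exp ((y + 1) * t) * (M * (‖a‖ * (2 : ℝ) ^ (2 - ρ) / (σ ^ ρ + ‖a‖) ^ 2)))
    (DifferentiableOn.mul (by fun_prop) (h.differentiableOn_resolventDeriv2 ha)) hσR
    (by linarith) (by linarith) (by
      intro s hs1 hs2 hs3
      rw [norm_mul, Complex.norm_exp, mul_assoc]
      have e : s = s.re + Complex.I * s.im := by rw [mul_comm]; exact (Complex.re_add_im s).symm
      have h1 := hvert s.re (hσR.le.trans hs1) s.im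
      rw [← e] at h1
      have h2 : (s * t).re = s.re * t := by simp
      have h3 := Real.rpow_pos_of_pos hσ0 ρ
      have h4 : σ ^ ρ ≤ s.re ^ ρ := Real.rpow_le_rpow hσ0.le hs1 hρ.le
      have h5 : (s.re + |s.im|) ^ (ρ - 2) ≤ |s.im| ^ (-(2 - ρ)) := by
        rw [neg_sub]
        exact Real.rpow_le_rpow_of_nonpos (by linarith) (by linarith) (by linarith)
      have h6 : 0 ≤ (s.re + |s.im|) ^ (ρ - 2) := Real.rpow_nonneg (by linarith) _
      rw [h2]
      refine mul_le_mul (Real.exp_le_exp.mpr (mul_le_mul_of_nonneg_right hs2 ht.le)) (h1.trans ?_)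
        (norm_nonneg _) (Real.exp_pos _).le
      gcongr)
  have hline : (t : ℂ) * ((t : ℂ) * resKernel γ ρ α ω a t) = (1 / (2 * (Real.pi : ℂ))) *
      ∫ ξ : ℝ, Complex.exp ((σ + Complex.I * ξ) * t) * resolventDeriv2 γ ρ α ω a (σ + Complex.I * ξ) := by
    rw [hinv]
    congr 1
    exact hshift.symm
  have hnorm := congrArg norm hline
  rw [norm_mul, norm_mul, Complex.norm_real, Real.norm_of_nonneg ht.le, norm_mul] at hnorm
  have hσρ := Real.rpow_pos_of_pos hσ0 ρ
  have hI : ‖∫ ξ : ℝ, Complex.exp ((σ + Complex.I * ξ) * t) *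
      resolventDeriv2 γ ρ α ω a (σ + Complex.I * ξ)‖ ≤
      Real.exp (σ * t) * (M * (‖a‖ * (2 : ℝ) ^ (2 - ρ) / (σ ^ ρ + ‖a‖) ^ 2)) * (σ ^ (ρ - 1) * J) := by
    rw [← (integral_add_abs_rpow hρ1 hσ0).2, ← integral_const_mul]
    refine norm_integral_le_of_norm_le ((integral_add_abs_rpow hρ1 hσ0).1.const_mul _)
      (ae_of_all _ fun ξ => ?_)
    rw [norm_mul, Complex.norm_exp, mul_assoc]
    have h2 : ((σ + Complex.I * ξ) * t : ℂ).re = σ * t := by simp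
    rw [h2]
    exact mul_le_mul_of_nonneg_left (hvert σ hσR.le ξ) (Real.exp_pos _).le
  have hpi : ‖(1 / (2 * (Real.pi : ℂ)))‖ ≤ 1 := by
    rw [norm_div, norm_mul, Complex.norm_real, Real.norm_of_nonneg Real.pi_pos.le, norm_one,
      Complex.norm_ofNat, div_le_one (by positivity)]
    linarith [Real.pi_gt_three]
  have htt : 0 < 1 / t := by positivity
  have hs1 : σ ^ (ρ - 1) ≤ t ^ (1 - ρ) := by
    have : t ^ (1 - ρ) = (1 / t) ^ (ρ - 1) := by
      rw [one_div, Real.inv_rpow ht.le, ← Real.rpow_neg ht.le, neg_sub]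
    rw [this]
    exact Real.rpow_le_rpow_of_nonpos htt (by rw [hσ]; linarith) (by linarith)
  have hs2 : t ^ (-ρ) ≤ σ ^ ρ := by
    have : t ^ (-ρ) = (1 / t) ^ ρ := by
      rw [one_div, Real.inv_rpow ht.le, ← Real.rpow_neg ht.le]
    rw [this]
    exact Real.rpow_le_rpow htt.le (by rw [hσ]; linarith) hρ.le
  have htρ := Real.rpow_pos_of_pos ht (-ρ)
  have hexp : Real.exp (σ * t) = Real.exp 1 * Real.exp (R * t) := by
    rw [← Real.exp_add, hσ]; congr 1; field_simp; ring
  have hfin : t * (t * ‖resKernel γ ρ α ω a t‖) ≤ A * Real.exp (R * t) *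
      (‖a‖ * t ^ (1 - ρ) / (t ^ (-ρ) + ‖a‖) ^ 2) := by
    rw [hnorm]
    calc _ ≤ 1 * (Real.exp (σ * t) * (M * (‖a‖ * (2 : ℝ) ^ (2 - ρ) / (σ ^ ρ + ‖a‖) ^ 2)) *
          (σ ^ (ρ - 1) * J)) := mul_le_mul hpi hI (norm_nonneg _) zero_le_one
      _ ≤ 1 * ((Real.exp 1 * Real.exp (R * t)) * (M * (‖a‖ * (2 : ℝ) ^ (2 - ρ) /
          (t ^ (-ρ) + ‖a‖) ^ 2)) * (t ^ (1 - ρ) * J)) := by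
        rw [hexp]; gcongr
      _ = (A - 1) * Real.exp (R * t) * (‖a‖ * t ^ (1 - ρ) / (t ^ (-ρ) + ‖a‖) ^ 2) := by
        rw [hA]; ring
      _ ≤ _ := by gcongr; linarith
  have ht1 : t ^ (1 - ρ) = t ^ (-1 - ρ) * t ^ 2 := by
    rw [← Real.rpow_two, ← Real.rpow_add ht]; ring_nf
  rw [resBound]
  have ht2 : 0 < t ^ 2 := by positivity
  refine le_of_mul_le_mul_left ?_ ht2
  calc t ^ 2 * ‖resKernel γ ρ α ω a t‖ = t * (t * ‖resKernel γ ρ α ω a t‖) := by ring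
    _ ≤ _ := hfin
    _ = _ := by rw [ht1]; ring

end estimates

/-! ### The majorant of the resolvent kernel and weakly singular weights. -/

section bounds

variable {ρ A t : ℝ}

lemma resBound_eq (ht : 0 < t) : resBound ρ A t = A * t ^ (ρ - 1) / (1 + A * t ^ ρ) ^ 2 := by
  have h := Real.rpow_pos_of_pos ht ρ
  have h1 : t ^ (-ρ) = (t ^ ρ)⁻¹ := Real.rpow_neg ht.le ρ
  have h2 : t ^ (-1 - ρ) = t⁻¹ * (t ^ ρ)⁻¹ := by
    rw [Real.rpow_sub ht, Real.rpow_neg_one]; rfl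
  have h3 : t ^ (ρ - 1) = t ^ ρ * t⁻¹ := by rw [Real.rpow_sub_one ht.ne']; rfl
  rw [resBound, h1, h2, h3]
  have e : (t ^ ρ)⁻¹ + A = (t ^ ρ)⁻¹ * (1 + A * t ^ ρ) := by field_simp
  rw [e, mul_pow]
  field_simp

lemma resBound_nonneg (hA : 0 ≤ A) (ht : 0 < t) : 0 ≤ resBound ρ A t :=
  div_nonneg (mul_nonneg hA (Real.rpow_nonneg ht.le _)) (sq_nonneg _)

/-- With z = A t^ρ, the product of t and the majorant is z/(1 + z)² ≤ 1. -/
lemma resBound_le (hA : 0 ≤ A) (ht : 0 < t) : resBound ρ A t ≤ 1 / t := by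
  have h := Real.rpow_pos_of_pos ht ρ
  have hp : 0 < (1 + A * t ^ ρ) ^ 2 := by positivity
  rw [resBound_eq ht, Real.rpow_sub_one ht.ne', div_le_div_iff₀ hp ht]
  have : A * (t ^ ρ / t) * t = A * t ^ ρ := by field_simp
  rw [this]
  nlinarith [mul_nonneg hA h.le]

lemma measurable_resBound : Measurable fun x : ℝ × ℝ => resBound ρ x.1 x.2 := by
  unfold resBound; fun_prop

/-- The majorant has the explicit primitive z/(ρ(1 + z)), z = A τ^ρ, which vanishes at 0 and stays
below 1/ρ for every A. This independence of A lets all frequencies be treated at once. -/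
lemma integral_resBound_le (hρ : 0 < ρ) (hA : 0 ≤ A) (ht : 0 < t) :
    IntegrableOn (resBound ρ A) (Set.Ioc 0 t) ∧ ∫ τ in Set.Ioc 0 t, resBound ρ A τ ≤ 1 / ρ := by
  set Φ : ℝ → ℝ := fun τ => (1 / ρ) * (A * τ ^ ρ / (1 + A * τ ^ ρ)) with hΦ
  have hc : ContinuousOn Φ (Set.Icc 0 t) := by
    have h1 : Continuous fun τ : ℝ => τ ^ ρ := Real.continuous_rpow_const hρ.le
    refine continuousOn_const.mul (ContinuousOn.div (by fun_prop) (by fun_prop) fun τ hτ => ?_)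
    have := Real.rpow_nonneg hτ.1 ρ
    positivity
  have hd : ∀ τ ∈ Set.Ioo 0 t, HasDerivAt Φ (resBound ρ A τ) τ := fun τ hτ => by
    have hτ0 := hτ.1
    have h := Real.rpow_pos_of_pos hτ0 ρ
    have h1 := (Real.hasDerivAt_rpow_const (p := ρ) (Or.inl hτ0.ne')).const_mul A
    have hne : 1 + A * τ ^ ρ ≠ 0 := by positivity
    refine ((h1.div (h1.const_add 1) hne).const_mul (1 / ρ)).congr_deriv ?_
    rw [resBound_eq hτ0]
    field_simp
    ring
  have hi : IntegrableOn (resBound ρ A) (Set.Ioc 0 t) :=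
    intervalIntegral.integrableOn_deriv_of_nonneg hc hd fun τ hτ => resBound_nonneg hA hτ.1
  refine ⟨hi, ?_⟩
  rw [← intervalIntegral.integral_of_le ht.le, intervalIntegral.integral_eq_sub_of_hasDerivAt_of_le
    ht.le hc hd ((intervalIntegrable_iff_integrableOn_Ioc_of_le ht.le).mpr hi)]
  have h := Real.rpow_pos_of_pos ht ρ
  have h0 : Φ 0 = 0 := by simp [hΦ, Real.zero_rpow hρ.ne']
  rw [h0, sub_zero, hΦ]
  have : A * t ^ ρ / (1 + A * t ^ ρ) ≤ 1 := by
    rw [div_le_one (by positivity)]; linarith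
  have hρ' : 0 < 1 / ρ := by positivity
  simp only
  nlinarith

/-- The interval is split at t/2: on the left half the weight is bounded, on the right half f is. -/
lemma weight_mul_le {c τ f : ℝ} (hρ : 0 < ρ) (hτ : 0 < τ) (hτt : τ < t) (hf0 : 0 ≤ f)
    (hf : f ≤ c / τ) :
    (t - τ) ^ (-ρ) * f ≤ (t / 2) ^ (-ρ) * f + 2 * c / t * (t - τ) ^ (-ρ) := by
  have ht : 0 < t := hτ.trans hτt
  have h1 := Real.rpow_pos_of_pos (sub_pos.mpr hτt) (-ρ)
  have h2 := Real.rpow_pos_of_pos (half_pos ht) (-ρ)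
  have hc : 0 ≤ c := by
    by_contra hc
    have := div_neg_of_neg_of_pos (not_le.mp hc) hτ
    linarith
  rcases le_or_gt τ (t / 2) with h | h
  · have : (t - τ) ^ (-ρ) ≤ (t / 2) ^ (-ρ) :=
      Real.rpow_le_rpow_of_nonpos (half_pos ht) (by linarith) (by linarith)
    have h3 : 0 ≤ 2 * c / t * (t - τ) ^ (-ρ) := by positivity
    nlinarith
  · have : f ≤ 2 * c / t := by
      refine hf.trans ?_
      rw [div_le_div_iff₀ hτ ht]
      nlinarith
    have h3 : 0 ≤ (t / 2) ^ (-ρ) * f := by positivity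
    nlinarith

lemma integrableOn_sub_rpow (hρ1 : ρ < 1) (ht : 0 < t) :
    IntegrableOn (fun τ : ℝ => (t - τ) ^ (-ρ)) (Set.Ioo 0 t) := by
  have := (intervalIntegral.intervalIntegrable_rpow' (a := 0) (b := t) (r := -ρ)
    (by linarith)).comp_sub_left t
  rw [← intervalIntegrable_iff_integrableOn_Ioo_of_le ht.le]
  simpa using this.symm

end bounds

/-! ### Associativity of convolution; the time derivative as a single convolution. -/

section assoc

lemma measurable_indicator_Ioi {k : ℝ → ℂ} (hk : ContinuousOn k (Set.Ioi 0)) :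
    Measurable ((Set.Ioi (0 : ℝ)).indicator k) := by
  rw [← Set.piecewise_eq_indicator]
  exact hk.measurable_piecewise continuousOn_const measurableSet_Ioi

lemma integrableOn_shifted_beta {b c s T : ℝ} (hb : 0 < b) (hc : 0 < c) (hs : s < T) :
    IntegrableOn (fun τ => (T - τ) ^ (b - 1) * (τ - s) ^ (c - 1)) (Set.Ioo s T) ∧
    ∫ τ in Set.Ioo s T, (T - τ) ^ (b - 1) * (τ - s) ^ (c - 1) =
      (T - s) ^ (b + c - 1) * (Real.Gamma b * Real.Gamma c / Real.Gamma (b + c)) := by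
  have h0 : 0 < T - s := sub_pos.mpr hs
  have e : (fun τ : ℝ => (T - τ) ^ (b - 1) * (τ - s) ^ (c - 1)) =
      fun τ => (fun u => (T - s - u) ^ (b - 1) * u ^ (c - 1)) (τ - s) := by
    ext τ; simp
  constructor
  · rw [← intervalIntegrable_iff_integrableOn_Ioo_of_le hs.le, e]
    simpa using (intervalIntegrable_rpow_mul_rpow hb hc h0).comp_sub_right s
  · rw [← integral_rpow_mul_rpow hb hc h0, ← integral_Ioc_eq_integral_Ioo,
      ← intervalIntegral.integral_of_le hs.le, e, intervalIntegral.integral_comp_sub_right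
        (fun u => (T - s - u) ^ (b - 1) * u ^ (c - 1)) s]
    simp

/-- Associativity of the convolution on the half line, for kernels with integrable power
singularities. -/
lemma halfConv_assoc {β₁ β₂ A T : ℝ} {k₁ k₂ f : ℝ → ℂ} (hT : 0 < T) (h₁ : 0 < β₁) (h₂ : 0 < β₂)
    (hc₁ : ContinuousOn k₁ (Set.Ioi 0)) (hc₂ : ContinuousOn k₂ (Set.Ioi 0))
    (hk₁ : ∀ τ, 0 < τ → τ ≤ T → ‖k₁ τ‖ ≤ A * τ ^ (β₁ - 1))
    (hk₂ : ∀ τ, 0 < τ → τ ≤ T → ‖k₂ τ‖ ≤ A * τ ^ (β₂ - 1))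
    (hfm : AEStronglyMeasurable f (volume.restrict (Set.Ioo 0 T)))
    (hf : IntegrableOn (fun s => (T - s) ^ (β₁ + β₂ - 1) * ‖f s‖) (Set.Ioo 0 T)) :
    IntervalIntegrable (fun τ => k₁ (T - τ) * halfConv k₂ f τ) volume 0 T ∧
    halfConv k₁ (halfConv k₂ f) T = halfConv (halfConv k₁ k₂) f T := by
  -- Extension by 0 encodes the triangle s < τ < T in the integrand, so that Fubini's theorem
  -- applies on a square.
  set K₁ := (Set.Ioi (0 : ℝ)).indicator k₁ with hK₁
  set K₂ := (Set.Ioi (0 : ℝ)).indicator k₂ with hK₂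
  have hm₁ : Measurable K₁ := measurable_indicator_Ioi hc₁
  have hm₂ : Measurable K₂ := measurable_indicator_Ioi hc₂
  have hK₁e : ∀ x, 0 < x → K₁ x = k₁ x := fun x hx => Set.indicator_of_mem (s := Set.Ioi (0 : ℝ)) hx _
  have hK₂e : ∀ x, 0 < x → K₂ x = k₂ x := fun x hx => Set.indicator_of_mem (s := Set.Ioi (0 : ℝ)) hx _
  have hK₂z : ∀ x, x ≤ 0 → K₂ x = 0 := fun x hx =>
    Set.indicator_of_notMem (s := Set.Ioi (0 : ℝ)) (not_lt.mpr hx) _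
  set F : ℝ × ℝ → ℂ := fun z => (K₁ (T - z.2) * K₂ (z.2 - z.1)) * f z.1 with hF
  set μ := volume.restrict (Set.Ioo 0 T) with hμ
  have hFm : AEStronglyMeasurable F (μ.prod μ) := by
    refine AEStronglyMeasurable.mul (Measurable.aestronglyMeasurable ?_) hfm.comp_fst
    exact (hm₁.comp (by fun_prop)).mul (hm₂.comp (by fun_prop))
  set B := Real.Gamma β₁ * Real.Gamma β₂ / Real.Gamma (β₁ + β₂)
  have hset : ∀ s ∈ Set.Ioo 0 T, Set.Ioo 0 T ∩ Set.Ioo s T = Set.Ioo s T := fun s hs =>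
    Set.inter_eq_right.mpr (Set.Ioo_subset_Ioo_left hs.1.le)
  -- The Beta integral bounds the inner integral by a multiple of (T - s)^{β₁+β₂-1}, the weight
  -- against which ‖f‖ is assumed integrable.
  have hG : ∀ s ∈ Set.Ioo 0 T, Integrable (fun τ => K₁ (T - τ) * K₂ (τ - s)) μ ∧
      ∫ τ, ‖K₁ (T - τ) * K₂ (τ - s)‖ ∂μ ≤ A ^ 2 * B * (T - s) ^ (β₁ + β₂ - 1) := by
    intro s hs
    obtain ⟨hi, hv⟩ := integrableOn_shifted_beta h₁ h₂ hs.2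
    have hi' : Integrable ((Set.Ioo s T).indicator fun τ => A ^ 2 *
        ((T - τ) ^ (β₁ - 1) * (τ - s) ^ (β₂ - 1))) μ := by
      rw [integrable_indicator_iff measurableSet_Ioo, IntegrableOn, hμ,
        Measure.restrict_restrict measurableSet_Ioo, Set.inter_comm, hset s hs]
      exact hi.const_mul _
    have hle : ∀ᵐ τ ∂μ, ‖K₁ (T - τ) * K₂ (τ - s)‖ ≤ (Set.Ioo s T).indicator (fun τ => A ^ 2 *
        ((T - τ) ^ (β₁ - 1) * (τ - s) ^ (β₂ - 1))) τ := by
      filter_upwards [ae_restrict_mem measurableSet_Ioo] with τ hτ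
      rcases le_or_gt τ s with h | h
      · rw [hK₂z _ (by linarith), mul_zero, norm_zero, Set.indicator_of_notMem]
        exact fun h' => absurd h'.1 (not_lt.mpr h)
      · have e1 := hk₁ (T - τ) (by linarith [hτ.2]) (by linarith [hτ.1])
        have e2 := hk₂ (τ - s) (by linarith) (by linarith [hs.1, hτ.2])
        rw [Set.indicator_of_mem (show τ ∈ Set.Ioo s T from ⟨h, hτ.2⟩), norm_mul,
          hK₁e _ (by linarith [hτ.2]), hK₂e _ (by linarith)]
        calc _ ≤ (A * (T - τ) ^ (β₁ - 1)) * (A * (τ - s) ^ (β₂ - 1)) :=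
              mul_le_mul e1 e2 (norm_nonneg _) ((norm_nonneg _).trans e1)
          _ = _ := by ring
    have hint : Integrable (fun τ => K₁ (T - τ) * K₂ (τ - s)) μ :=
      Integrable.mono' hi' ((hm₁.comp (by fun_prop)).mul (hm₂.comp (by fun_prop))).aestronglyMeasurable hle
    refine ⟨hint, (integral_mono_ae hint.norm hi' hle).trans (le_of_eq ?_)⟩
    rw [integral_indicator measurableSet_Ioo, hμ, Measure.restrict_restrict measurableSet_Ioo,
      Set.inter_comm, hset s hs, integral_const_mul, hv]
    ring
  have hFi : Integrable F (μ.prod μ) := by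
    rw [integrable_prod_iff hFm]
    constructor
    · filter_upwards [ae_restrict_mem measurableSet_Ioo] with s hs
      exact (hG s hs).1.mul_const (f s)
    · refine Integrable.mono' (hf.const_mul (A ^ 2 * B)) hFm.norm.integral_prod_right' ?_
      filter_upwards [ae_restrict_mem measurableSet_Ioo] with s hs
      rw [Real.norm_of_nonneg (integral_nonneg fun _ => norm_nonneg _)]
      simp only [hF, norm_mul _ (f _)]
      rw [integral_mul_const, ← mul_assoc]
      exact mul_le_mul_of_nonneg_right (hG s hs).2 (norm_nonneg _)
  have hin : ∀ τ ∈ Set.Ioo 0 T, ∫ s, F (s, τ) ∂μ = k₁ (T - τ) * halfConv k₂ f τ := by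
    intro τ hτ
    simp only [hF, mul_assoc]
    rw [integral_const_mul, hK₁e _ (by linarith [hτ.2]), halfConv,
      intervalIntegral.integral_of_le hτ.1.le, integral_Ioc_eq_integral_Ioo]
    congr 1
    have e : Set.Ioo 0 τ = Set.Ioo 0 T ∩ Set.Ioo 0 τ :=
      (Set.inter_eq_right.mpr (Set.Ioo_subset_Ioo_right hτ.2.le)).symm
    rw [e, ← setIntegral_indicator measurableSet_Ioo]
    refine setIntegral_congr_fun measurableSet_Ioo fun s hs => ?_
    by_cases h : s < τ
    · rw [Set.indicator_of_mem (show s ∈ Set.Ioo 0 τ from ⟨hs.1, h⟩)]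
      simp only [hK₂e _ (sub_pos.mpr h)]
    · rw [Set.indicator_of_notMem (fun h' => h h'.2)]
      simp only [hK₂z _ (sub_nonpos.mpr (not_lt.mp h)), zero_mul]
  have hout : ∀ s ∈ Set.Ioo 0 T, ∫ τ, F (s, τ) ∂μ = halfConv k₁ k₂ (T - s) * f s := by
    intro s hs
    simp only [hF]
    rw [integral_mul_const]
    congr 1
    have e0 := intervalIntegral.integral_comp_sub_right (a := s) (b := T)
      (fun u => k₁ (T - s - u) * k₂ u) s
    rw [sub_self] at e0
    rw [halfConv, ← e0, intervalIntegral.integral_of_le hs.2.le, integral_Ioc_eq_integral_Ioo,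
      ← hset s hs, ← setIntegral_indicator measurableSet_Ioo]
    refine setIntegral_congr_fun measurableSet_Ioo fun τ hτ => ?_
    by_cases h : s < τ
    · rw [Set.indicator_of_mem (show τ ∈ Set.Ioo s T from ⟨h, hτ.2⟩)]
      simp only [hK₂e _ (sub_pos.mpr h), hK₁e _ (sub_pos.mpr hτ.2), sub_sub_sub_cancel_right]
    · rw [Set.indicator_of_notMem (fun h' => h h'.1)]
      simp only [hK₂z _ (sub_nonpos.mpr (not_lt.mp h)), mul_zero]
  constructor
  · rw [intervalIntegrable_iff_integrableOn_Ioo_of_le hT.le]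
    refine hFi.integral_prod_right.congr ?_
    filter_upwards [ae_restrict_mem measurableSet_Ioo] with τ hτ using hin τ hτ
  · have hswap := integral_integral_swap (f := fun s τ => F (s, τ)) hFi
    have e1 : halfConv k₁ (halfConv k₂ f) T = ∫ τ, ∫ s, F (s, τ) ∂μ ∂μ := by
      rw [halfConv, intervalIntegral.integral_of_le hT.le, integral_Ioc_eq_integral_Ioo]
      exact setIntegral_congr_fun measurableSet_Ioo fun τ hτ => (hin τ hτ).symm
    rw [e1, ← hswap, halfConv, intervalIntegral.integral_of_le hT.le, integral_Ioc_eq_integral_Ioo]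
    exact setIntegral_congr_fun measurableSet_Ioo fun s hs => hout s hs

/-- On (0, T] the regular part of the general bound is absorbed into the power, since T^{1-β}
t^{β-1} ≥ 1 for β ≤ 1. -/
lemma exists_prabhakarKernel_bound_Ioc {α β : ℝ} (hα : 0 < α) (hβ : 0 < β) (hβ1 : β ≤ 1) (c : ℝ)
    (ω : ℂ) {T : ℝ} (hT : 0 < T) :
    ∃ A : ℝ, 0 ≤ A ∧ ∀ t, 0 < t → t ≤ T → ‖prabhakarKernel α β c ω t‖ ≤ A * t ^ (β - 1) := by
  obtain ⟨A, y, hA, hy, h⟩ := exists_prabhakarKernel_bound hα hβ c ω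
  have hTb := Real.rpow_pos_of_pos hT (1 - β)
  refine ⟨A * (1 + T ^ (1 - β)) * Real.exp (y * T), by positivity, fun t ht htT => (h t ht).trans ?_⟩
  have htb := Real.rpow_pos_of_pos ht (β - 1)
  have h1 : 1 ≤ T ^ (1 - β) * t ^ (β - 1) := by
    rw [← neg_sub 1 β, Real.rpow_neg ht.le, ← div_eq_mul_inv,
      one_le_div (Real.rpow_pos_of_pos ht _)]
    exact Real.rpow_le_rpow ht.le htT (by linarith)
  have h2 : Real.exp (y * t) ≤ Real.exp (y * T) :=
    Real.exp_le_exp.mpr (mul_le_mul_of_nonneg_left htT hy.le)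
  calc A * (t ^ (β - 1) + 1) * Real.exp (y * t)
      ≤ A * (t ^ (β - 1) + T ^ (1 - β) * t ^ (β - 1)) * Real.exp (y * T) := by gcongr
    _ = _ := by ring

lemma prabhakarIntegral_zero {α : ℝ} {ω : ℂ} {f : ℝ → ℂ} :
    prabhakarIntegral α 0 0 ω f = f := by
  ext t; simp [prabhakarIntegral]

lemma prabhakarIntegral_eq_halfConv {α β c : ℝ} {ω : ℂ} {f : ℝ → ℂ} (hβ : β ≠ 0) :
    prabhakarIntegral α β c ω f = halfConv (prabhakarKernel α β c ω) f := by
  ext t; simp [prabhakarIntegral, halfConv, hβ]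

variable {γ ρ ν α : ℝ} {ω : ℂ}

lemma intervalIntegrable_kernel_mul {α β c : ℝ} {ω : ℂ} {f : ℝ → ℂ} {t : ℝ} (hα : 0 < α)
    (hβ : 0 < β) (hβ1 : β ≤ 1) (ht : 0 < t)
    (hfm : AEStronglyMeasurable f (volume.restrict (Set.Ioo 0 t)))
    (hf : IntegrableOn (fun s => (t - s) ^ (β - 1) * ‖f s‖) (Set.Ioo 0 t)) :
    IntervalIntegrable (fun τ => prabhakarKernel α β c ω (t - τ) * f τ) volume 0 t := by
  obtain ⟨A, hA, hk⟩ := exists_prabhakarKernel_bound_Ioc hα hβ hβ1 c ω ht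
  rw [intervalIntegrable_iff_integrableOn_Ioo_of_le ht.le]
  refine Integrable.mono' (hf.const_mul A) (AEStronglyMeasurable.mul ?_ hfm) ?_
  · refine ContinuousOn.aestronglyMeasurable ?_ measurableSet_Ioo
    exact (continuousOn_prabhakarKernel hα hβ c ω).comp (by fun_prop) fun τ hτ => sub_pos.mpr hτ.2
  · filter_upwards [ae_restrict_mem measurableSet_Ioo] with τ hτ
    rw [norm_mul, ← mul_assoc]
    exact mul_le_mul_of_nonneg_right (hk _ (sub_pos.mpr hτ.2) (by linarith [hτ.1])) (norm_nonneg _)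

/-- The regularized Hilfer-Prabhakar derivative is a single convolution. -/
lemma regHilferPrabhakar_eq (hρ : 0 < ρ) (hρ1 : ρ < 1) (hν0 : 0 ≤ ν) (hν1 : ν ≤ 1) (hα : 0 < α)
    {f : ℝ → ℂ} {t : ℝ} (ht : 0 < t)
    (hf : IntegrableOn (fun s => (t - s) ^ (-ρ) * ‖deriv f s‖) (Set.Ioo 0 t)) :
    PrabhakarIntegrable α (ν * (1 - ρ)) (-(γ * ν)) ω
      (prabhakarIntegral α ((1 - ν) * (1 - ρ)) (-(γ * (1 - ν))) ω (deriv f)) t ∧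
    regHilferPrabhakar γ ρ ν α ω f t =
      halfConv (prabhakarKernel α (1 - ρ) (-γ) ω) (deriv f) t := by
  have h1ρ : 0 < 1 - ρ := by linarith
  have hfm : AEStronglyMeasurable (deriv f) (volume.restrict (Set.Ioo 0 t)) :=
    (measurable_deriv f).aestronglyMeasurable
  -- At ν = 0 and ν = 1 one of the two integrals is the identity by convention and the other is
  -- already the full convolution.
  rcases eq_or_lt_of_le hν0 with h0 | h0
  · subst h0
    refine ⟨Or.inl (by simp), ?_⟩
    simp only [regHilferPrabhakar, zero_mul, mul_zero, neg_zero, sub_zero, one_mul, mul_one]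
    rw [prabhakarIntegral_zero, prabhakarIntegral_eq_halfConv h1ρ.ne']
  rcases eq_or_lt_of_le hν1 with h1 | h1
  · subst h1
    simp only [regHilferPrabhakar, sub_self, zero_mul, mul_zero, neg_zero, one_mul, mul_one]
    rw [prabhakarIntegral_zero, prabhakarIntegral_eq_halfConv h1ρ.ne']
    refine ⟨Or.inr (intervalIntegrable_kernel_mul hα h1ρ (by linarith) ht hfm ?_), rfl⟩
    simpa only [show 1 - ρ - 1 = -ρ by ring] using hf
  have hβ₁ : 0 < ν * (1 - ρ) := by positivity
  have hβ₂ : 0 < (1 - ν) * (1 - ρ) := mul_pos (by linarith) h1ρ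
  obtain ⟨A₁, hA₁, hk₁⟩ := exists_prabhakarKernel_bound_Ioc hα hβ₁ (by nlinarith) (-(γ * ν)) ω ht
  obtain ⟨A₂, hA₂, hk₂⟩ :=
    exists_prabhakarKernel_bound_Ioc hα hβ₂ (by nlinarith) (-(γ * (1 - ν))) ω ht
  have key := halfConv_assoc (A := max A₁ A₂) ht hβ₁ hβ₂
    (continuousOn_prabhakarKernel hα hβ₁ (-(γ * ν)) ω)
    (continuousOn_prabhakarKernel hα hβ₂ (-(γ * (1 - ν))) ω)
    (fun τ h h' => (hk₁ τ h h').trans (mul_le_mul_of_nonneg_right (le_max_left _ _)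
      (Real.rpow_nonneg h.le _)))
    (fun τ h h' => (hk₂ τ h h').trans (mul_le_mul_of_nonneg_right (le_max_right _ _)
      (Real.rpow_nonneg h.le _))) hfm
    (by simpa only [show ν * (1 - ρ) + (1 - ν) * (1 - ρ) - 1 = -ρ by ring] using hf)
  rw [regHilferPrabhakar, prabhakarIntegral_eq_halfConv hβ₂.ne', prabhakarIntegral_eq_halfConv hβ₁.ne']
  refine ⟨Or.inr key.1, key.2.trans (halfConv_congr (fun τ hτ => ?_) (fun _ _ => rfl) ht)⟩
  rw [halfConv_prabhakarKernel hα hβ₁ hβ₂ hτ]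
  congr 1 <;> ring

/-- Absolute convergence of the regularized Hilfer-Prabhakar derivative. -/
lemma hasRegHilferPrabhakar (hρ : 0 < ρ) (hρ1 : ρ < 1) (hν0 : 0 ≤ ν) (hν1 : ν ≤ 1) (hα : 0 < α)
    {f : ℝ → ℂ} (hf : ∀ σ : ℝ, 0 < σ → σ < 1 → ∀ t : ℝ, 0 < t →
      IntegrableOn (fun s => (t - s) ^ (-σ) * ‖deriv f s‖) (Set.Ioo 0 t))
    {t : ℝ} (ht : 0 < t) : HasRegHilferPrabhakar γ ρ ν α ω f t := by
  refine ⟨fun s hs => ?_,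
    (regHilferPrabhakar_eq hρ hρ1 hν0 hν1 hα ht (hf ρ hρ hρ1 t ht)).1⟩
  rcases eq_or_lt_of_le hν1 with h1 | h1
  · subst h1; exact Or.inl (by simp)
  have hβ : 0 < (1 - ν) * (1 - ρ) := mul_pos (by linarith) (by linarith)
  have hfm : AEStronglyMeasurable (deriv f) (volume.restrict (Set.Ioo 0 s)) :=
    (measurable_deriv f).aestronglyMeasurable
  refine Or.inr (intervalIntegrable_kernel_mul hα hβ (by nlinarith) hs hfm ?_)
  -- The inner integral has its own singularity, of order 1 - (1-ν)(1-ρ) instead of ρ; hence the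
  -- hypothesis for all σ in (0,1).
  simpa only [neg_sub] using hf (1 - (1 - ν) * (1 - ρ)) (by nlinarith) (by linarith) s hs

end assoc

/-! ### Fourier inversion, decay and differentiation. -/

section fourier

open Real in
lemma invFourierT_eq (F : ℝ → ℂ) (x : ℝ) :
    invFourierT F x = (1 / (2 * (π : ℂ))) * FourierTransform.fourier F (x / (2 * π)) := by
  rw [invFourierT, Real.fourier_real_eq_integral_exp_smul]
  congr 2; ext k
  rw [smul_eq_mul, mul_comm]
  congr 2
  push_cast
  have : (π : ℂ) ≠ 0 := by exact_mod_cast pi_ne_zero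
  field_simp

/-- The Riemann-Lebesgue lemma. For non-integrable F the integrals are 0 by convention, so no
hypothesis is needed. -/
lemma tendsto_invFourierT_cocompact (F : ℝ → ℂ) :
    Tendsto (invFourierT F) (cocompact ℝ) (𝓝 0) := by
  have h2 : Tendsto (fun x : ℝ => x / (2 * Real.pi)) (cocompact ℝ) (cocompact ℝ) :=
    (Homeomorph.mulRight₀ (2 * Real.pi)⁻¹ (by positivity)).isClosedEmbedding.tendsto_cocompact
  have := ((Real.zero_at_infty_fourier F).comp h2).const_mul (1 / (2 * (Real.pi : ℂ)))
  rw [mul_zero] at this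
  exact this.congr fun x => (invFourierT_eq F x).symm

open Real in
lemma invFourierT_fourierT {g : ℝ → ℂ} (hc : Continuous g) (hi : Integrable g)
    (hF : Integrable (fourierT g)) (x : ℝ) : invFourierT (fourierT g) x = g x := by
  have hpi : (π : ℂ) ≠ 0 := by exact_mod_cast pi_ne_zero
  have e : ∀ ξ : ℝ, FourierTransformInv.fourierInv g ξ = fourierT g ((2 * π) * ξ) := fun ξ => by
    rw [Real.fourierInv_eq', fourierT]
    congr 1; ext v
    rw [smul_eq_mul, mul_comm]
    congr 2
    simp
    ring
  have e' : ∀ ξ : ℝ, FourierTransform.fourier g ξ = fourierT g ((-(2 * π)) * ξ) := fun ξ => by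
    rw [Real.fourier_real_eq_integral_exp_smul, fourierT]
    congr 1; ext v
    rw [smul_eq_mul, mul_comm]
    congr 2
    push_cast
    ring
  have hFi : Integrable (FourierTransform.fourier g) := by
    rw [show FourierTransform.fourier g = fun ξ => fourierT g ((-(2 * π)) * ξ) from funext e']
    exact hF.comp_mul_left' (by simp [pi_ne_zero])
  have h1 := congrFun (hc.fourier_fourierInv_eq hi hFi) x
  rw [← h1, Real.fourier_real_eq_integral_exp_smul, invFourierT]
  simp only [e]
  have h3 := Measure.integral_comp_mul_left
    (fun k : ℝ => fourierT g k * Complex.exp (-(Complex.I * k * x))) (2 * π)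
  have h4 : ((1 / (2 * (π : ℂ)))) = ((|(2 * π)⁻¹| : ℝ) : ℂ) := by
    rw [abs_of_pos (by positivity)]; push_cast; rw [one_div]
  rw [Complex.real_smul] at h3
  rw [h4, ← h3]
  congr 1; ext ξ
  rw [smul_eq_mul, mul_comm]
  congr 2
  push_cast
  ring

lemma norm_exp_I_mul (k x : ℝ) : ‖Complex.exp (-(Complex.I * k * x))‖ = 1 := by
  rw [Complex.norm_exp]; simp

lemma integrable_mul_exp {F : ℝ → ℂ} (hF : Integrable F) (x : ℝ) :
    Integrable fun k : ℝ => F k * Complex.exp (-(Complex.I * k * x)) := by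
  refine hF.mul_bdd (c := 1) (Continuous.aestronglyMeasurable (by fun_prop)) (ae_of_all _ fun k => ?_)
  rw [norm_exp_I_mul]

lemma norm_invFourierT_le {F : ℝ → ℂ} {B : ℝ → ℝ} (hB : Integrable B) (h : ∀ k, ‖F k‖ ≤ B k)
    (x : ℝ) : ‖invFourierT F x‖ ≤ ∫ k, B k := by
  rw [invFourierT, norm_mul]
  have hpi : ‖(1 / (2 * (Real.pi : ℂ)))‖ ≤ 1 := by
    rw [norm_div, norm_mul, Complex.norm_real, Real.norm_of_nonneg Real.pi_pos.le, norm_one,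
      Complex.norm_ofNat, div_le_one (by positivity)]
    linarith [Real.pi_gt_three]
  have h1 : ‖∫ k : ℝ, F k * Complex.exp (-(Complex.I * k * x))‖ ≤ ∫ k, B k :=
    norm_integral_le_of_norm_le hB (ae_of_all _ fun k => by
      rw [norm_mul, norm_exp_I_mul, mul_one]; exact h k)
  have := mul_le_mul hpi h1 (norm_nonneg _) zero_le_one
  linarith

lemma invFourierT_add {F G : ℝ → ℂ} (hF : Integrable F) (hG : Integrable G) (x : ℝ) :
    invFourierT (fun k => F k + G k) x = invFourierT F x + invFourierT G x := by
  simp only [invFourierT, add_mul]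
  rw [integral_add (integrable_mul_exp hF x) (integrable_mul_exp hG x), mul_add]

lemma invFourierT_const_mul (c : ℂ) (F : ℝ → ℂ) (x : ℝ) :
    invFourierT (fun k => c * F k) x = c * invFourierT F x := by
  simp only [invFourierT, mul_assoc c]
  rw [integral_const_mul]; ring

lemma hasDerivAt_invFourierT {F : ℝ → ℂ} (hF : Integrable F)
    (hF' : Integrable fun k : ℝ => (k : ℂ) * F k) (x : ℝ) :
    HasDerivAt (invFourierT F) (invFourierT (fun k : ℝ => -(Complex.I * k) * F k) x) x := by
  have key := hasDerivAt_integral_of_dominated_loc_of_deriv_le (μ := volume)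
    (F := fun (x : ℝ) (k : ℝ) => F k * Complex.exp (-(Complex.I * k * x)))
    (F' := fun (x : ℝ) (k : ℝ) => -(Complex.I * k) * F k * Complex.exp (-(Complex.I * k * x)))
    (x₀ := x) (s := Set.univ) (bound := fun k : ℝ => ‖(k : ℂ) * F k‖) univ_mem
    (Eventually.of_forall fun y => (integrable_mul_exp hF y).aestronglyMeasurable)
    (integrable_mul_exp hF x) ?_ (ae_of_all _ fun k y _ => ?_) hF'.norm
    (ae_of_all _ fun k y _ => ?_)
  · exact key.2.const_mul _
  · have := (integrable_mul_exp (hF'.const_mul (-Complex.I)) x).aestronglyMeasurable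
    refine this.congr (ae_of_all _ fun k => ?_)
    simp only; ring
  · rw [norm_mul, norm_exp_I_mul, mul_one, norm_mul, norm_neg, norm_mul, Complex.norm_I, one_mul,
      ← norm_mul]
  · have h1 : HasDerivAt (fun y : ℝ => -(Complex.I * k * (y : ℂ))) (-(Complex.I * k * 1)) y :=
      ((hasDerivAt_id y).ofReal_comp.const_mul (Complex.I * k)).neg
    refine (h1.cexp.const_mul (F k)).congr_deriv ?_
    ring

end fourier

/-! ### Joint measurability in frequency and time. -/

section measurability

/-- A pointwise limit of finite partial sums; the indicator discards the times at which convergence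
is not known. -/
lemma measurable_gseries_param {ι : Type*} [Countable ι] {C : ℝ → ι → ℂ} {b : ι → ℝ}
    (hC : ∀ i, Measurable fun k => C k i)
    (hs : ∀ k t, 0 < t → Summable fun i => C k i * (rlKernel (b i) t : ℂ)) :
    Measurable fun z : ℝ × ℝ => (Set.Ioi (0 : ℝ)).indicator (gseries (C z.1) b) z.2 := by
  refine measurable_of_tendsto_metrizable' atTop
    (f := fun (s : Finset ι) (z : ℝ × ℝ) => ∑ i ∈ s, (Set.Ioi (0 : ℝ)).indicator
      (fun t => C z.1 i * (rlKernel (b i) t : ℂ)) z.2) (fun s => ?_) ?_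
  · refine Finset.measurable_fun_sum s fun i _ => ?_
    have : (fun z : ℝ × ℝ => (Set.Ioi (0 : ℝ)).indicator
        (fun t => C z.1 i * (rlKernel (b i) t : ℂ)) z.2) =
        {z : ℝ × ℝ | 0 < z.2}.indicator fun z => C z.1 i * (rlKernel (b i) z.2 : ℂ) := by
      ext z; simp [Set.indicator]
    rw [this]
    refine Measurable.indicator ?_ (measurableSet_lt measurable_const measurable_snd)
    exact ((hC i).comp measurable_fst).mul
      (Complex.measurable_ofReal.comp ((measurable_rlKernel _).comp measurable_snd))
  · rw [tendsto_pi_nhds]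
    intro z
    by_cases hz : z.2 ∈ Set.Ioi (0 : ℝ)
    · simp only [Set.indicator_of_mem hz]
      exact (hs z.1 z.2 hz).hasSum
    · simp only [Set.indicator_of_notMem hz, Finset.sum_const_zero]
      exact tendsto_const_nhds

variable {γ ρ α : ℝ} {ω : ℂ} {p ϑ lam : ℝ}

lemma measurable_spaceSymbol : Measurable (spaceSymbol p ϑ lam) := by
  unfold spaceSymbol; fun_prop

lemma spaceSymbol_re : ∀ k, (spaceSymbol p ϑ lam k).re = -(ϑ * |k| ^ lam) := fun k => by
  simp [spaceSymbol]

lemma spaceSymbol_im : ∀ k, (spaceSymbol p ϑ lam k).im = p * k := fun k => by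
  simp [spaceSymbol]

lemma spaceSymbol_re_nonpos (hϑ : 0 < ϑ) (k : ℝ) : (spaceSymbol p ϑ lam k).re ≤ 0 := by
  rw [spaceSymbol_re]
  have := Real.rpow_nonneg (abs_nonneg k) lam
  nlinarith

lemma measurable_resKernel_param (hγ : 0 < γ) (hρ : 0 < ρ) (hα : 0 < α) :
    Measurable fun z : ℝ × ℝ => (Set.Ioi (0 : ℝ)).indicator
      (resKernel γ ρ α ω (spaceSymbol p ϑ lam z.1)) z.2 := by
  refine measurable_gseries_param (C := fun k => resCoeff γ ω (spaceSymbol p ϑ lam k))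
    (fun i => ?_) fun k t ht => ?_
  · exact (measurable_spaceSymbol.pow_const _).mul_const _
  · obtain ⟨y, -, h⟩ := exists_gadm_res hγ hρ hα (spaceSymbol p ϑ lam k) ω
    exact h.summable_term ht

lemma measurable_resKernel_symbol (hγ : 0 < γ) (hρ : 0 < ρ) (hα : 0 < α) {t : ℝ} (ht : 0 < t) :
    Measurable fun k : ℝ => resKernel γ ρ α ω (spaceSymbol p ϑ lam k) t := by
  have := (measurable_resKernel_param (ω := ω) (p := p) (ϑ := ϑ) (lam := lam) hγ hρ hα).comp
    (measurable_id.prodMk (measurable_const (a := t)))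
  simpa [Function.comp_def, Set.indicator_of_mem (show t ∈ Set.Ioi (0 : ℝ) from ht)] using this

lemma measurable_resPrim_symbol (hγ : 0 < γ) (hρ : 0 < ρ) (hα : 0 < α) {t : ℝ} (ht : 0 < t) :
    Measurable fun k : ℝ => resPrim γ ρ α ω (spaceSymbol p ϑ lam k) t := by
  have h := measurable_gseries_param (C := fun k => resCoeff γ ω (spaceSymbol p ϑ lam k))
    (b := fun q => resExp ρ α q + 1)
    (fun i => (measurable_spaceSymbol.pow_const _).mul_const _) (fun k t ht => by
      obtain ⟨y, -, h⟩ := exists_gadm_res hγ hρ hα (spaceSymbol p ϑ lam k) ω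
      exact h.succ.summable_term ht)
  have := h.comp (measurable_id.prodMk (measurable_const (a := t)))
  simpa [Function.comp_def, Set.indicator_of_mem (show t ∈ Set.Ioi (0 : ℝ) from ht), resPrim] using this

end measurability

/-! ### Existence: bounds of the symbol and the equation for its inverse Fourier transform. -/

section solution

variable {γ ρ ν α : ℝ} {ω : ℂ} {p ϑ lam : ℝ} {g : ℝ → ℂ}

/-- Bounds of the resolvent kernel and its primitive by constants that are uniform in the
symbol. -/
structure ResBounds (γ ρ α : ℝ) (ω : ℂ) (A R : ℝ) : Prop where
  hA : 0 < A
  hR : 0 < R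
  bound : ∀ a : ℂ, a.re ≤ 0 → ∀ t, 0 < t →
    ‖resKernel γ ρ α ω a t‖ ≤ A * Real.exp (R * t) * resBound ρ ‖a‖ t

namespace ResBounds

variable {A R : ℝ}

lemma norm_resKernel_le (h : ResBounds γ ρ α ω A R) {a : ℂ} (ha : a.re ≤ 0) {t T : ℝ} (ht : 0 < t)
    (hT : t ≤ T) : ‖resKernel γ ρ α ω a t‖ ≤ A * Real.exp (R * T) * resBound ρ ‖a‖ t := by
  refine (h.bound a ha t ht).trans ?_
  have h1 := h.hA
  have h2 := resBound_nonneg (ρ := ρ) (norm_nonneg a) ht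
  have h3 : Real.exp (R * t) ≤ Real.exp (R * T) :=
    Real.exp_le_exp.mpr (mul_le_mul_of_nonneg_left hT h.hR.le)
  gcongr

lemma norm_resKernel_le' (h : ResBounds γ ρ α ω A R) {a : ℂ} (ha : a.re ≤ 0) {t T : ℝ} (ht : 0 < t)
    (hT : t ≤ T) : ‖resKernel γ ρ α ω a t‖ ≤ A * Real.exp (R * T) / t := by
  have h1 := h.hA
  rw [div_eq_mul_one_div]
  exact (h.norm_resKernel_le ha ht hT).trans
    (mul_le_mul_of_nonneg_left (resBound_le (norm_nonneg a) ht) (by positivity))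

lemma norm_resPrim_le (h : ResBounds γ ρ α ω A R) (hγ : 0 < γ) (hρ : 0 < ρ) (hα : 0 < α) {a : ℂ}
    (ha : a.re ≤ 0) {t T : ℝ} (ht : 0 < t) (hT : t ≤ T) :
    ‖resPrim γ ρ α ω a t‖ ≤ A * Real.exp (R * T) / ρ := by
  obtain ⟨h1, h2⟩ := integral_resBound_le hρ (norm_nonneg a) ht
  have hA := h.hA
  rw [← integral_resKernel hγ hρ hα ht, intervalIntegral.integral_of_le ht.le]
  refine (norm_integral_le_of_norm_le (h1.const_mul (A * Real.exp (R * T))) ?_).trans ?_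
  · filter_upwards [ae_restrict_mem measurableSet_Ioc] with τ hτ
    exact h.norm_resKernel_le ha hτ.1 (hτ.2.trans hT)
  · rw [integral_const_mul, div_eq_mul_one_div]
    exact mul_le_mul_of_nonneg_left h2 (by positivity)

/-- The weighted bound that makes the time derivative converge, uniformly in the symbol. -/
lemma exists_weighted (h : ResBounds γ ρ α ω A R) (hγ : 0 < γ) (hρ : 0 < ρ) (hρ1 : ρ < 1)
    (hα : 0 < α) {t : ℝ} (ht : 0 < t) : ∃ M : ℝ, 0 ≤ M ∧ ∀ a : ℂ, a.re ≤ 0 →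
      IntegrableOn (fun τ => prabhakarKernel α (1 - ρ) (-γ) ω (t - τ) * resKernel γ ρ α ω a τ)
        (Set.Ioo 0 t) ∧
      ∫ τ in Set.Ioo 0 t, ‖prabhakarKernel α (1 - ρ) (-γ) ω (t - τ) * resKernel γ ρ α ω a τ‖ ≤ M := by
  have h1ρ : 0 < 1 - ρ := by linarith
  obtain ⟨A', hA', hk⟩ := exists_prabhakarKernel_bound_Ioc hα h1ρ (by linarith) (-γ) ω ht
  have hA := h.hA
  set c := A' * (A * Real.exp (R * t)) with hc
  have hc0 : 0 ≤ c := by positivity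
  set I := ∫ τ in Set.Ioo 0 t, (t - τ) ^ (-ρ) with hI
  have hI0 : 0 ≤ I := setIntegral_nonneg measurableSet_Ioo fun τ hτ =>
    Real.rpow_nonneg (sub_pos.mpr hτ.2).le _
  -- The splitting at t/2 with f the majorant: its integral is at most 1/ρ and its values at most
  -- 1/τ, so a does not enter.
  refine ⟨c * ((t / 2) ^ (-ρ) * (1 / ρ) + 2 * 1 / t * I), by positivity, fun a ha => ?_⟩
  obtain ⟨h1, h2⟩ := integral_resBound_le hρ (norm_nonneg a) ht
  have h1' := h1.mono_set Set.Ioo_subset_Ioc_self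
  rw [integral_Ioc_eq_integral_Ioo] at h2
  have hmaj : IntegrableOn (fun τ => c * ((t / 2) ^ (-ρ) * resBound ρ ‖a‖ τ +
      2 * 1 / t * (t - τ) ^ (-ρ))) (Set.Ioo 0 t) :=
    ((h1'.const_mul _).add ((integrableOn_sub_rpow hρ1 ht).const_mul _)).const_mul _
  have hle : ∀ τ ∈ Set.Ioo 0 t,
      ‖prabhakarKernel α (1 - ρ) (-γ) ω (t - τ) * resKernel γ ρ α ω a τ‖ ≤
      c * ((t / 2) ^ (-ρ) * resBound ρ ‖a‖ τ + 2 * 1 / t * (t - τ) ^ (-ρ)) := fun τ hτ => by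
    have e1 := hk (t - τ) (sub_pos.mpr hτ.2) (by linarith [hτ.1])
    rw [show 1 - ρ - 1 = -ρ by ring] at e1
    have e2 := h.norm_resKernel_le ha hτ.1 hτ.2.le
    have e3 := weight_mul_le hρ hτ.1 hτ.2 (resBound_nonneg (ρ := ρ) (norm_nonneg a) hτ.1)
      (resBound_le (norm_nonneg a) hτ.1)
    rw [norm_mul]
    calc _ ≤ (A' * (t - τ) ^ (-ρ)) * (A * Real.exp (R * t) * resBound ρ ‖a‖ τ) :=
          mul_le_mul e1 e2 (norm_nonneg _) ((norm_nonneg _).trans e1)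
      _ = c * ((t - τ) ^ (-ρ) * resBound ρ ‖a‖ τ) := by rw [hc]; ring
      _ ≤ _ := mul_le_mul_of_nonneg_left e3 hc0
  have hmeas : AEStronglyMeasurable
      (fun τ => prabhakarKernel α (1 - ρ) (-γ) ω (t - τ) * resKernel γ ρ α ω a τ)
      (volume.restrict (Set.Ioo 0 t)) := by
    refine ContinuousOn.aestronglyMeasurable (ContinuousOn.mul ?_ ?_) measurableSet_Ioo
    · exact (continuousOn_prabhakarKernel hα h1ρ (-γ) ω).comp (by fun_prop) fun τ hτ =>
        sub_pos.mpr hτ.2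
    · exact (continuousOn_resKernel hγ hρ hα).mono fun τ hτ => hτ.1
  have hint := Integrable.mono' hmaj hmeas ((ae_restrict_iff' measurableSet_Ioo).mpr
    (ae_of_all _ hle))
  refine ⟨hint, (setIntegral_mono_on hint.norm hmaj measurableSet_Ioo hle).trans ?_⟩
  rw [integral_const_mul, integral_add (h1'.const_mul _)
    ((integrableOn_sub_rpow hρ1 ht).const_mul _), integral_const_mul, integral_const_mul]
  gcongr

/-- By the resolvent equation the left side is the convolution just bounded. This is the smoothing
effect: for t > 0 the symbol u is O(1/|a|), so the multipliers k (if p ≠ 0) and |k|^lam keep u g*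
integrable. -/
lemma exists_mul_le (h : ResBounds γ ρ α ω A R) (hγ : 0 < γ) (hρ : 0 < ρ) (hρ1 : ρ < 1)
    (hα : 0 < α) {t : ℝ} (ht : 0 < t) :
    ∃ M : ℝ, 0 ≤ M ∧ ∀ a : ℂ, a.re ≤ 0 → ‖a * (1 + resPrim γ ρ α ω a t)‖ ≤ M := by
  obtain ⟨M, hM, hb⟩ := h.exists_weighted hγ hρ hρ1 hα ht
  refine ⟨M, hM, fun a ha => ?_⟩
  rw [← halfConv_resKernel hγ hρ hρ1 hα ht, halfConv, intervalIntegral.integral_of_le ht.le,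
    integral_Ioc_eq_integral_Ioo]
  exact (norm_integral_le_integral_norm _).trans (hb a ha).2

end ResBounds

lemma exists_resBounds (hγ : 0 < γ) (hρ : 0 < ρ) (hρ1 : ρ < 1) (hα : 0 < α) (ω : ℂ) :
    ∃ A R, ResBounds γ ρ α ω A R := by
  obtain ⟨A, R, hA, hR, h⟩ := exists_resKernel_bound hγ hρ hρ1 hα ω
  exact ⟨A, R, hA, hR, h⟩

end solution

section solution

variable {γ ρ ν α : ℝ} {ω : ℂ} {p ϑ lam : ℝ} {G : ℝ → ℂ} {A R : ℝ}

/-- The inverse Fourier transform of `u(k,t) G(k)`, `u` the Fourier symbol of the solution. -/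
noncomputable def symbolSolution (γ ρ α : ℝ) (ω : ℂ) (p ϑ lam : ℝ) (G : ℝ → ℂ) (x t : ℝ) : ℂ :=
  invFourierT (fun k : ℝ => (∑' n : ℕ, symbolTerm γ ρ α ω p ϑ lam k t n) * G k) x

lemma tsum_symbolTerm (hγ : 0 < γ) (hρ : 0 < ρ) (hα : 0 < α) {t : ℝ} (ht : 0 < t) (k : ℝ) :
    ∑' n : ℕ, symbolTerm γ ρ α ω p ϑ lam k t n =
      1 + resPrim γ ρ α ω (spaceSymbol p ϑ lam k) t :=
  (hasSum_symbolTerm hγ hρ hα ht).tsum_eq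

lemma symbolSolution_eq (hγ : 0 < γ) (hρ : 0 < ρ) (hα : 0 < α) {t : ℝ} (ht : 0 < t) (x : ℝ) :
    symbolSolution γ ρ α ω p ϑ lam G x t =
      invFourierT (fun k => (1 + resPrim γ ρ α ω (spaceSymbol p ϑ lam k) t) * G k) x := by
  simp only [symbolSolution, tsum_symbolTerm hγ hρ hα ht]

lemma symbolSolution_zero (hρ : 0 < ρ) (x : ℝ) :
    symbolSolution γ ρ α ω p ϑ lam G x 0 = invFourierT G x := by
  simp only [symbolSolution, (hasSum_symbolTerm_zero hρ).tsum_eq, one_mul]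

namespace ResBounds

lemma integrable_symbol_mul (h : ResBounds γ ρ α ω A R) (hγ : 0 < γ) (hρ : 0 < ρ) (hα : 0 < α)
    (hϑ : 0 < ϑ) (hG : Integrable G) {t : ℝ} (ht : 0 < t) :
    Integrable fun k => (1 + resPrim γ ρ α ω (spaceSymbol p ϑ lam k) t) * G k := by
  refine hG.bdd_mul (c := 1 + A * Real.exp (R * t) / ρ)
    ((measurable_resPrim_symbol hγ hρ hα ht).const_add 1).aestronglyMeasurable
    (ae_of_all _ fun k => ?_)
  refine (norm_add_le _ _).trans ?_
  rw [norm_one]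
  have := h.norm_resPrim_le hγ hρ hα (spaceSymbol_re_nonpos (p := p) (lam := lam) hϑ k) ht le_rfl
  gcongr

lemma integrable_resKernel_mul (h : ResBounds γ ρ α ω A R) (hγ : 0 < γ) (hρ : 0 < ρ) (hα : 0 < α)
    (hϑ : 0 < ϑ) (hG : Integrable G) {t : ℝ} (ht : 0 < t) :
    Integrable fun k => resKernel γ ρ α ω (spaceSymbol p ϑ lam k) t * G k :=
  hG.bdd_mul (measurable_resKernel_symbol hγ hρ hα ht).aestronglyMeasurable
    (ae_of_all _ fun k => h.norm_resKernel_le' (spaceSymbol_re_nonpos hϑ k) ht le_rfl)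

/-- Differentiation under the integral: for times in (t/2, 2t) the resolvent kernel is bounded by a
constant independent of k. -/
lemma hasDerivAt_symbolSolution (h : ResBounds γ ρ α ω A R) (hγ : 0 < γ) (hρ : 0 < ρ) (hα : 0 < α)
    (hϑ : 0 < ϑ) (hG : Integrable G) {t : ℝ} (ht : 0 < t) (x : ℝ) :
    HasDerivAt (symbolSolution γ ρ α ω p ϑ lam G x)
      (invFourierT (fun k => resKernel γ ρ α ω (spaceSymbol p ϑ lam k) t * G k) x) t := by
  have hpos : ∀ s ∈ Metric.ball t (t / 2), t / 2 < s ∧ s < 2 * t := fun s hs => by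
    rw [Metric.mem_ball, Real.dist_eq, abs_lt] at hs
    constructor <;> linarith [hs.1, hs.2]
  have key := hasDerivAt_integral_of_dominated_loc_of_deriv_le (μ := volume)
    (F := fun (s : ℝ) (k : ℝ) => (1 + resPrim γ ρ α ω (spaceSymbol p ϑ lam k) s) * G k *
      Complex.exp (-(Complex.I * k * x)))
    (F' := fun (s : ℝ) (k : ℝ) => resKernel γ ρ α ω (spaceSymbol p ϑ lam k) s * G k *
      Complex.exp (-(Complex.I * k * x)))
    (x₀ := t) (s := Metric.ball t (t / 2))
    (bound := fun k : ℝ => A * Real.exp (R * (2 * t)) / (t / 2) * ‖G k‖)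
    (Metric.ball_mem_nhds t (half_pos ht)) ?_
    (integrable_mul_exp (h.integrable_symbol_mul hγ hρ hα hϑ hG ht) x)
    (integrable_mul_exp (h.integrable_resKernel_mul hγ hρ hα hϑ hG ht) x).aestronglyMeasurable
    (ae_of_all _ fun k s hs => ?_) (hG.norm.const_mul _) (ae_of_all _ fun k s hs => ?_)
  · refine (key.2.const_mul _).congr_of_eventuallyEq ?_
    filter_upwards [Ioi_mem_nhds ht] with s hs
    exact symbolSolution_eq hγ hρ hα hs x
  · filter_upwards [Ioi_mem_nhds ht] with s hs
    exact (integrable_mul_exp (h.integrable_symbol_mul hγ hρ hα hϑ hG hs) x).aestronglyMeasurable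
  · obtain ⟨h1, h2⟩ := hpos s hs
    have hs0 : 0 < s := by linarith
    have hA := h.hA
    rw [norm_mul, norm_exp_I_mul, mul_one, norm_mul]
    refine mul_le_mul_of_nonneg_right ?_ (norm_nonneg _)
    refine (h.norm_resKernel_le' (spaceSymbol_re_nonpos hϑ k) hs0 h2.le).trans ?_
    gcongr
  · have hs0 : 0 < s := by linarith [(hpos s hs).1]
    exact (((hasDerivAt_resPrim hγ hρ hα hs0).const_add 1).mul_const _).mul_const _

/-- By Tonelli: for each k the time integral of the majorant is at most 1/ρ, and G is integrable. -/
lemma integrableOn_majorant (hρ : 0 < ρ) (hG : Integrable G) {b : ℝ} (hb : 0 < b) :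
    IntegrableOn (fun t => ∫ k, resBound ρ ‖spaceSymbol p ϑ lam k‖ t * ‖G k‖) (Set.Ioc 0 b) := by
  set μ := volume.restrict (Set.Ioc 0 b) with hμ
  have hm : AEStronglyMeasurable (fun z : ℝ × ℝ =>
      resBound ρ ‖spaceSymbol p ϑ lam z.1‖ z.2 * ‖G z.1‖) (volume.prod μ) := by
    refine AEStronglyMeasurable.mul (Measurable.aestronglyMeasurable ?_)
      hG.aestronglyMeasurable.norm.comp_fst
    exact measurable_resBound.comp
      (((measurable_spaceSymbol.comp measurable_fst).norm).prodMk measurable_snd)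
  have hi : Integrable (fun z : ℝ × ℝ =>
      resBound ρ ‖spaceSymbol p ϑ lam z.1‖ z.2 * ‖G z.1‖) (volume.prod μ) := by
    rw [integrable_prod_iff hm]
    refine ⟨ae_of_all _ fun k => ?_, ?_⟩
    · exact (integral_resBound_le (A := ‖spaceSymbol p ϑ lam k‖) hρ (norm_nonneg _) hb).1.mul_const
        ‖G k‖
    refine Integrable.mono' (hG.norm.const_mul (1 / ρ)) hm.norm.integral_prod_right'
      (ae_of_all _ fun k => ?_)
    rw [Real.norm_of_nonneg (integral_nonneg fun _ => norm_nonneg _)]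
    simp only [norm_mul, norm_norm]
    rw [integral_mul_const]
    refine mul_le_mul_of_nonneg_right ?_ (norm_nonneg _)
    refine le_trans (le_of_eq ?_) (integral_resBound_le hρ (norm_nonneg (spaceSymbol p ϑ lam k)) hb).2
    refine setIntegral_congr_fun measurableSet_Ioc fun t ht => ?_
    exact Real.norm_of_nonneg (resBound_nonneg (norm_nonneg _) ht.1)
  exact hi.integral_prod_right

lemma norm_deriv_le (h : ResBounds γ ρ α ω A R) (hγ : 0 < γ) (hρ : 0 < ρ) (hα : 0 < α)
    (hϑ : 0 < ϑ) (hG : Integrable G) {t T : ℝ} (ht : 0 < t) (hT : t ≤ T) (x : ℝ) :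
    ‖deriv (symbolSolution γ ρ α ω p ϑ lam G x) t‖ ≤
      A * Real.exp (R * T) * (∫ k, resBound ρ ‖spaceSymbol p ϑ lam k‖ t * ‖G k‖) := by
  rw [(h.hasDerivAt_symbolSolution hγ hρ hα hϑ hG ht x).deriv, ← integral_const_mul]
  have hb : ∀ k, 0 ≤ resBound ρ ‖spaceSymbol p ϑ lam k‖ t := fun k =>
    resBound_nonneg (norm_nonneg _) ht
  have hi : Integrable fun k => resBound ρ ‖spaceSymbol p ϑ lam k‖ t * ‖G k‖ := by
    refine hG.norm.bdd_mul (c := 1 / t) ?_ (ae_of_all _ fun k => ?_)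
    · exact (measurable_resBound.comp
        ((measurable_spaceSymbol.norm).prodMk measurable_const)).aestronglyMeasurable
    · rw [Real.norm_of_nonneg (hb k)]
      exact resBound_le (norm_nonneg _) ht
  refine norm_invFourierT_le (hi.const_mul _) (fun k => ?_) x
  rw [norm_mul, ← mul_assoc]
  exact mul_le_mul_of_nonneg_right (h.norm_resKernel_le (spaceSymbol_re_nonpos hϑ k) ht hT)
    (norm_nonneg _)

/-- The cruder bound c/t, not integrable at 0, complements the integrable one: it controls the
derivative near the endpoint where the fractional weight is singular. -/
lemma norm_deriv_le' (h : ResBounds γ ρ α ω A R) (hγ : 0 < γ) (hρ : 0 < ρ) (hα : 0 < α)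
    (hϑ : 0 < ϑ) (hG : Integrable G) {t T : ℝ} (ht : 0 < t) (hT : t ≤ T) (x : ℝ) :
    ‖deriv (symbolSolution γ ρ α ω p ϑ lam G x) t‖ ≤ A * Real.exp (R * T) * (∫ k, ‖G k‖) / t := by
  rw [(h.hasDerivAt_symbolSolution hγ hρ hα hϑ hG ht x).deriv, mul_div_right_comm,
    ← integral_const_mul]
  refine norm_invFourierT_le (hG.norm.const_mul _) (fun k => ?_) x
  rw [norm_mul]
  exact mul_le_mul_of_nonneg_right (h.norm_resKernel_le' (spaceSymbol_re_nonpos hϑ k) ht hT)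
    (norm_nonneg _)

lemma integrableOn_deriv (h : ResBounds γ ρ α ω A R) (hγ : 0 < γ) (hρ : 0 < ρ) (hα : 0 < α)
    (hϑ : 0 < ϑ) (hG : Integrable G) {b : ℝ} (hb : 0 < b) (x : ℝ) :
    IntegrableOn (deriv (symbolSolution γ ρ α ω p ϑ lam G x)) (Set.Ioc 0 b) := by
  refine Integrable.mono' ((integrableOn_majorant (p := p) (ϑ := ϑ) (lam := lam) hρ hG hb).const_mul
    (A * Real.exp (R * b))) (measurable_deriv _).aestronglyMeasurable ?_
  filter_upwards [ae_restrict_mem measurableSet_Ioc] with t ht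
  exact h.norm_deriv_le hγ hρ hα hϑ hG ht.1 ht.2 x

lemma integrableOn_weighted_deriv (h : ResBounds γ ρ α ω A R) (hγ : 0 < γ) (hρ : 0 < ρ)
    (hα : 0 < α) (hϑ : 0 < ϑ) (hG : Integrable G) (x σ : ℝ) (hσ : 0 < σ) (hσ1 : σ < 1) (t : ℝ)
    (ht : 0 < t) :
    IntegrableOn (fun s => (t - s) ^ (-σ) * ‖deriv (symbolSolution γ ρ α ω p ϑ lam G x) s‖)
      (Set.Ioo 0 t) := by
  have h1 := ((h.integrableOn_deriv (p := p) (lam := lam) hγ hρ hα hϑ hG ht x).mono_set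
    Set.Ioo_subset_Ioc_self).norm
  refine Integrable.mono' ((h1.const_mul ((t / 2) ^ (-σ))).add
    ((integrableOn_sub_rpow hσ1 ht).const_mul
      (2 * (A * Real.exp (R * t) * (∫ k, ‖G k‖)) / t))) ?_ ?_
  · exact (Measurable.aestronglyMeasurable (by fun_prop)).mul h1.aestronglyMeasurable
  · filter_upwards [ae_restrict_mem measurableSet_Ioo] with s hs
    rw [Real.norm_of_nonneg (mul_nonneg (Real.rpow_nonneg (sub_pos.mpr hs.2).le _) (norm_nonneg _))]
    exact weight_mul_le hσ hs.1 hs.2 (norm_nonneg _) (h.norm_deriv_le' hγ hρ hα hϑ hG hs.1 hs.2.le x)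

/-- The time derivative acts on the symbol as multiplication by `ipk - ϑ|k|^lam`. -/
lemma regHilferPrabhakar_symbolSolution (h : ResBounds γ ρ α ω A R) (hγ : 0 < γ) (hρ : 0 < ρ)
    (hρ1 : ρ < 1) (hν0 : 0 ≤ ν) (hν1 : ν ≤ 1) (hα : 0 < α) (hϑ : 0 < ϑ) (hG : Integrable G)
    {t : ℝ} (ht : 0 < t) (x : ℝ) :
    regHilferPrabhakar γ ρ ν α ω (symbolSolution γ ρ α ω p ϑ lam G x) t =
      invFourierT (fun k => spaceSymbol p ϑ lam k *
        ((1 + resPrim γ ρ α ω (spaceSymbol p ϑ lam k) t) * G k)) x := by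
  have h1ρ : 0 < 1 - ρ := by linarith
  rw [(regHilferPrabhakar_eq hρ hρ1 hν0 hν1 hα ht
    (h.integrableOn_weighted_deriv hγ hρ hα hϑ hG x ρ hρ hρ1 t ht)).2, halfConv,
    intervalIntegral.integral_of_le ht.le, integral_Ioc_eq_integral_Ioo]
  set K := prabhakarKernel α (1 - ρ) (-γ) ω with hK
  set μ := volume.restrict (Set.Ioo 0 t) with hμ
  obtain ⟨M, hM, hb⟩ := h.exists_weighted hγ hρ hρ1 hα ht
  set e : ℝ → ℂ := fun k => Complex.exp (-(Complex.I * k * x)) with he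
  set F : ℝ × ℝ → ℂ := fun z =>
    (K (t - z.2) * resKernel γ ρ α ω (spaceSymbol p ϑ lam z.1) z.2) * (G z.1 * e z.1) with hF
  have hGe : Integrable fun k => G k * e k := integrable_mul_exp hG x
  have hFm : AEStronglyMeasurable F (volume.prod μ) := by
    refine AEStronglyMeasurable.mul ?_ hGe.aestronglyMeasurable.comp_fst
    refine AEStronglyMeasurable.mul ?_ ?_
    · refine AEStronglyMeasurable.comp_snd (f := fun τ => K (t - τ)) ?_
      refine ContinuousOn.aestronglyMeasurable ?_ measurableSet_Ioo
      exact (continuousOn_prabhakarKernel hα h1ρ (-γ) ω).comp (by fun_prop) fun τ hτ =>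
        sub_pos.mpr hτ.2
    · refine (measurable_resKernel_param (ω := ω) (p := p) (ϑ := ϑ) (lam := lam) hγ hρ hα).aestronglyMeasurable.congr ?_
      have : ∀ᵐ z : ℝ × ℝ ∂(volume.prod μ), z.2 ∈ Set.Ioo 0 t :=
        Measure.quasiMeasurePreserving_snd.ae (ae_restrict_mem measurableSet_Ioo)
      filter_upwards [this] with z hz
      rw [Set.indicator_of_mem (show z.2 ∈ Set.Ioi (0 : ℝ) from hz.1)]
  have hre := fun k => spaceSymbol_re_nonpos (p := p) (lam := lam) hϑ k
  -- The weighted time integral is at most M for every frequency, so G alone provides integrability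
  -- in k.
  have hFi : Integrable F (volume.prod μ) := by
    rw [integrable_prod_iff hFm]
    refine ⟨ae_of_all _ fun k => (hb _ (hre k)).1.mul_const (G k * e k), ?_⟩
    refine Integrable.mono' (hG.norm.const_mul M) hFm.norm.integral_prod_right'
      (ae_of_all _ fun k => ?_)
    rw [Real.norm_of_nonneg (integral_nonneg fun _ => norm_nonneg _)]
    simp only [hF, norm_mul _ (G _ * _)]
    rw [integral_mul_const, norm_mul (G k), norm_exp_I_mul, mul_one]
    exact mul_le_mul_of_nonneg_right (hb _ (hre k)).2 (norm_nonneg _)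
  have hswap := integral_integral_swap (f := fun k τ => F (k, τ)) hFi
  have h1 : ∀ τ ∈ Set.Ioo 0 t, K (t - τ) * deriv (symbolSolution γ ρ α ω p ϑ lam G x) τ =
      (1 / (2 * (Real.pi : ℂ))) * ∫ k, F (k, τ) := fun τ hτ => by
    rw [(h.hasDerivAt_symbolSolution hγ hρ hα hϑ hG hτ.1 x).deriv, invFourierT, mul_left_comm,
      ← integral_const_mul]
    congr 2; ext k
    simp only [hF]; ring
  rw [setIntegral_congr_fun measurableSet_Ioo h1, integral_const_mul, ← hswap, invFourierT]
  congr 2; ext k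
  simp only [hF]
  rw [integral_mul_const, ← integral_Ioc_eq_integral_Ioo, ← intervalIntegral.integral_of_le ht.le]
  have := halfConv_resKernel (ω := ω) (a := spaceSymbol p ϑ lam k) hγ hρ hρ1 hα ht
  rw [halfConv] at this
  rw [this]
  ring

/-- For each k the primitive of the integrable resolvent kernel tends to 0; the bound uniform in k
gives dominated convergence. -/
lemma tendsto_symbolSolution (h : ResBounds γ ρ α ω A R) (hγ : 0 < γ) (hρ : 0 < ρ)
    (hα : 0 < α) (hϑ : 0 < ϑ) (hG : Integrable G) (x : ℝ) :
    Tendsto (symbolSolution γ ρ α ω p ϑ lam G x) (𝓝[>] 0) (𝓝 (invFourierT G x)) := by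
  have hre := fun k => spaceSymbol_re_nonpos (p := p) (lam := lam) hϑ k
  have hlim : ∀ k, Tendsto (fun t => resPrim γ ρ α ω (spaceSymbol p ϑ lam k) t) (𝓝[>] 0) (𝓝 0) := by
    intro k
    have hi := intervalIntegrable_resKernel (ω := ω) (a := spaceSymbol p ϑ lam k) hγ hρ hα one_pos
    have hc := intervalIntegral.continuousOn_primitive_interval' hi Set.left_mem_uIcc
    have h0 := (hc 0 Set.left_mem_uIcc).tendsto
    rw [intervalIntegral.integral_same, Set.uIcc_of_le zero_le_one] at h0
    have h1 : 𝓝[>] (0 : ℝ) ≤ 𝓝[Set.Icc 0 1] 0 := by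
      rw [nhdsWithin_le_iff]
      exact mem_of_superset (Ioo_mem_nhdsGT zero_lt_one) Set.Ioo_subset_Icc_self
    refine (h0.mono_left h1).congr' ?_
    filter_upwards [self_mem_nhdsWithin] with t ht
    exact integral_resKernel hγ hρ hα ht
  have key : Tendsto (fun t => ∫ k : ℝ, (1 + resPrim γ ρ α ω (spaceSymbol p ϑ lam k) t) * G k *
      Complex.exp (-(Complex.I * k * x))) (𝓝[>] 0)
      (𝓝 (∫ k : ℝ, G k * Complex.exp (-(Complex.I * k * x)))) := by
    refine tendsto_integral_filter_of_dominated_convergence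
      (fun k => (1 + A * Real.exp (R * 1) / ρ) * ‖G k‖) ?_ ?_ (hG.norm.const_mul _)
      (ae_of_all _ fun k => ?_)
    · filter_upwards [self_mem_nhdsWithin] with t ht
      exact (integrable_mul_exp (h.integrable_symbol_mul hγ hρ hα hϑ hG ht) x).aestronglyMeasurable
    · filter_upwards [Ioo_mem_nhdsGT zero_lt_one] with t ht
      refine ae_of_all _ fun k => ?_
      rw [norm_mul, norm_exp_I_mul, mul_one, norm_mul]
      refine mul_le_mul_of_nonneg_right ((norm_add_le _ _).trans ?_) (norm_nonneg _)
      rw [norm_one]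
      have := h.norm_resPrim_le hγ hρ hα (hre k) ht.1 ht.2.le
      gcongr
    · have := (((hlim k).const_add 1).mul_const (G k)).mul_const
        (Complex.exp (-(Complex.I * k * x)))
      simpa using this
  refine (key.const_mul (1 / (2 * (Real.pi : ℂ)))).congr' ?_
  filter_upwards [self_mem_nhdsWithin] with t ht
  exact (symbolSolution_eq hγ hρ hα ht x).symm

end ResBounds

lemma abs_rpow_le_norm_spaceSymbol (hϑ : 0 < ϑ) (k : ℝ) :
    |k| ^ lam ≤ ‖spaceSymbol p ϑ lam k‖ / ϑ := by
  have h1 := Complex.abs_re_le_norm (spaceSymbol p ϑ lam k)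
  rw [spaceSymbol_re, abs_neg, abs_of_nonneg (mul_nonneg hϑ.le (Real.rpow_nonneg (abs_nonneg k) _))] at h1
  rw [le_div_iff₀ hϑ]; linarith

lemma abs_le_norm_spaceSymbol (hp : p ≠ 0) (k : ℝ) :
    |k| ≤ ‖spaceSymbol p ϑ lam k‖ / |p| := by
  have h1 := Complex.abs_im_le_norm (spaceSymbol p ϑ lam k)
  rw [spaceSymbol_im, abs_mul] at h1
  rw [le_div_iff₀ (abs_pos.mpr hp)]; linarith

/-- Existence for the Cauchy problem. -/
theorem isCauchySolution_symbolSolution {g : ℝ → ℂ} (hγ : 0 < γ) (hρ : 0 < ρ)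
    (hρ1 : ρ < 1) (hν0 : 0 ≤ ν) (hν1 : ν ≤ 1) (hα : 0 < α) (hϑ : 0 < ϑ) (hg_cont : Continuous g)
    (hg_int : Integrable g) (hG : Integrable (fourierT g)) :
    IsCauchySolution γ ρ ν α ω p ϑ lam g
      (symbolSolution γ ρ α ω p ϑ lam (fourierT g)) := by
  obtain ⟨A, R, h⟩ := exists_resBounds hγ hρ hρ1 hα ω
  have hd := fun (x t : ℝ) (ht : 0 < t) =>
    h.hasDerivAt_symbolSolution (p := p) (lam := lam) hγ hρ hα hϑ hG ht x
  -- multipliers controlled by the symbol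
  have hmul : ∀ t, 0 < t → ∀ (w : ℝ → ℂ) (c : ℝ), 0 < c → Measurable w →
      (∀ k, ‖w k‖ ≤ ‖spaceSymbol p ϑ lam k‖ / c) →
      Integrable fun k => w k * ((1 + resPrim γ ρ α ω (spaceSymbol p ϑ lam k) t) * fourierT g k) := by
    intro t ht w c hc hw hle
    obtain ⟨M, hM, hb⟩ := h.exists_mul_le hγ hρ hρ1 hα ht
    simp only [← mul_assoc]
    refine hG.bdd_mul (c := M / c) ?_ (ae_of_all _ fun k => ?_)
    · exact (hw.mul ((measurable_resPrim_symbol hγ hρ hα ht).const_add 1)).aestronglyMeasurable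
    · have h1 := hb _ (spaceSymbol_re_nonpos (p := p) (lam := lam) hϑ k)
      rw [norm_mul] at h1 ⊢
      calc _ ≤ ‖spaceSymbol p ϑ lam k‖ / c * ‖1 + resPrim γ ρ α ω (spaceSymbol p ϑ lam k) t‖ :=
            mul_le_mul_of_nonneg_right (hle k) (norm_nonneg _)
        _ = (‖spaceSymbol p ϑ lam k‖ * ‖1 + resPrim γ ρ α ω (spaceSymbol p ϑ lam k) t‖) / c := by ring
        _ ≤ M / c := by gcongr
  have hlamI : ∀ t, 0 < t → Integrable fun k : ℝ => ((|k| ^ lam : ℝ) : ℂ) *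
      ((1 + resPrim γ ρ α ω (spaceSymbol p ϑ lam k) t) * fourierT g k) := fun t ht =>
    hmul t ht _ ϑ hϑ (by fun_prop) fun k => by
      rw [Complex.norm_real, Real.norm_of_nonneg (Real.rpow_nonneg (abs_nonneg k) _)]
      exact abs_rpow_le_norm_spaceSymbol hϑ k
  have hkI : p ≠ 0 → ∀ t, 0 < t → Integrable fun k : ℝ => (k : ℂ) *
      ((1 + resPrim γ ρ α ω (spaceSymbol p ϑ lam k) t) * fourierT g k) := fun hp t ht =>
    hmul t ht _ |p| (abs_pos.mpr hp) (by fun_prop) fun k => by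
      rw [Complex.norm_real, Real.norm_eq_abs]
      exact abs_le_norm_spaceSymbol hp k
  have hfun : ∀ t, 0 < t → (fun y => symbolSolution γ ρ α ω p ϑ lam (fourierT g) y t) =
      invFourierT (fun k => (1 + resPrim γ ρ α ω (spaceSymbol p ϑ lam k) t) * fourierT g k) :=
    fun t ht => funext fun y => symbolSolution_eq hγ hρ hα ht y
  refine ⟨fun x t ht => (hd x t ht).differentiableAt, ?_, ?_, ?_, ?_, ?_, ?_⟩
  · refine ⟨fun t => A * Real.exp (R * t) *
      (∫ k, resBound ρ ‖spaceSymbol p ϑ lam k‖ t * ‖fourierT g k‖), fun b hb => ?_,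
      fun x t ht => h.norm_deriv_le hγ hρ hα hϑ hG ht le_rfl x⟩
    have h1 := ResBounds.integrableOn_majorant (p := p) (ϑ := ϑ) (lam := lam) hρ hG hb
    refine h1.bdd_mul (c := A * Real.exp (R * b)) (Continuous.aestronglyMeasurable (by fun_prop)) ?_
    filter_upwards [ae_restrict_mem measurableSet_Ioc] with t ht
    have hA := h.hA
    rw [Real.norm_of_nonneg (by positivity)]
    exact mul_le_mul_of_nonneg_left (Real.exp_le_exp.mpr
      (mul_le_mul_of_nonneg_left ht.2 h.hR.le)) hA.le
  · intro x t ht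
    exact hasRegHilferPrabhakar hρ hρ1 hν0 hν1 hα
      (fun σ hσ hσ1 t ht => h.integrableOn_weighted_deriv hγ hρ hα hϑ hG x σ hσ hσ1 t ht) ht
  · intro hp x t ht
    rw [hfun t ht]
    exact (hasDerivAt_invFourierT (h.integrable_symbol_mul hγ hρ hα hϑ hG ht)
      (hkI hp t ht) x).differentiableAt
  · intro t ht
    refine ⟨invFourierT fun k : ℝ => -((|k| ^ lam : ℝ) : ℂ) *
      ((1 + resPrim γ ρ α ω (spaceSymbol p ϑ lam k) t) * fourierT g k),
      ⟨_, h.integrable_symbol_mul hγ hρ hα hϑ hG ht, hlamI t ht,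
        fun x => symbolSolution_eq hγ hρ hα ht x, fun x => rfl⟩, fun x => ?_⟩
    rw [h.regHilferPrabhakar_symbolSolution hγ hρ hρ1 hν0 hν1 hα hϑ hG ht x, hfun t ht]
    have hI2 : Integrable fun k : ℝ => (ϑ : ℂ) * (-((|k| ^ lam : ℝ) : ℂ) *
        ((1 + resPrim γ ρ α ω (spaceSymbol p ϑ lam k) t) * fourierT g k)) := by
      refine ((hlamI t ht).const_mul (-(ϑ : ℂ))).congr (ae_of_all _ fun k => ?_)
      simp only; ring
    rw [← invFourierT_const_mul]
    -- For p = 0 the symbol controls only |k|^lam, so k u g* need not be integrable; the first order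
    -- term then has coefficient 0.
    by_cases hp : p = 0
    · subst hp
      simp only [Complex.ofReal_zero, neg_zero, zero_mul, zero_add]
      congr 1; ext k
      rw [spaceSymbol]; push_cast; ring
    · have hI1 : Integrable fun k : ℝ => -(p : ℂ) * (-(Complex.I * k) *
        ((1 + resPrim γ ρ α ω (spaceSymbol p ϑ lam k) t) * fourierT g k)) := by
        refine ((hkI hp t ht).const_mul (p * Complex.I)).congr (ae_of_all _ fun k => ?_)
        simp only; ring
      rw [(hasDerivAt_invFourierT (h.integrable_symbol_mul hγ hρ hα hϑ hG ht) (hkI hp t ht) x).deriv,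
        ← invFourierT_const_mul, ← invFourierT_add hI1 hI2]
      congr 1; ext k
      rw [spaceSymbol]; ring
  · intro x
    rw [symbolSolution_zero hρ, invFourierT_fourierT hg_cont hg_int hG]
    refine ⟨rfl, ?_⟩
    have := h.tendsto_symbolSolution (p := p) (lam := lam) hγ hρ hα hϑ hG x
    rwa [invFourierT_fourierT hg_cont hg_int hG] at this
  · intro t _
    exact tendsto_invFourierT_cocompact _

end solution

/-! ### Band-limited test functions. -/

section testFunctions

open Real in
lemma fourierT_eq (f : ℝ → ℂ) (k : ℝ) :
    fourierT f k = FourierTransformInv.fourierInv f (k / (2 * π)) := by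
  have hpi : (π : ℂ) ≠ 0 := by exact_mod_cast pi_ne_zero
  rw [Real.fourierInv_eq', fourierT]
  congr 1; ext v
  rw [smul_eq_mul, mul_comm]
  congr 2
  simp
  field_simp

-- Compactly supported smooth functions are Schwartz functions, and so are their transforms. This
-- supplies integrable kernels with prescribed Fourier transform.
open Real in
lemma invFourierT_contDiff {χ : ℝ → ℂ} (hχ : ContDiff ℝ (⊤ : ℕ∞) χ) (hc : HasCompactSupport χ) :
    Integrable (invFourierT χ) ∧ ∀ k, fourierT (invFourierT χ) k = χ k := by
  have hpi : (2 * π) ≠ 0 := by positivity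
  have hb : ContDiff ℝ (⊤ : ℕ∞) fun ξ : ℝ => χ ((2 * π) * ξ) := hχ.comp (by fun_prop)
  have hbc : HasCompactSupport fun ξ : ℝ => χ ((2 * π) * ξ) :=
    hc.comp_homeomorph (Homeomorph.mulLeft₀ (2 * π) hpi)
  set b : SchwartzMap ℝ ℂ := hbc.toSchwartzMap hb with hbdef
  have e : invFourierT χ = ⇑(FourierTransform.fourier b) := by
    ext x
    rw [SchwartzMap.fourier_coe, Real.fourier_real_eq_integral_exp_smul, invFourierT]
    have h3 := Measure.integral_comp_mul_left
      (fun k : ℝ => χ k * Complex.exp (-(Complex.I * k * x))) (2 * π)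
    have h4 : ((1 / (2 * (π : ℂ)))) = ((|(2 * π)⁻¹| : ℝ) : ℂ) := by
      rw [abs_of_pos (by positivity)]; push_cast; rw [one_div]
    rw [Complex.real_smul] at h3
    rw [h4, ← h3]
    congr 1; ext ξ
    rw [smul_eq_mul, mul_comm]
    congr 2
    push_cast
    ring
  refine ⟨e ▸ (FourierTransform.fourier b).integrable, fun k => ?_⟩
  rw [fourierT_eq, e, ← SchwartzMap.fourierInv_coe, FourierTransform.fourierInv_fourier_eq]
  change χ ((2 * π) * (k / (2 * π))) = χ k
  rw [mul_div_cancel₀ _ hpi]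

/-- The convolution theorem, by Fubini, in a form that requires of the first factor only that it be
an inverse transform of an integrable function. -/
lemma integral_invFourierT_mul {F η : ℝ → ℂ} (hF : Integrable F) (hη : Integrable η) (y : ℝ) :
    ∫ x, invFourierT F x * η (y - x) = invFourierT (fun k => F k * fourierT η k) y := by
  have hη' : Integrable fun x => η (y - x) := hη.comp_sub_left y
  set H : ℝ × ℝ → ℂ := fun z => η (y - z.1) * F z.2 * Complex.exp (-(Complex.I * z.2 * z.1)) with hH
  have hi : Integrable H (volume.prod volume) := by
    refine (hη'.mul_prod hF).mul_bdd (c := 1) (Continuous.aestronglyMeasurable (by fun_prop))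
      (ae_of_all _ fun z => ?_)
    rw [norm_exp_I_mul]
  have hswap := integral_integral_swap (f := fun x k => H (x, k)) hi
  have e1 : ∀ x, invFourierT F x * η (y - x) = (1 / (2 * (Real.pi : ℂ))) * ∫ k, H (x, k) :=
    fun x => by
      rw [invFourierT, mul_assoc, mul_comm (∫ k : ℝ, _), ← integral_const_mul]
      congr 2; ext k
      simp only [hH]; ring
  simp only [e1]
  rw [integral_const_mul, hswap, invFourierT]
  congr 2; ext k
  rw [fourierT, mul_assoc, ← integral_mul_const, ← integral_const_mul,
    ← integral_sub_left_eq_self _ _ y]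
  congr 1; ext x
  simp only [hH]
  have hexp : Complex.exp (-(Complex.I * k * ((y - x : ℝ) : ℂ))) =
      Complex.exp (Complex.I * k * x) * Complex.exp (-(Complex.I * k * y)) := by
    rw [← Complex.exp_add]; congr 1; push_cast; ring
  rw [hexp, sub_sub_cancel]; ring

/-- Smooth cutoff functions that vanish near `0` and near infinity. -/
noncomputable def cutoff (N : ℝ) (k : ℝ) : ℂ :=
  (((⟨1, 2, one_pos, one_lt_two⟩ : ContDiffBump (0 : ℝ)) (k / N) *
    (1 - (⟨1, 2, one_pos, one_lt_two⟩ : ContDiffBump (0 : ℝ)) (N * k)) : ℝ) : ℂ)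

variable {N : ℝ}

lemma contDiff_cutoff : ContDiff ℝ (⊤ : ℕ∞) (cutoff N) := by
  refine Complex.ofRealCLM.contDiff.comp ?_
  have h := (⟨1, 2, one_pos, one_lt_two⟩ : ContDiffBump (0 : ℝ)).contDiff (n := (⊤ : ℕ∞))
  exact (h.comp (by fun_prop)).mul (contDiff_const.sub (h.comp (by fun_prop)))

lemma norm_cutoff_le (k : ℝ) : ‖cutoff N k‖ ≤ 1 := by
  set f : ContDiffBump (0 : ℝ) := ⟨1, 2, one_pos, one_lt_two⟩ with hf
  have h1 := f.nonneg' (k / N)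
  have h2 := f.le_one (x := k / N)
  have h3 := f.nonneg' (N * k)
  have h4 := f.le_one (x := N * k)
  rw [cutoff, Complex.norm_real, Real.norm_of_nonneg (mul_nonneg h1 (by linarith))]
  nlinarith

lemma cutoff_eq_zero_of_ge (hN : 0 < N) {k : ℝ} (hk : 2 * N ≤ |k|) : cutoff N k = 0 := by
  rw [cutoff, ContDiffBump.zero_of_le_dist _ (x := k / N), zero_mul, Complex.ofReal_zero]
  rw [Real.dist_eq, sub_zero, abs_div, abs_of_pos hN, le_div_iff₀ hN]
  exact hk

lemma cutoff_eq_zero_of_le (hN : 0 < N) {k : ℝ} (hk : |k| ≤ 1 / N) : cutoff N k = 0 := by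
  rw [cutoff, ContDiffBump.one_of_mem_closedBall _ (x := N * k), sub_self, mul_zero,
    Complex.ofReal_zero]
  rw [Metric.mem_closedBall, Real.dist_eq, sub_zero, abs_mul, abs_of_pos hN]
  rwa [le_div_iff₀ hN, mul_comm] at hk

lemma cutoff_eq_one (hN : 0 < N) {k : ℝ} (hk : |k| ≤ N) (hk' : 2 / N ≤ |k|) : cutoff N k = 1 := by
  rw [cutoff, ContDiffBump.one_of_mem_closedBall _ (x := k / N),
    ContDiffBump.zero_of_le_dist _ (x := N * k)]
  · simp
  · rw [Real.dist_eq, sub_zero, abs_mul, abs_of_pos hN]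
    rwa [div_le_iff₀ hN, mul_comm] at hk'
  · rw [Metric.mem_closedBall, Real.dist_eq, sub_zero, abs_div, abs_of_pos hN]
    exact (div_le_one hN).mpr hk

lemma hasCompactSupport_cutoff (hN : 0 < N) : HasCompactSupport (cutoff N) := by
  refine HasCompactSupport.intro (isCompact_Icc (a := -(2 * N)) (b := 2 * N)) fun k hk => ?_
  refine cutoff_eq_zero_of_ge hN ?_
  by_contra h
  exact hk (abs_le.mp (not_le.mp h).le)

/-- The support of the first factor lies in 1/N ≤ |k| ≤ 2N, where the second factor is 1. A
multiplier may thus be cut off by the wider function when it acts on averages with the narrower one.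
-/
lemma cutoff_mul_cutoff (hN : 0 < N) (k : ℝ) : cutoff N k * cutoff (2 * N) k = cutoff N k := by
  rcases le_or_gt (2 * N) |k| with h | h
  · rw [cutoff_eq_zero_of_ge hN h, zero_mul]
  rcases le_or_gt |k| (1 / N) with h' | h'
  · rw [cutoff_eq_zero_of_le hN h', zero_mul]
  rw [cutoff_eq_one (N := 2 * N) (by positivity) h.le, mul_one]
  exact (le_of_eq (by field_simp)).trans h'.le

lemma tendsto_cutoff {k : ℝ} (hk : k ≠ 0) :
    Tendsto (fun n : ℕ => cutoff (n + 1 : ℝ) k) atTop (𝓝 1) := by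
  have hk0 := abs_pos.mpr hk
  obtain ⟨n, hn⟩ := exists_nat_ge (max |k| (2 / |k|))
  refine tendsto_const_nhds.congr' ?_
  filter_upwards [eventually_ge_atTop n] with j hj
  have hj' : (n : ℝ) ≤ j := by exact_mod_cast hj
  have hj0 : (0 : ℝ) < j + 1 := by positivity
  have h1 := (le_max_left _ _).trans hn
  have h2 := (le_max_right _ _).trans hn
  refine (cutoff_eq_one hj0 (by linarith) ?_).symm
  rw [div_le_iff₀ hk0] at h2
  rw [div_le_iff₀ hj0]
  nlinarith

/-- The factor |k|^lam may fail to be smooth at 0, and only there; this is the reason for cutting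
off near 0 as well. -/
lemma contDiff_spaceSymbol_mul_cutoff {p ϑ lam : ℝ} (hN : 0 < N) :
    ContDiff ℝ (⊤ : ℕ∞) fun k => spaceSymbol p ϑ lam k * cutoff N k := by
  rw [contDiff_iff_contDiffAt]
  intro k
  by_cases hk : k = 0
  · subst hk
    refine (contDiffAt_const (c := (0 : ℂ))).congr_of_eventuallyEq ?_
    filter_upwards [Metric.ball_mem_nhds (0 : ℝ) (one_div_pos.mpr hN)] with k hk
    rw [Metric.mem_ball, Real.dist_eq, sub_zero] at hk
    rw [cutoff_eq_zero_of_le hN hk.le, mul_zero]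
  · refine ContDiffAt.mul ?_ contDiff_cutoff.contDiffAt
    unfold spaceSymbol
    have h1 : ContDiffAt ℝ (⊤ : ℕ∞) (fun k : ℝ => |k| ^ lam) k :=
      (contDiffAt_abs hk).rpow_const_of_ne (abs_pos.mpr hk).ne'
    have h2 := Complex.ofRealCLM.contDiff.contDiffAt.comp k h1
    have h3 : ContDiffAt ℝ (⊤ : ℕ∞) (fun k : ℝ => (k : ℂ)) k :=
      Complex.ofRealCLM.contDiff.contDiffAt
    exact (contDiffAt_const.mul h3).sub (contDiffAt_const.mul h2)

lemma hasCompactSupport_mul_cutoff (hN : 0 < N) (w : ℝ → ℂ) :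
    HasCompactSupport fun k => w k * cutoff N k :=
  (hasCompactSupport_cutoff hN).mul_left

end testFunctions

/-! ### Null solutions: regularity and averages in space. -/

section nullSolution

lemma continuous_invFourierT {F : ℝ → ℂ} (hF : Integrable F) : Continuous (invFourierT F) := by
  refine continuous_const.mul (continuous_of_dominated (bound := fun k => ‖F k‖)
    (fun x => (integrable_mul_exp hF x).aestronglyMeasurable) (fun x => ae_of_all _ fun k => ?_)
    hF.norm (ae_of_all _ fun k => by fun_prop))
  rw [norm_mul, norm_exp_I_mul, mul_one]

/-- The convolution of two L¹ functions exists almost everywhere. At the remaining times the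
weighted majorant need not be integrable, so the equation can be averaged only at almost every time.
-/
lemma ae_integrableOn_weight {ρ T : ℝ} {m : ℝ → ℝ} (hρ1 : ρ < 1) (hT : 0 < T)
    (hm : IntegrableOn m (Set.Ioo 0 T)) :
    ∀ᵐ t ∂(volume.restrict (Set.Ioo 0 T)),
      IntegrableOn (fun s => (t - s) ^ (-ρ) * m s) (Set.Ioo 0 t) := by
  have h1 : Integrable ((Set.Ioo 0 T).indicator m) := (integrable_indicator_iff measurableSet_Ioo).mpr hm
  have h2 : Integrable ((Set.Ioo 0 T).indicator fun u : ℝ => u ^ (-ρ)) := by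
    rw [integrable_indicator_iff measurableSet_Ioo, ← intervalIntegrable_iff_integrableOn_Ioo_of_le hT.le]
    exact intervalIntegral.intervalIntegrable_rpow' (by linarith)
  filter_upwards [ae_restrict_of_ae (h1.ae_convolution_exists (ContinuousLinearMap.mul ℝ ℝ) h2),
    ae_restrict_mem measurableSet_Ioo] with t ht htT
  refine (ht.integrableOn (s := Set.Ioo 0 t)).congr_fun (fun s hs => ?_) measurableSet_Ioo
  have hs1 : s ∈ Set.Ioo 0 T := ⟨hs.1, hs.2.trans htT.2⟩
  have hs2 : t - s ∈ Set.Ioo 0 T := ⟨sub_pos.mpr hs.2, by linarith [hs.1, htT.2]⟩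
  simp only [Set.indicator_of_mem hs1, Set.indicator_of_mem hs2, ContinuousLinearMap.mul_apply']
  ring

/-- A solution of the homogeneous problem with zero initial value, extended by `0` to negative
times. The equation is required only at those times at which the time derivative converges
uniformly in `x`. -/
structure IsNullSolution (γ ρ α : ℝ) (ω : ℂ) (p ϑ lam : ℝ) (m : ℝ → ℝ) (φ : ℝ → ℝ → ℂ) : Prop where
  m_int : ∀ a b, IntervalIntegrable m volume a b
  cont_t : ∀ x, Continuous (φ x)
  diff_t : ∀ x t, t ≠ 0 → DifferentiableAt ℝ (φ x) t
  bound : ∀ x t, t ≠ 0 → ‖deriv (φ x) t‖ ≤ m t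
  zero : ∀ x t, t ≤ 0 → φ x t = 0
  equation : ∀ t, 0 < t → ∃ F : ℝ → ℂ, Integrable F ∧
    Integrable (fun k : ℝ => ((|k| ^ lam : ℝ) : ℂ) * F k) ∧ (∀ x, φ x t = invFourierT F x) ∧
    (IntegrableOn (fun s => (t - s) ^ (-ρ) * m s) (Set.Ioo 0 t) →
      (p ≠ 0 → ∀ x, DifferentiableAt ℝ (fun y => φ y t) x) ∧
      ∀ x, halfConv (prabhakarKernel α (1 - ρ) (-γ) ω) (deriv (φ x)) t =
        -(p : ℂ) * deriv (fun y => φ y t) x +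
          ϑ * invFourierT (fun k : ℝ => -((|k| ^ lam : ℝ) : ℂ) * F k) x)

namespace IsNullSolution

variable {γ ρ α : ℝ} {ω : ℂ} {p ϑ lam : ℝ} {m : ℝ → ℝ} {φ : ℝ → ℝ → ℂ}

lemma ae_bound (h : IsNullSolution γ ρ α ω p ϑ lam m φ) (x : ℝ) (μ : Measure ℝ) (hμ : μ ≪ volume) :
    ∀ᵐ t ∂μ, ‖deriv (φ x) t‖ ≤ m t := by
  refine hμ.ae_le ?_
  filter_upwards [compl_mem_ae_iff.mpr (measure_singleton (0 : ℝ))] with t ht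
  exact h.bound x t ht

lemma intervalIntegrable_deriv (h : IsNullSolution γ ρ α ω p ϑ lam m φ) (x a b : ℝ) :
    IntervalIntegrable (deriv (φ x)) volume a b :=
  (h.m_int a b).mono_fun' (measurable_deriv _).aestronglyMeasurable
    (h.ae_bound x _ Measure.restrict_le_self.absolutelyContinuous)

lemma integral_deriv (h : IsNullSolution γ ρ α ω p ϑ lam m φ) (x a b : ℝ) :
    ∫ t in a..b, deriv (φ x) t = φ x b - φ x a :=
  integral_eq_of_hasDerivAt_off_countable _ _ (Set.countable_singleton 0)
    (h.cont_t x).continuousOn (fun t ht => (h.diff_t x t ht.2).hasDerivAt)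
    (h.intervalIntegrable_deriv x a b)

lemma norm_sub_le (h : IsNullSolution γ ρ α ω p ϑ lam m φ) (x a b : ℝ) :
    ‖φ x b - φ x a‖ ≤ |∫ t in a..b, m t| := by
  rw [← h.integral_deriv x a b]
  exact intervalIntegral.norm_integral_le_abs_of_norm_le
    (h.ae_bound x _ Measure.restrict_le_self.absolutelyContinuous) (h.m_int a b)

lemma m_nonneg (h : IsNullSolution γ ρ α ω p ϑ lam m φ) {t : ℝ} (ht : t ≠ 0) : 0 ≤ m t :=
  (norm_nonneg _).trans (h.bound 0 t ht)

lemma integrableOn_m (h : IsNullSolution γ ρ α ω p ϑ lam m φ) {t : ℝ} (ht : 0 < t) :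
    IntegrableOn m (Set.Ioo 0 t) :=
  (intervalIntegrable_iff_integrableOn_Ioo_of_le ht.le).mp (h.m_int 0 t)

lemma norm_le (h : IsNullSolution γ ρ α ω p ϑ lam m φ) (x : ℝ) {t T : ℝ} (ht : 0 < t) (hT : t ≤ T) :
    ‖φ x t‖ ≤ ∫ s in Set.Ioo 0 T, m s := by
  have h1 := h.norm_sub_le x 0 t
  have hnn : 0 ≤ᵐ[volume.restrict (Set.Ioo 0 T)] m := by
    filter_upwards [ae_restrict_mem measurableSet_Ioo] with s hs using h.m_nonneg hs.1.ne'
  have h2 := setIntegral_mono_set (h.integrableOn_m (ht.trans_le hT)) hnn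
    (Set.Ioo_subset_Ioo_right hT).eventuallyLE
  rw [h.zero x 0 le_rfl, sub_zero, intervalIntegral.integral_of_le ht.le,
    integral_Ioc_eq_integral_Ioo, abs_of_nonneg (setIntegral_nonneg measurableSet_Ioo fun s hs =>
      h.m_nonneg hs.1.ne')] at h1
  exact h1.trans h2

lemma continuous_x (h : IsNullSolution γ ρ α ω p ϑ lam m φ) (t : ℝ) :
    Continuous fun x => φ x t := by
  rcases le_or_gt t 0 with ht | ht
  · simp only [h.zero _ t ht]; exact continuous_const
  · obtain ⟨F, hF, -, he, -⟩ := h.equation t ht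
    rw [show (fun x => φ x t) = invFourierT F from funext he]
    exact continuous_invFourierT hF

/-- The primitive of m makes φ continuous in time uniformly in x. Joint continuity is needed for the
joint measurability of the time derivative. -/
lemma continuous_uncurry (h : IsNullSolution γ ρ α ω p ϑ lam m φ) :
    Continuous (Function.uncurry φ) := by
  rw [continuous_iff_continuousAt]
  rintro ⟨x₀, t₀⟩
  have h1 : Tendsto (fun z : ℝ × ℝ => ∫ t in t₀..z.2, m t) (𝓝 (x₀, t₀)) (𝓝 0) := by
    have := (intervalIntegral.continuous_primitive h.m_int t₀).comp continuous_snd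
      |>.tendsto (x₀, t₀)
    simpa [Function.comp_def] using this
  have h2 : Tendsto (fun z : ℝ × ℝ => φ z.1 z.2 - φ z.1 t₀) (𝓝 (x₀, t₀)) (𝓝 0) :=
    squeeze_zero_norm (fun z => h.norm_sub_le z.1 t₀ z.2) (by simpa using h1.abs)
  have h3 : Tendsto (fun z : ℝ × ℝ => φ z.1 t₀) (𝓝 (x₀, t₀)) (𝓝 (φ x₀ t₀)) :=
    ((h.continuous_x t₀).comp continuous_fst).tendsto (x₀, t₀)
  have h4 := h2.add h3
  simpa [ContinuousAt, Function.uncurry_def] using h4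

lemma measurable_deriv_param (h : IsNullSolution γ ρ α ω p ϑ lam m φ) :
    Measurable fun z : ℝ × ℝ => deriv (φ z.1) z.2 :=
  measurable_deriv_with_param h.continuous_uncurry

/-- Averages in `x` commute with convolutions in time. -/
lemma integral_halfConv_mul (h : IsNullSolution γ ρ α ω p ϑ lam m φ) {k θ : ℝ → ℂ} {t : ℝ}
    (ht : 0 < t) (hk : ContinuousOn k (Set.Ioi 0))
    (hkm : IntegrableOn (fun s => ‖k (t - s)‖ * m s) (Set.Ioo 0 t)) (hθ : Integrable θ) (y : ℝ) :
    ∫ x, halfConv k (deriv (φ x)) t * θ (y - x) =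
      halfConv k (fun s => ∫ x, deriv (φ x) s * θ (y - x)) t := by
  set μ := volume.restrict (Set.Ioo 0 t) with hμ
  have hθ' : Integrable fun x => θ (y - x) := hθ.comp_sub_left y
  set H : ℝ × ℝ → ℂ := fun z => (k (t - z.2) * deriv (φ z.1) z.2) * θ (y - z.1) with hH
  have hHi : Integrable H (volume.prod μ) := by
    refine Integrable.mono' (hθ'.norm.mul_prod hkm) ?_ ?_
    · refine AEStronglyMeasurable.mul (AEStronglyMeasurable.mul ?_
        h.measurable_deriv_param.aestronglyMeasurable) hθ'.aestronglyMeasurable.comp_fst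
      refine AEStronglyMeasurable.comp_snd (f := fun s => k (t - s)) ?_
      exact (hk.comp (by fun_prop) fun s hs => sub_pos.mpr hs.2).aestronglyMeasurable
        measurableSet_Ioo
    · have : ∀ᵐ z : ℝ × ℝ ∂(volume.prod μ), z.2 ∈ Set.Ioo 0 t :=
        Measure.quasiMeasurePreserving_snd.ae (ae_restrict_mem measurableSet_Ioo)
      filter_upwards [this] with z hz
      rw [norm_mul, norm_mul, mul_comm]
      exact mul_le_mul_of_nonneg_left (mul_le_mul_of_nonneg_left (h.bound _ _ hz.1.ne')
        (norm_nonneg _)) (norm_nonneg _)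
  have hswap := integral_integral_swap (f := fun x s => H (x, s)) hHi
  have e : ∀ f : ℝ → ℂ, halfConv k f t = ∫ s, k (t - s) * f s ∂μ := fun f => by
    rw [halfConv, intervalIntegral.integral_of_le ht.le, integral_Ioc_eq_integral_Ioo]
  simp only [e, ← integral_mul_const]
  refine hswap.trans (integral_congr_ae (ae_of_all _ fun s => ?_))
  simp only [hH, mul_assoc]
  rw [integral_const_mul]

lemma halfConv_one_deriv (h : IsNullSolution γ ρ α ω p ϑ lam m φ) (x t : ℝ) :
    halfConv (fun _ => 1) (deriv (φ x)) t = φ x t := by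
  simp [halfConv, h.integral_deriv, h.zero x 0 le_rfl]

lemma integral_mul_eq (h : IsNullSolution γ ρ α ω p ϑ lam m φ) {θ : ℝ → ℂ} {t : ℝ} (ht : 0 < t)
    (hθ : Integrable θ) (y : ℝ) : ∫ x, φ x t * θ (y - x) =
      halfConv (fun _ => 1) (fun s => ∫ x, deriv (φ x) s * θ (y - x)) t := by
  rw [← h.integral_halfConv_mul ht continuousOn_const (by simpa using h.integrableOn_m ht) hθ]
  simp only [h.halfConv_one_deriv]

/-- The averages of a null solution, in terms of those of its time derivative of order `ρ`. -/
lemma integral_mul_eq_halfConv (h : IsNullSolution γ ρ α ω p ϑ lam m φ) (hρ : 0 < ρ) (hρ1 : ρ < 1)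
    (hα : 0 < α) {θ : ℝ → ℂ} {t : ℝ} (ht : 0 < t) (hθ : Integrable θ) (y : ℝ) :
    ∫ x, φ x t * θ (y - x) = halfConv (prabhakarKernel α ρ γ ω)
      (halfConv (prabhakarKernel α (1 - ρ) (-γ) ω) fun s => ∫ x, deriv (φ x) s * θ (y - x)) t := by
  have h1ρ : 0 < 1 - ρ := by linarith
  have hθ' : Integrable fun x => θ (y - x) := hθ.comp_sub_left y
  obtain ⟨A₁, hA₁, hk₁⟩ := exists_prabhakarKernel_bound_Ioc hα hρ hρ1.le γ ω ht
  obtain ⟨A₂, hA₂, hk₂⟩ := exists_prabhakarKernel_bound_Ioc hα h1ρ (by linarith) (-γ) ω ht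
  have hwm : AEStronglyMeasurable (fun s => ∫ x, deriv (φ x) s * θ (y - x))
      (volume.restrict (Set.Ioo 0 t)) := by
    have : AEStronglyMeasurable (fun z : ℝ × ℝ => deriv (φ z.2) z.1 * θ (y - z.2))
        ((volume.restrict (Set.Ioo 0 t)).prod volume) :=
      (h.measurable_deriv_param.comp measurable_swap).aestronglyMeasurable.mul
        hθ'.aestronglyMeasurable.comp_snd
    exact this.integral_prod_right'
  have key := (halfConv_assoc (A := max A₁ A₂) ht hρ h1ρ
    (continuousOn_prabhakarKernel hα hρ γ ω) (continuousOn_prabhakarKernel hα h1ρ (-γ) ω)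
    (fun τ h h' => (hk₁ τ h h').trans (mul_le_mul_of_nonneg_right (le_max_left _ _)
      (Real.rpow_nonneg h.le _)))
    (fun τ h h' => (hk₂ τ h h').trans (mul_le_mul_of_nonneg_right (le_max_right _ _)
      (Real.rpow_nonneg h.le _))) hwm ?_).2
  · rw [key, h.integral_mul_eq ht hθ y]
    refine halfConv_congr (fun τ hτ => ?_) (fun _ _ => rfl) ht
    -- The two kernels are complementary: their convolution has parameters 1 and 0 and is the
    -- constant 1, so together they undo the differentiation.
    rw [halfConv_prabhakarKernel hα hρ h1ρ hτ, add_sub_cancel, add_neg_cancel,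
      prabhakarKernel_one_zero hτ]
  · simp only [add_sub_cancel, sub_self, Real.rpow_zero, one_mul]
    refine Integrable.mono' ((h.integrableOn_m ht).mul_const (∫ x, ‖θ (y - x)‖)) hwm.norm ?_
    filter_upwards [ae_restrict_mem measurableSet_Ioo] with s hs
    rw [norm_norm, ← integral_const_mul]
    refine norm_integral_le_of_norm_le (hθ'.norm.const_mul _) (ae_of_all _ fun x => ?_)
    rw [norm_mul]
    exact mul_le_mul_of_nonneg_right (h.bound x s hs.1.ne') (norm_nonneg _)

end IsNullSolution

end nullSolution

namespace IsNullSolution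

variable {γ ρ α : ℝ} {ω : ℂ} {p ϑ lam : ℝ} {m : ℝ → ℝ} {φ : ℝ → ℝ → ℂ} {N : ℝ}

lemma integrableOn_kernel_weight (h : IsNullSolution γ ρ α ω p ϑ lam m φ) (hρ1 : ρ < 1)
    (hρ : 0 < ρ) (hα : 0 < α) {t : ℝ} (ht : 0 < t)
    (hw : IntegrableOn (fun s => (t - s) ^ (-ρ) * m s) (Set.Ioo 0 t)) :
    IntegrableOn (fun s => ‖prabhakarKernel α (1 - ρ) (-γ) ω (t - s)‖ * m s) (Set.Ioo 0 t) := by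
  have h1ρ : 0 < 1 - ρ := by linarith
  obtain ⟨A, hA, hk⟩ := exists_prabhakarKernel_bound_Ioc hα h1ρ (by linarith) (-γ) ω ht
  refine Integrable.mono' (hw.const_mul A) (AEStronglyMeasurable.mul ?_
    (h.integrableOn_m ht).aestronglyMeasurable) ?_
  · exact (((continuousOn_prabhakarKernel hα h1ρ (-γ) ω).comp (by fun_prop)
      fun s hs => sub_pos.mpr hs.2).aestronglyMeasurable measurableSet_Ioo).norm
  · filter_upwards [ae_restrict_mem measurableSet_Ioo] with s hs
    have hm := h.m_nonneg hs.1.ne'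
    have hb := hk (t - s) (sub_pos.mpr hs.2) (by linarith [hs.1])
    rw [show 1 - ρ - 1 = -ρ by ring] at hb
    rw [Real.norm_of_nonneg (mul_nonneg (norm_nonneg _) hm), ← mul_assoc]
    exact mul_le_mul_of_nonneg_right hb hm

lemma norm_halfConv_deriv_le (h : IsNullSolution γ ρ α ω p ϑ lam m φ) {k : ℝ → ℂ} {t : ℝ}
    (ht : 0 < t) (hkm : IntegrableOn (fun s => ‖k (t - s)‖ * m s) (Set.Ioo 0 t)) (x : ℝ) :
    ‖halfConv k (deriv (φ x)) t‖ ≤ ∫ s in Set.Ioo 0 t, ‖k (t - s)‖ * m s := by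
  rw [halfConv, intervalIntegral.integral_of_le ht.le, integral_Ioc_eq_integral_Ioo]
  refine norm_integral_le_of_norm_le hkm ?_
  filter_upwards [ae_restrict_mem measurableSet_Ioo] with s hs
  rw [norm_mul]
  exact mul_le_mul_of_nonneg_left (h.bound x s hs.1.ne') (norm_nonneg _)

/-- On band-limited averages the equation reads as a convolution in `x`. -/
lemma halfConv_average (h : IsNullSolution γ ρ α ω p ϑ lam m φ) (hρ : 0 < ρ) (hρ1 : ρ < 1)
    (hα : 0 < α) (hN : 0 < N) {t : ℝ} (ht : 0 < t)
    (hw : IntegrableOn (fun s => (t - s) ^ (-ρ) * m s) (Set.Ioo 0 t)) (y : ℝ) :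
    halfConv (prabhakarKernel α (1 - ρ) (-γ) ω)
        (fun s => ∫ x, deriv (φ x) s * invFourierT (cutoff N) (y - x)) t =
      ∫ z, (∫ x, φ x t * invFourierT (cutoff N) (z - x)) *
        invFourierT (fun k => spaceSymbol p ϑ lam k * cutoff (2 * N) k) (y - z) := by
  have h1ρ : 0 < 1 - ρ := by linarith
  obtain ⟨F, hF, hFlam, hφF, heq⟩ := h.equation t ht
  obtain ⟨hdx, heq⟩ := heq hw
  set χ := cutoff N with hχ
  set θ := invFourierT χ with hθdef
  obtain ⟨hθ, hθF⟩ := invFourierT_contDiff (contDiff_cutoff (N := N)) (hasCompactSupport_cutoff hN)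
  obtain ⟨hA, hAF⟩ := invFourierT_contDiff (contDiff_spaceSymbol_mul_cutoff (p := p) (ϑ := ϑ)
    (lam := lam) (N := 2 * N) (by positivity)) (hasCompactSupport_mul_cutoff (by positivity) _)
  have hcχ : Continuous χ := contDiff_cutoff.continuous
  have hχi : Integrable χ := hcχ.integrable_of_hasCompactSupport (hasCompactSupport_cutoff hN)
  have hθ' : Integrable fun x => θ (y - x) := hθ.comp_sub_left y
  have hkm := h.integrableOn_kernel_weight hρ1 hρ hα ht hw
  have hFχ : Integrable fun k => F k * χ k :=
    hF.mul_bdd hcχ.aestronglyMeasurable (ae_of_all _ norm_cutoff_le)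
  -- the right-hand side
  have hR : ∫ z, (∫ x, φ x t * θ (z - x)) *
      invFourierT (fun k => spaceSymbol p ϑ lam k * cutoff (2 * N) k) (y - z) =
      invFourierT (fun k => spaceSymbol p ϑ lam k * (F k * χ k)) y := by
    have e : ∀ z, ∫ x, φ x t * θ (z - x) = invFourierT (fun k => F k * χ k) z := fun z => by
      simp only [hφF]
      rw [integral_invFourierT_mul hF hθ z]
      simp only [hθF]; rfl
    simp only [e]
    rw [integral_invFourierT_mul hFχ hA y]
    congr 1; ext k
    -- The average has its frequencies in the support of χ, so the truncated symbol acts on it as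
    -- the full one.
    have hχχ : χ k * cutoff (2 * N) k = χ k := cutoff_mul_cutoff hN k
    rw [hAF, mul_left_comm, mul_assoc (F k), hχχ]
  rw [hR, ← h.integral_halfConv_mul ht (continuousOn_prabhakarKernel hα h1ρ (-γ) ω) hkm hθ y]
  simp only [heq]
  -- the fractional Laplacian
  set L : ℝ → ℂ := fun k => -((|k| ^ lam : ℝ) : ℂ) * F k with hL
  have hLi : Integrable L := by
    refine hFlam.neg.congr (ae_of_all _ fun k => ?_)
    simp [hL]
  have hLb : ∀ x, ‖invFourierT L x‖ ≤ ∫ k, ‖L k‖ := norm_invFourierT_le hLi.norm fun k => le_rfl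
  have hI2 : Integrable fun x => invFourierT L x * θ (y - x) :=
    hθ'.bdd_mul (continuous_invFourierT hLi).aestronglyMeasurable (ae_of_all _ hLb)
  have hL2 : ∫ x, invFourierT L x * θ (y - x) = invFourierT (fun k => L k * χ k) y := by
    rw [integral_invFourierT_mul hLi hθ y]
    simp only [hθF]; rfl
  have hLχ : Integrable fun k => (ϑ : ℂ) * (L k * χ k) :=
    (hLi.mul_bdd hcχ.aestronglyMeasurable (ae_of_all _ norm_cutoff_le)).const_mul _
  by_cases hp : p = 0
  · subst hp
    simp only [Complex.ofReal_zero, neg_zero, zero_mul, zero_add, mul_assoc]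
    rw [integral_const_mul, hL2, ← invFourierT_const_mul]
    congr 1; ext k
    simp only [hL, spaceSymbol]; push_cast; ring
  have hpC : (p : ℂ) ≠ 0 := by exact_mod_cast hp
  -- integration by parts
  set χ' : ℝ → ℂ := fun k => -(Complex.I * k) * cutoff N k with hχ'
  have hχ'd : ContDiff ℝ (⊤ : ℕ∞) χ' :=
    ((contDiff_const.mul Complex.ofRealCLM.contDiff).neg).mul contDiff_cutoff
  obtain ⟨hη, hηF⟩ := invFourierT_contDiff hχ'd (hasCompactSupport_mul_cutoff hN _)
  have hθd : ∀ x, HasDerivAt θ (invFourierT χ' x) x := fun x =>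
    hasDerivAt_invFourierT hχi ((Complex.continuous_ofReal.mul hcχ).integrable_of_hasCompactSupport
      (hasCompactSupport_mul_cutoff hN _)) x
  have hη' : Integrable fun x => invFourierT χ' (y - x) := hη.comp_sub_left y
  -- No bound on the space derivative is assumed; for p ≠ 0 the equation itself, solved for it,
  -- provides one, and this justifies the integration by parts.
  have hdb : ∀ x, ‖deriv (fun y => φ y t) x‖ ≤ (|ϑ| * (∫ k, ‖L k‖) +
      ∫ s in Set.Ioo 0 t, ‖prabhakarKernel α (1 - ρ) (-γ) ω (t - s)‖ * m s) / |p| := fun x => by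
    have e : deriv (fun y => φ y t) x = (ϑ * invFourierT L x -
        halfConv (prabhakarKernel α (1 - ρ) (-γ) ω) (deriv (φ x)) t) / p := by
      rw [heq x]; field_simp [hpC]; ring
    rw [e, norm_div, Complex.norm_real, Real.norm_eq_abs]
    refine div_le_div_of_nonneg_right ((_root_.norm_sub_le _ _).trans (add_le_add ?_
      (h.norm_halfConv_deriv_le ht hkm x))) (abs_nonneg p)
    rw [norm_mul, Complex.norm_real, Real.norm_eq_abs]
    exact mul_le_mul_of_nonneg_left (hLb x) (abs_nonneg ϑ)
  have hI1 : Integrable fun x => deriv (fun y => φ y t) x * θ (y - x) :=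
    hθ'.bdd_mul (measurable_deriv _).aestronglyMeasurable (ae_of_all _ hdb)
  have hφm : AEStronglyMeasurable (fun x => φ x t) := (h.continuous_x t).aestronglyMeasurable
  have hparts : ∫ x, deriv (fun y => φ y t) x * θ (y - x) =
      invFourierT (fun k => F k * χ' k) y := by
    have hb : ∀ x, ‖φ x t‖ ≤ _ := fun x => h.norm_le x ht le_rfl
    have key := integral_mul_deriv_eq_deriv_mul_of_integrable (u := fun x => φ x t)
      (v := fun x => θ (y - x)) (u' := deriv fun y => φ y t) (v' := fun x => -invFourierT χ' (y - x))
      (fun x _ => (hdx hp x).hasDerivAt)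
      (fun x _ => by
        simpa using (hθd (y - x)).comp_const_sub y x)
      (hη'.neg.bdd_mul hφm (ae_of_all _ hb)) hI1 (hθ'.bdd_mul hφm (ae_of_all _ hb))
    simp only [mul_neg, integral_neg, neg_inj] at key
    rw [← key]
    simp only [hφF]
    rw [integral_invFourierT_mul hF hη y]
    simp only [hηF]
  have hFχ' : Integrable fun k => -(p : ℂ) * (F k * χ' k) := by
    have hc' : Continuous χ' := hχ'd.continuous
    obtain ⟨C, hC⟩ := hc'.bounded_above_of_compact_support (hasCompactSupport_mul_cutoff hN _)
    exact (hF.mul_bdd hc'.aestronglyMeasurable (ae_of_all _ hC)).const_mul _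
  simp only [add_mul, mul_assoc]
  rw [integral_add (hI1.const_mul _) (hI2.const_mul _), integral_const_mul, integral_const_mul,
    hparts, hL2, ← invFourierT_const_mul, ← invFourierT_const_mul, ← invFourierT_add hFχ' hLχ]
  congr 1; ext k
  simp only [hL, hχ', hχ, spaceSymbol]; ring

end IsNullSolution

/-- The fractional integral of order ρ gains a factor σ^{-ρ} on e^{στ}; for large σ this makes the
Volterra operator a contraction. -/
lemma integral_weight_exp_le {ρ σ t : ℝ} (hρ : 0 < ρ) (hσ : 0 < σ) (ht : 0 < t) :
    IntegrableOn (fun τ => (t - τ) ^ (ρ - 1) * Real.exp (σ * τ)) (Set.Ioo 0 t) ∧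
    ∫ τ in Set.Ioo 0 t, (t - τ) ^ (ρ - 1) * Real.exp (σ * τ) ≤
      Real.exp (σ * t) * (σ ^ (-ρ) * Real.Gamma ρ) := by
  have hi : IntegrableOn (fun u => u ^ (ρ - 1) * Real.exp (-(σ * u))) (Set.Ioi 0) := by
    simpa [Real.rpow_one] using
      integrableOn_rpow_mul_exp_neg_mul_rpow (s := ρ - 1) (p := 1) (by linarith) one_pos hσ
  have e : ∀ τ, (t - τ) ^ (ρ - 1) * Real.exp (σ * τ) =
      Real.exp (σ * t) * (fun u => u ^ (ρ - 1) * Real.exp (-(σ * u))) (t - τ) := fun τ => by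
    simp only
    rw [mul_left_comm, ← Real.exp_add]
    congr 2; ring
  have hi' : IntervalIntegrable (fun u => u ^ (ρ - 1) * Real.exp (-(σ * u))) volume 0 t :=
    (intervalIntegrable_iff_integrableOn_Ioo_of_le ht.le).mpr (hi.mono_set fun u hu => hu.1)
  simp only [e]
  constructor
  · rw [← intervalIntegrable_iff_integrableOn_Ioo_of_le ht.le]
    have := (hi'.comp_sub_left t).symm
    simp only [sub_self, sub_zero] at this
    exact this.const_mul _
  · rw [← integral_Ioc_eq_integral_Ioo, ← intervalIntegral.integral_of_le ht.le,
      intervalIntegral.integral_const_mul, intervalIntegral.integral_comp_sub_left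
        (fun u => u ^ (ρ - 1) * Real.exp (-(σ * u))) t, sub_self, sub_zero,
      intervalIntegral.integral_of_le ht.le]
    refine mul_le_mul_of_nonneg_left ?_ (Real.exp_pos _).le
    have h1 := Real.integral_rpow_mul_exp_neg_mul_Ioi hρ hσ
    rw [Real.rpow_neg hσ.le, ← Real.inv_rpow hσ.le, ← one_div, ← h1]
    refine setIntegral_mono_set hi ?_ (Eventually.of_forall fun u hu => hu.1)
    filter_upwards [ae_restrict_mem measurableSet_Ioi] with u hu
    exact mul_nonneg (Real.rpow_nonneg (le_of_lt hu) _) (Real.exp_pos _).le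

/-! ### Null solutions vanish. -/

namespace IsNullSolution

variable {γ ρ α : ℝ} {ω : ℂ} {p ϑ lam : ℝ} {m : ℝ → ℝ} {φ : ℝ → ℝ → ℂ} {N : ℝ}

/-- The averages Φ satisfy a Volterra equation: Φ is the time convolution of the kernel e^γ_{α,ρ,ω}
with the space convolution of Φ with B in L¹. Iterating it in the norm with weight e^{-σt} halves
the bound at each step. -/
lemma average_eq_zero (h : IsNullSolution γ ρ α ω p ϑ lam m φ) (hρ : 0 < ρ) (hρ1 : ρ < 1)
    (hα : 0 < α) (hN : 0 < N) (y : ℝ) {T : ℝ} (hT : 0 < T) :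
    ∫ x, φ x T * invFourierT (cutoff N) (y - x) = 0 := by
  set θ := invFourierT (cutoff N) with hθdef
  set B := invFourierT (fun k => spaceSymbol p ϑ lam k * cutoff (2 * N) k) with hB
  have hθ : Integrable θ :=
    (invFourierT_contDiff (contDiff_cutoff (N := N)) (hasCompactSupport_cutoff hN)).1
  have hBi : Integrable B := (invFourierT_contDiff (contDiff_spaceSymbol_mul_cutoff (p := p)
    (ϑ := ϑ) (lam := lam) (N := 2 * N) (by positivity))
    (hasCompactSupport_mul_cutoff (by positivity) _)).1
  set b := ∫ x, ‖B x‖ with hb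
  have hb0 : 0 ≤ b := integral_nonneg fun _ => norm_nonneg _
  obtain ⟨A, hA, hκ⟩ := exists_prabhakarKernel_bound_Ioc hα hρ hρ1.le γ ω hT
  -- The operator norm in the weighted space is at most A b σ^{-ρ} Γ(ρ); σ is taken so large that
  -- this is at most 1/2.
  obtain ⟨σ, hσ, hσ0⟩ : ∃ σ : ℝ, A * b * (σ ^ (-ρ) * Real.Gamma ρ) ≤ 1 / 2 ∧ 0 < σ := by
    have h1 := ((tendsto_rpow_neg_atTop hρ).mul_const (Real.Gamma ρ)).const_mul (A * b)
    rw [zero_mul, mul_zero] at h1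
    exact ((h1.eventually_le_const (by norm_num : (0 : ℝ) < 1 / 2)).and (eventually_gt_atTop 0)).exists
  set C := (∫ s in Set.Ioo 0 T, m s) * ∫ x, ‖θ x‖ with hC
  have hm0 : 0 ≤ ∫ s in Set.Ioo 0 T, m s :=
    setIntegral_nonneg measurableSet_Ioo fun s hs => h.m_nonneg hs.1.ne'
  have hC0 : 0 ≤ C := mul_nonneg hm0 (integral_nonneg fun _ => norm_nonneg _)
  have step : ∀ n : ℕ, ∀ y t, 0 < t → t ≤ T →
      ‖∫ x, φ x t * θ (y - x)‖ ≤ C * (1 / 2) ^ n * Real.exp (σ * t) := by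
    intro n
    induction n with
    | zero =>
      intro y t ht htT
      have h1 : ‖∫ x, φ x t * θ (y - x)‖ ≤ ∫ x, (∫ s in Set.Ioo 0 T, m s) * ‖θ (y - x)‖ :=
        norm_integral_le_of_norm_le ((hθ.comp_sub_left y).norm.const_mul _)
          (ae_of_all _ fun x => by
            rw [norm_mul]
            exact mul_le_mul_of_nonneg_right (h.norm_le x ht htT) (norm_nonneg _))
      rw [integral_const_mul, integral_sub_left_eq_self (fun x => ‖θ x‖) _ y] at h1
      have h2 : 1 ≤ Real.exp (σ * t) := Real.one_le_exp (by positivity)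
      rw [pow_zero, mul_one]
      exact h1.trans (le_mul_of_one_le_right hC0 h2)
    | succ n ih =>
      intro y t ht htT
      obtain ⟨hi, hle⟩ := integral_weight_exp_le hρ hσ0 ht
      set c := C * (1 / 2) ^ n with hc
      have hc0 : 0 ≤ c := by positivity
      rw [h.integral_mul_eq_halfConv hρ hρ1 hα ht hθ y, halfConv,
        intervalIntegral.integral_of_le ht.le, integral_Ioc_eq_integral_Ioo]
      refine (norm_integral_le_of_norm_le (hi.const_mul (A * b * c)) ?_).trans ?_
      -- The averaged equation is known only for almost every τ, which suffices under the time
      -- integral.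
      · filter_upwards [ae_integrableOn_weight hρ1 ht (h.integrableOn_m ht),
          ae_restrict_mem measurableSet_Ioo] with τ hw hτ
        have e1 := hκ (t - τ) (sub_pos.mpr hτ.2) (by linarith [hτ.1])
        have e2 : ‖∫ z, (∫ x, φ x τ * θ (z - x)) * B (y - z)‖ ≤ c * Real.exp (σ * τ) * b := by
          rw [hb, ← integral_sub_left_eq_self (fun x => ‖B x‖) _ y, ← integral_const_mul]
          refine norm_integral_le_of_norm_le ((hBi.comp_sub_left y).norm.const_mul _)
            (ae_of_all _ fun z => ?_)
          rw [norm_mul]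
          exact mul_le_mul_of_nonneg_right (ih z τ hτ.1 (hτ.2.le.trans htT)) (norm_nonneg _)
        rw [norm_mul, h.halfConv_average hρ hρ1 hα hN hτ.1 hw y]
        calc _ ≤ (A * (t - τ) ^ (ρ - 1)) * (c * Real.exp (σ * τ) * b) :=
              mul_le_mul e1 e2 (norm_nonneg _) ((norm_nonneg _).trans e1)
          _ = _ := by ring
      · rw [integral_const_mul]
        have hAbc : 0 ≤ A * b * c := by positivity
        calc _ ≤ A * b * c * (Real.exp (σ * t) * (σ ^ (-ρ) * Real.Gamma ρ)) :=
              mul_le_mul_of_nonneg_left hle hAbc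
          _ = c * Real.exp (σ * t) * (A * b * (σ ^ (-ρ) * Real.Gamma ρ)) := by ring
          _ ≤ c * Real.exp (σ * t) * (1 / 2) := mul_le_mul_of_nonneg_left hσ (by positivity)
          _ = _ := by rw [hc, pow_succ]; ring
  have hlim : Tendsto (fun n : ℕ => C * (1 / 2 : ℝ) ^ n * Real.exp (σ * T)) atTop (𝓝 0) := by
    have := ((tendsto_pow_atTop_nhds_zero_of_lt_one (by norm_num : (0 : ℝ) ≤ 1 / 2)
      (by norm_num)).const_mul C).mul_const (Real.exp (σ * T))
    simpa using this
  exact norm_le_zero_iff.mp (ge_of_tendsto' hlim fun n => step n y T hT le_rfl)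

/-- The averages are the inverse transforms of the truncated F. The cutoffs tend to 1 except at k =
0, a null set, so dominated convergence recovers φ. -/
lemma eq_zero (h : IsNullSolution γ ρ α ω p ϑ lam m φ) (hρ : 0 < ρ) (hρ1 : ρ < 1)
    (hα : 0 < α) (y : ℝ) {t : ℝ} (ht : 0 < t) : φ y t = 0 := by
  obtain ⟨F, hF, -, hφF, -⟩ := h.equation t ht
  have hz : ∀ n : ℕ, invFourierT (fun k => F k * cutoff (n + 1 : ℝ) k) y = 0 := fun n => by
    have hN : (0 : ℝ) < n + 1 := by positivity
    obtain ⟨hθ, hθF⟩ := invFourierT_contDiff (contDiff_cutoff (N := (n + 1 : ℝ)))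
      (hasCompactSupport_cutoff hN)
    rw [← h.average_eq_zero hρ hρ1 hα hN y ht]
    simp only [hφF]
    rw [integral_invFourierT_mul hF hθ y]
    simp only [hθF]
  have key : Tendsto (fun n : ℕ => ∫ k : ℝ, F k * cutoff (n + 1 : ℝ) k *
      Complex.exp (-(Complex.I * k * y))) atTop
      (𝓝 (∫ k : ℝ, F k * Complex.exp (-(Complex.I * k * y)))) := by
    refine tendsto_integral_of_dominated_convergence (fun k => ‖F k‖) (fun n => ?_) hF.norm
      (fun n => ae_of_all _ fun k => ?_) ?_
    · exact (hF.aestronglyMeasurable.mul contDiff_cutoff.continuous.aestronglyMeasurable).mul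
        (Continuous.aestronglyMeasurable (by fun_prop))
    · rw [norm_mul, norm_exp_I_mul, mul_one, norm_mul]
      exact mul_le_of_le_one_right (norm_nonneg _) (norm_cutoff_le k)
    · filter_upwards [compl_mem_ae_iff.mpr (measure_singleton (0 : ℝ))] with k hk
      have := ((tendsto_cutoff hk).const_mul (F k)).mul_const (Complex.exp (-(Complex.I * k * y)))
      simpa using this
  have key' := key.const_mul (1 / (2 * (Real.pi : ℂ)))
  rw [hφF y]
  exact tendsto_nhds_unique key' (tendsto_const_nhds.congr fun n => (hz n).symm)

end IsNullSolution

/-! ### Uniqueness for the Cauchy problem and the conclusion. -/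

section uniqueness

variable {γ ρ ν α : ℝ} {ω : ℂ} {p ϑ lam : ℝ} {g : ℝ → ℂ}

lemma IsCauchySolution.isNullSolution_sub {ψ₁ ψ₂ : ℝ → ℝ → ℂ} (hρ : 0 < ρ)
    (hρ1 : ρ < 1) (hν0 : 0 ≤ ν) (hν1 : ν ≤ 1) (hα : 0 < α)
    (h₁ : IsCauchySolution γ ρ ν α ω p ϑ lam g ψ₁)
    (h₂ : IsCauchySolution γ ρ ν α ω p ϑ lam g ψ₂) :
    ∃ m, IsNullSolution γ ρ α ω p ϑ lam m fun x t => if 0 < t then ψ₁ x t - ψ₂ x t else 0 := by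
  have h1ρ : 0 < 1 - ρ := by linarith
  obtain ⟨m₁, hm₁, hb₁⟩ := h₁.dom_t
  obtain ⟨m₂, hm₂, hb₂⟩ := h₂.dom_t
  set φ : ℝ → ℝ → ℂ := fun x t => if 0 < t then ψ₁ x t - ψ₂ x t else 0 with hφ
  have hpos : ∀ x t, 0 < t → φ x t = ψ₁ x t - ψ₂ x t := fun x t ht => if_pos ht
  have hneg : ∀ x t, t ≤ 0 → φ x t = 0 := fun x t ht => if_neg (not_lt.mpr ht)
  have hd : ∀ x t, 0 < t → HasDerivAt (φ x) (deriv (ψ₁ x) t - deriv (ψ₂ x) t) t := fun x t ht => by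
    refine ((h₁.diff_t x t ht).hasDerivAt.sub (h₂.diff_t x t ht).hasDerivAt).congr_of_eventuallyEq ?_
    filter_upwards [Ioi_mem_nhds ht] with s hs using hpos x s hs
  have hd' : ∀ x t, t < 0 → HasDerivAt (φ x) 0 t := fun x t ht => by
    refine (hasDerivAt_const t (0 : ℂ)).congr_of_eventuallyEq ?_
    filter_upwards [Iio_mem_nhds ht] with s hs using hneg x s (le_of_lt hs)
  -- Nothing is known about the two majorants at times t ≤ 0, where the extended difference
  -- vanishes.
  set m : ℝ → ℝ := (Set.Ioi 0).indicator fun t => m₁ t + m₂ t with hm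
  have hmpos : ∀ t, 0 < t → m t = m₁ t + m₂ t := fun t ht =>
    Set.indicator_of_mem (s := Set.Ioi (0 : ℝ)) ht _
  have hm₁0 : ∀ t, 0 < t → 0 ≤ m₁ t := fun t ht => (norm_nonneg _).trans (hb₁ 0 t ht)
  have hm₂0 : ∀ t, 0 < t → 0 ≤ m₂ t := fun t ht => (norm_nonneg _).trans (hb₂ 0 t ht)
  have hmi : ∀ b, 0 < b → IntegrableOn m (Set.Iic b) := fun b hb => by
    rw [hm, IntegrableOn, integrable_indicator_iff measurableSet_Ioi, IntegrableOn,
      Measure.restrict_restrict measurableSet_Ioi, Set.Ioi_inter_Iic]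
    exact (hm₁ b hb).add (hm₂ b hb)
  refine ⟨m, fun a b => ?_, fun x => ?_, fun x t ht => ?_, fun x t ht => ?_, hneg, fun t ht => ?_⟩
  · have hb : 0 < |a| + |b| + 1 := by positivity
    refine ((hmi _ hb).mono_set fun s hs => ?_).intervalIntegrable
    rw [Set.mem_uIcc] at hs
    rw [Set.mem_Iic]
    have := le_abs_self a
    have := le_abs_self b
    have := abs_nonneg a
    have := abs_nonneg b
    rcases hs with hs | hs <;> linarith [hs.2]
  · rw [continuous_iff_continuousAt]
    intro t
    rcases lt_trichotomy t 0 with ht | rfl | ht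
    · exact (hd' x t ht).continuousAt
    -- At t = 0 the two solutions have the same limit from the right; without this, φ could jump
    -- there and would not be the integral of its derivative.
    · rw [continuousAt_iff_continuous_left'_right']
      constructor
      · refine (continuousWithinAt_const (b := (0 : ℂ))).congr (fun s hs => hneg x s (le_of_lt hs))
          (hneg x 0 le_rfl)
      · have := (h₁.initial x).2.sub (h₂.initial x).2
        rw [sub_self] at this
        rw [ContinuousWithinAt, hneg x 0 le_rfl]
        refine this.congr' ?_
        filter_upwards [self_mem_nhdsWithin] with s hs using (hpos x s hs).symm
    · exact (hd x t ht).continuousAt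
  · rcases ht.lt_or_gt with ht | ht
    · exact (hd' x t ht).differentiableAt
    · exact (hd x t ht).differentiableAt
  · rcases ht.lt_or_gt with ht | ht
    · rw [(hd' x t ht).deriv, norm_zero, hm, Set.indicator_of_notMem (by simpa using ht.le)]
    · rw [(hd x t ht).deriv, hmpos t ht]
      exact (norm_sub_le _ _).trans (add_le_add (hb₁ x t ht) (hb₂ x t ht))
  · obtain ⟨f₁, ⟨F₁, hF₁, hL₁, he₁, hf₁⟩, heq₁⟩ := h₁.equation t ht
    obtain ⟨f₂, ⟨F₂, hF₂, hL₂, he₂, hf₂⟩, heq₂⟩ := h₂.equation t ht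
    have hsub : ∀ {G₁ G₂ : ℝ → ℂ}, Integrable G₁ → Integrable G₂ → ∀ x,
        invFourierT (fun k => G₁ k - G₂ k) x = invFourierT G₁ x - invFourierT G₂ x := by
      intro G₁ G₂ hG₁ hG₂ x
      simp only [invFourierT, sub_mul]
      rw [integral_sub (integrable_mul_exp hG₁ x) (integrable_mul_exp hG₂ x), mul_sub]
    have hL : ∀ k : ℝ, ((|k| ^ lam : ℝ) : ℂ) * (F₁ k - F₂ k) =
        ((|k| ^ lam : ℝ) : ℂ) * F₁ k - ((|k| ^ lam : ℝ) : ℂ) * F₂ k := fun k => mul_sub _ _ _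
    have hxfun : (fun y => φ y t) = fun y => ψ₁ y t - ψ₂ y t := funext fun y => hpos y t ht
    refine ⟨fun k => F₁ k - F₂ k, hF₁.sub hF₂, (hL₁.sub hL₂).congr (ae_of_all _ fun k => (hL k).symm),
      fun x => by rw [hpos x t ht, hsub hF₁ hF₂, ← he₁, ← he₂], fun hw => ⟨fun hp x => ?_, fun x => ?_⟩⟩
    · rw [hxfun]
      exact (h₁.diff_x hp x t ht).sub (h₂.diff_x hp x t ht)
    -- When the weighted m is integrable at t, both time derivatives are absolutely convergent
    -- single convolutions, so they may be subtracted.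
    · have hwt : ∀ f : ℝ → ℂ, (∀ s, 0 < s → ‖deriv f s‖ ≤ m s) →
          IntegrableOn (fun s => (t - s) ^ (-ρ) * ‖deriv f s‖) (Set.Ioo 0 t) := fun f hf => by
        refine Integrable.mono' hw ((Measurable.aestronglyMeasurable (by fun_prop)).mul
          (measurable_deriv f).norm.aestronglyMeasurable) ?_
        filter_upwards [ae_restrict_mem measurableSet_Ioo] with s hs
        have h0 := Real.rpow_nonneg (sub_pos.mpr hs.2).le (-ρ)
        rw [Real.norm_of_nonneg (mul_nonneg h0 (norm_nonneg _))]
        exact mul_le_mul_of_nonneg_left (hf s hs.1) h0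
      have hw₁ := hwt (ψ₁ x) fun s hs => by
        rw [hmpos s hs]; linarith [hb₁ x s hs, hm₂0 s hs]
      have hw₂ := hwt (ψ₂ x) fun s hs => by
        rw [hmpos s hs]; linarith [hb₂ x s hs, hm₁0 s hs]
      have hI : ∀ f : ℝ → ℂ, IntegrableOn (fun s => (t - s) ^ (-ρ) * ‖deriv f s‖) (Set.Ioo 0 t) →
          IntervalIntegrable (fun s => prabhakarKernel α (1 - ρ) (-γ) ω (t - s) * deriv f s)
            volume 0 t := fun f hf =>
        intervalIntegrable_kernel_mul hα h1ρ (by linarith) ht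
          (measurable_deriv f).aestronglyMeasurable
          (by simpa only [show 1 - ρ - 1 = -ρ by ring] using hf)
      have e : halfConv (prabhakarKernel α (1 - ρ) (-γ) ω) (deriv (φ x)) t =
          halfConv (prabhakarKernel α (1 - ρ) (-γ) ω) (deriv (ψ₁ x)) t -
          halfConv (prabhakarKernel α (1 - ρ) (-γ) ω) (deriv (ψ₂ x)) t := by
        rw [halfConv_congr (fun τ _ => rfl) (fun τ hτ => (hd x τ hτ).deriv) ht]
        simp only [halfConv, mul_sub]
        exact intervalIntegral.integral_sub (hI _ hw₁) (hI _ hw₂)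
      rw [e, ← (regHilferPrabhakar_eq hρ hρ1 hν0 hν1 hα ht hw₁).2,
        ← (regHilferPrabhakar_eq hρ hρ1 hν0 hν1 hα ht hw₂).2, heq₁ x, heq₂ x, hf₁, hf₂]
      have hLn : ∀ {F : ℝ → ℂ}, Integrable (fun k : ℝ => ((|k| ^ lam : ℝ) : ℂ) * F k) →
          Integrable fun k : ℝ => -((|k| ^ lam : ℝ) : ℂ) * F k := fun hF =>
        hF.neg.congr (ae_of_all _ fun k => (neg_mul _ _).symm)
      simp only [mul_sub]
      rw [hsub (hLn hL₁) (hLn hL₂)]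
      by_cases hp : p = 0
      · simp only [hp, Complex.ofReal_zero, neg_zero, zero_mul, zero_add]; ring
      · rw [hxfun, deriv_fun_sub (h₁.diff_x hp x t ht) (h₂.diff_x hp x t ht)]; ring

/-- Uniqueness for the Cauchy problem. -/
theorem IsCauchySolution.unique {ψ₁ ψ₂ : ℝ → ℝ → ℂ} (hρ : 0 < ρ)
    (hρ1 : ρ < 1) (hν0 : 0 ≤ ν) (hν1 : ν ≤ 1) (hα : 0 < α)
    (h₁ : IsCauchySolution γ ρ ν α ω p ϑ lam g ψ₁)
    (h₂ : IsCauchySolution γ ρ ν α ω p ϑ lam g ψ₂) (x : ℝ) {t : ℝ} (ht : 0 ≤ t) :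
    ψ₁ x t = ψ₂ x t := by
  rcases ht.eq_or_lt with rfl | ht
  · rw [(h₁.initial x).1, (h₂.initial x).1]
  · obtain ⟨m, h⟩ := h₁.isNullSolution_sub hρ hρ1 hν0 hν1 hα h₂
    have := h.eq_zero hρ hρ1 hα x ht
    rw [if_pos ht] at this
    exact sub_eq_zero.mp this

end uniqueness

theorem mainTheorem8 (γ ρ ν α : ℝ) (ω : ℂ) (p ϑ lam : ℝ) (g : ℝ → ℂ)
    (hγ : 0 < γ) (hρ0 : 0 < ρ) (hρ1 : ρ < 1) (hν0 : 0 ≤ ν) (hν1 : ν ≤ 1) (hα : 0 < α)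
    (hϑ : 0 < ϑ) (hlam0 : 0 < lam) (hlam2 : lam < 2)
    (hg_cont : Continuous g) (hg_int : Integrable g) (hg_fourier : Integrable (fourierT g)) :
    (∀ k t : ℝ, 0 ≤ t → Summable (symbolTerm γ ρ α ω p ϑ lam k t)) ∧
    (∀ t : ℝ, 0 ≤ t →
      Integrable (fun k : ℝ => (∑' n : ℕ, symbolTerm γ ρ α ω p ϑ lam k t n) * fourierT g k)) ∧
    IsCauchySolution γ ρ ν α ω p ϑ lam g
      (fun x t => invFourierT
        (fun k : ℝ => (∑' n : ℕ, symbolTerm γ ρ α ω p ϑ lam k t n) * fourierT g k) x) ∧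
    (∀ ψ : ℝ → ℝ → ℂ, IsCauchySolution γ ρ ν α ω p ϑ lam g ψ →
      ∀ x t : ℝ, 0 ≤ t → ψ x t = invFourierT
        (fun k : ℝ => (∑' n : ℕ, symbolTerm γ ρ α ω p ϑ lam k t n) * fourierT g k) x) := by
  obtain ⟨A, R, hR⟩ := exists_resBounds hγ hρ0 hρ1 hα ω
  have hsol := isCauchySolution_symbolSolution (ω := ω) (p := p) (lam := lam) hγ hρ0 hρ1 hν0 hν1 hα
    hϑ hg_cont hg_int hg_fourier
  refine ⟨fun k t ht => ?_, fun t ht => ?_, hsol, fun ψ hψ x t ht => ?_⟩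
  · rcases ht.eq_or_lt with rfl | ht
    · exact (hasSum_symbolTerm_zero hρ0).summable
    · exact (hasSum_symbolTerm hγ hρ0 hα ht).summable
  · rcases ht.eq_or_lt with rfl | ht
    · simpa only [(hasSum_symbolTerm_zero hρ0).tsum_eq, one_mul] using hg_fourier
    · simpa only [tsum_symbolTerm hγ hρ0 hα ht] using
        hR.integrable_symbol_mul hγ hρ0 hα hϑ hg_fourier ht
  · exact hψ.unique hρ0 hρ1 hν0 hν1 hα hsol x ht
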